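/- **Setting.** Let $(\Omega,\mathcal F,\Pr)$ be a probability space with a filtration $(\mathcal F_t)_{t\ge 0}$, and let $p,m\ge 0$ and $1\le T\le N_1\le N$ be integers. Let $\mathbf u_t\in\mathbb R^p$ be $\mathcal F_t$-measurable for $1\le t\le N$, put $\overline{\mathbf u}_t=[\mathbf u_t\,|\,\mathbf u_{t-1}\,|\dots|\,\mathbf u_{t-T+1}]\in\mathbb R^{Tp}$, and suppose that for some $G_\star\in\mathbb R^{m\times Tp}$ $$\mathbf y_t=G_\star\overline{\mathbf u}_t+\boldsymbol\delta_t\in\mathbb R^m,\qquad \boldsymbol\delta_t \text{ is }\mathcal F_{t-T}\text{-measurable},\qquad N_1\le t\le N .$$ Let $\overline{\mathbf U}$ and $\boldsymbol\Delta$ be the matrices with rows $\overline{\mathbf u}_t^\top$ and $\boldsymbol\delta_t^\top$, $t=N_1,\dots,N$. Write $\|\cdot\|$ for the Euclidean operator norm, $A^\dagger$ for the Moore–Penrose inverse, $\sigma_{\min}(A)$ for the $\min(n,m)$-th singular value of $A\in\mathbb R^{n\times m}$, and $$\widetilde p=p\,\min\{T,\ \log^2(eTp)\,\log^2(Tp)\},\qquad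 \log_+x=\max\{1,\log x\}.$$ Call $\mathbf u_t$ *conditionally mean-zero and 1-subgaussian* if $\mathbb E[\mathbf u_t\mid\mathcal F_{t-1}]=0$ and $\mathbb E[e^{\lambda\langle v,\mathbf u_t\rangle}\mid\mathcal F_{t-1}]\le e^{\lambda^2\|v\|_2^2}$ a.s. for all $v\in\mathbb R^p$, $\lambda\in\mathbb R$. For $\phi\in\mathbb R^{m\times \overline L}$ and features $\mathbf k_t\in\mathbb R^{\overline L}$ that are $\mathcal F_{t-T}$-measurable ($N_1\le t\le N$), let $\boldsymbol\Delta_\phi$ be the matrix with rows $(\boldsymbol\delta_t-\phi\,\mathbf k_t)^\top$, and let $\widehat G_{\mathrm{fil}}(\phi)$ be any minimizer over $H\in\mathbb R^{m\times Tp}$ of $\sum_{t=N_1}^N\|(\mathbf y_t-\phi\,\mathbf k_t)-H\overline{\mathbf u}_t\|_2^2$. Let $\mathcal E=\{\tfrac N2 I\preceq\overline{\mathbf U}^\top\overline{\mathbf U}\preceq 2N I\}$. **Theorem.** There are universal constants $C,c>0$ such that in every such setting, for every $\delta\in(0,1)$: If $\mathbf u_t$ is conditionally mean-zero and 1-subgaussian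 for $1\le t\le N$, then (a) for every fixed positive definite $V_0\in\mathbb R^{m\times m}$, with probability at least $1-\delta$, $$\big\|(\boldsymbol\Delta^\top\boldsymbol\Delta+V_0)^{-1/2}\boldsymbol\Delta^\top\overline{\mathbf U}\big\|\le C\,T^{1/2}\sqrt{\widetilde p+\log\tfrac1\delta+\log\det\!\big(I+\boldsymbol\Delta V_0^{-1}\boldsymbol\Delta^\top\big)^{1/2}}\,;$$ (b) for every fixed $\kappa>0$, with probability at least $1-\delta$, $$\sigma_{\min}(\overline{\mathbf U})^2\,\|\overline{\mathbf U}^\dagger\boldsymbol\Delta\|\le\|\boldsymbol\Delta^\top\overline{\mathbf U}\|\le C\,T^{1/2}\big(\|\boldsymbol\Delta\|+\kappa\big)\sqrt{\widetilde p+m+\log\tfrac1\delta+\log\!\Big(1+\log\!\big(1+\tfrac{\|\boldsymbol\Delta\|}{\kappa}\big)\Big)}\,;$$ (c) for every fixed $\overline L$, $\phi$, $(\mathbf k_t)$ as above and every $\kappa>0$, with probability at least $1-\delta$ the following holds on $\mathcal E$: $$\|\widehat G_{\mathrm{fil}}(\phi)-G_\star\|\le C\,\frac{\big(N^{-1/2}\|\boldsymbol\Delta_\phi\|+\kappa\big)T^{1/2}}{\sqrt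 N}\sqrt{\widetilde p+m+\log\tfrac1\delta+\log_+\!\log_+\!\Big(\tfrac{\|\boldsymbol\Delta_\phi\|}{\kappa N^{1/2}}\Big)}.\qquad(*)$$ That is, the event that $\mathcal E$ occurs and $(*)$ fails has probability at most $\delta$. (d) If moreover $\mathbf u_t\mid\mathcal F_{t-1}\sim\mathcal N(0,I_p)$ for $1\le t\le N$, $N_1\le N/10$ and $N\ge c\,Tp\,\log^2(2Tp)\,\log^2(2Np)$, then for every fixed $\overline L$, $\phi$, $(\mathbf k_t)$ as above and every $\kappa>0$, $(*)$ fails with probability at most $\delta+\delta_{\overline{\mathbf U}}$, where $\delta_{\overline{\mathbf U}}=(2Np)^{-\log^2(2Tp)\,\log(2Np)}$. -/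

import Mathlib

open MeasureTheory ProbabilityTheory
open scoped Matrix MatrixOrder Matrix.Norms.L2Operator

namespace SemiPar

noncomputable section

/-! Throughout, `‖A‖` for a real matrix `A` is the Euclidean (`ℓ² → ℓ²`) operator norm, and
`A ≤ B` for square real matrices is the Loewner order. -/

/-- `log₊ x = max {1, log x}`. -/
def logPlus (x : ℝ) : ℝ := max 1 (Real.log x)

/-- The iterated logarithm `log₊ (log₊ x)`. -/
def lil (x : ℝ) : ℝ := logPlus (logPlus x)

/-- The iterated logarithm `log (1 + log (1 + x))`. -/
def lilOne (x : ℝ) : ℝ := Real.log (1 + Real.log (1 + x))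

/-- `p̃ = p · min {T, log²(e T p) · log²(T p)}`. -/
def pTilde (T p : ℕ) : ℝ :=
  (p : ℝ) * min (T : ℝ)
    (Real.log (Real.exp 1 * (T : ℝ) * (p : ℝ)) ^ 2 * Real.log ((T : ℝ) * (p : ℝ)) ^ 2)

section LinearAlgebra

variable {ι κ : Type*} [Fintype ι] [DecidableEq ι] [Fintype κ] [DecidableEq κ]

/-- The Moore–Penrose inverse `A† = (Aᵀ A)† Aᵀ`, where `(Aᵀ A)†` inverts the nonzero eigenvalues of
the symmetric matrix `Aᵀ A` and keeps the zero ones (in Lean `0⁻¹ = 0`).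
`pinv_penrose` proves the four Penrose equations. -/
def pinv (A : Matrix ι κ ℝ) : Matrix κ ι ℝ :=
  cfc (fun x : ℝ => x⁻¹) (Aᵀ * A) * Aᵀ

/-- The smallest singular value `σ_{n ∧ m}(A)` of `A ∈ ℝ^{n × m}`, the singular values being listed
in decreasing order (Mathlib numbers them from `0`). -/
def sigmaMin (A : Matrix ι κ ℝ) : ℝ :=
  (Matrix.toEuclideanLin A).singularValues (min (Fintype.card ι) (Fintype.card κ) - 1)

end LinearAlgebra

section Model

variable {Ω : Type*} {T N₁ N p m L : ℕ}

/-- The concatenated input `ū_t = [u_t | u_{t-1} | … | u_{t-T+1}] ∈ ℝ^{Tp}`; the coordinate `(j, i)`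
is the `i`-th coordinate of `u_{t-j}`. It is used for `t ≥ T` only. -/
def ubar (T : ℕ) (u : ℕ → Ω → EuclideanSpace ℝ (Fin p)) (t : ℕ) (ω : Ω) :
    EuclideanSpace ℝ (Fin T × Fin p) :=
  WithLp.toLp 2 fun ji => u (t - (ji.1 : ℕ)) ω ji.2

/-- The random matrix whose rows are `x_{N₁}ᵀ, …, x_Nᵀ`. -/
def rowMatrix {d : Type*} (N₁ N : ℕ) (x : ℕ → Ω → EuclideanSpace ℝ d) (ω : Ω) :
    Matrix (Finset.Icc N₁ N) d ℝ :=
  Matrix.of fun t i => x (t : ℕ) ω i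

/-- The matrix `Ū` whose rows are `ū_{N₁}ᵀ, …, ū_Nᵀ`. -/
def Ubar (T N₁ N : ℕ) (u : ℕ → Ω → EuclideanSpace ℝ (Fin p)) (ω : Ω) :
    Matrix (Finset.Icc N₁ N) (Fin T × Fin p) ℝ :=
  rowMatrix N₁ N (ubar T u) ω

/-- The serial semi-parametric model `y_t = G ū_t + e_t` for `N₁ ≤ t ≤ N`, with `u_t` being
`ℱ_t`-measurable and the errors `e_t` being `ℱ_{t-T}`-measurable. -/
structure SemiParametricModel [mΩ : MeasurableSpace Ω] (ℱ : Filtration ℕ mΩ)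
    (T N₁ N : ℕ) (G : Matrix (Fin m) (Fin T × Fin p) ℝ)
    (u : ℕ → Ω → EuclideanSpace ℝ (Fin p)) (y e : ℕ → Ω → EuclideanSpace ℝ (Fin m)) : Prop where
  input_adapted : ∀ t ∈ Finset.Icc 1 N, StronglyMeasurable[ℱ t] (u t)
  error_adapted : ∀ t ∈ Finset.Icc N₁ N, StronglyMeasurable[ℱ (t - T)] (e t)
  observation : ∀ t ∈ Finset.Icc N₁ N, ∀ ω,
    y t ω = Matrix.toEuclideanLin G (ubar T u t ω) + e t ω

/-- `X` is mean-zero conditionally on the `σ`-algebra `ℋ`. -/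
def CondMeanZero [MeasurableSpace Ω] (μ : Measure Ω)
    (X : Ω → EuclideanSpace ℝ (Fin p)) (ℋ : MeasurableSpace Ω) : Prop :=
  Integrable X μ ∧ μ[X | ℋ] =ᵐ[μ] 0

/-- `X` is `1`-subgaussian conditionally on `ℋ`:
`𝔼[exp(a ⟨v, X⟩) | ℋ] ≤ exp(a² ‖v‖²)` almost surely, for all `v` and all real `a`. -/
def CondSubgaussian [MeasurableSpace Ω] (μ : Measure Ω)
    (X : Ω → EuclideanSpace ℝ (Fin p)) (ℋ : MeasurableSpace Ω) : Prop :=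
  ∀ (v : EuclideanSpace ℝ (Fin p)) (a : ℝ),
    Integrable (fun ω => Real.exp (a * inner ℝ v (X ω))) μ ∧
    μ[fun ω => Real.exp (a * inner ℝ v (X ω)) | ℋ] ≤ᵐ[μ] fun _ => Real.exp (a ^ 2 * ‖v‖ ^ 2)

/-- `X | ℋ ∼ 𝒩(0, I)`: the conditional probability of `{X ∈ B}` given `ℋ` is almost surely the
standard Gaussian measure of `B`, for all Borel sets `B`. -/
def CondStdGaussian [MeasurableSpace Ω] (μ : Measure Ω)
    (X : Ω → EuclideanSpace ℝ (Fin p)) (ℋ : MeasurableSpace Ω) : Prop :=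
  ∀ B : Set (EuclideanSpace ℝ (Fin p)), MeasurableSet B →
    μ[(X ⁻¹' B).indicator (fun _ => (1 : ℝ)) | ℋ]
      =ᵐ[μ] fun _ => (stdGaussian (EuclideanSpace ℝ (Fin p))).real B

/-- The filtered sequence `x_t - φ k_t`. -/
def filtered (φ : Matrix (Fin m) (Fin L) ℝ) (k : ℕ → Ω → EuclideanSpace ℝ (Fin L))
    (x : ℕ → Ω → EuclideanSpace ℝ (Fin m)) (t : ℕ) (ω : Ω) : EuclideanSpace ℝ (Fin m) :=
  x t ω - Matrix.toEuclideanLin φ (k t ω)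

/-- The least-squares objective `∑_{t = N₁}^N ‖x_t - H ū_t‖₂²`. -/
def lsObjective (T N₁ N : ℕ) (u : ℕ → Ω → EuclideanSpace ℝ (Fin p))
    (x : ℕ → Ω → EuclideanSpace ℝ (Fin m)) (ω : Ω) (H : Matrix (Fin m) (Fin T × Fin p) ℝ) : ℝ :=
  ∑ t ∈ Finset.Icc N₁ N, ‖x t ω - Matrix.toEuclideanLin H (ubar T u t ω)‖ ^ 2

/-- `H` is a value at `ω` of the fixed-filter least-squares estimator, that is, a minimizer of
`∑_{t = N₁}^N ‖(y_t - φ k_t) - H ū_t‖₂²`. -/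
def IsFixedFilterEstimate (N₁ N : ℕ) (u : ℕ → Ω → EuclideanSpace ℝ (Fin p))
    (y : ℕ → Ω → EuclideanSpace ℝ (Fin m)) (k : ℕ → Ω → EuclideanSpace ℝ (Fin L))
    (φ : Matrix (Fin m) (Fin L) ℝ) (ω : Ω) (H : Matrix (Fin m) (Fin T × Fin p) ℝ) : Prop :=
  IsMinOn (lsObjective T N₁ N u (filtered φ k y) ω) Set.univ H

/-- The event `(N/2) I ≼ Ūᵀ Ū ≼ 2 N I`. -/
def wellConditioned (T N₁ N : ℕ) (u : ℕ → Ω → EuclideanSpace ℝ (Fin p)) : Set Ω :=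
  {ω | ((N : ℝ) / 2) • (1 : Matrix (Fin T × Fin p) (Fin T × Fin p) ℝ)
        ≤ (Ubar T N₁ N u ω)ᵀ * Ubar T N₁ N u ω ∧
      (Ubar T N₁ N u ω)ᵀ * Ubar T N₁ N u ω
        ≤ (2 * (N : ℝ)) • (1 : Matrix (Fin T × Fin p) (Fin T × Fin p) ℝ)}

/-- `δ_Ū = (2 N p)^{- log²(2 T p) · log(2 N p)}`. -/
def deltaU (T N p : ℕ) : ℝ :=
  (2 * (N : ℝ) * (p : ℝ)) ^
    (-(Real.log (2 * (T : ℝ) * (p : ℝ)) ^ 2 * Real.log (2 * (N : ℝ) * (p : ℝ))))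

/-- The error bound for a fixed filter, as a function of `D = ‖Δ_φ‖`, without the universal
constant. -/
def filterRate (T N p m : ℕ) (κ δ D : ℝ) : ℝ :=
  ((Real.sqrt N)⁻¹ * D + κ) * Real.sqrt T / Real.sqrt N *
    Real.sqrt (pTilde T p + (m : ℝ) + Real.log (1 / δ) + lil (D / (κ * Real.sqrt N)))

end Model

section Penrose

/-- `pinv A` satisfies the four Penrose equations, which characterize the Moore–Penrose inverse. -/
theorem pinv_penrose {ι κ : Type*} [Fintype ι] [Fintype κ] [DecidableEq κ] (A : Matrix ι κ ℝ) :
    A * pinv A * A = A ∧ pinv A * A * pinv A = pinv A ∧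
      (A * pinv A)ᵀ = A * pinv A ∧ (pinv A * A)ᵀ = pinv A * A := by
  have hH : IsSelfAdjoint (Aᵀ * A) := by
    rw [isSelfAdjoint_iff, Matrix.star_eq_conjTranspose, Matrix.conjTranspose_eq_transpose_of_trivial,
      Matrix.transpose_mul, Matrix.transpose_transpose]
  have hc : ∀ f : ℝ → ℝ, ContinuousOn f (spectrum ℝ (Aᵀ * A)) := fun f =>
    (Matrix.finite_real_spectrum (A := Aᵀ * A)).continuousOn f
  have hid : cfc (fun x : ℝ => x) (Aᵀ * A) = Aᵀ * A := cfc_id' ℝ (Aᵀ * A)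
  set J := cfc (fun x : ℝ => x⁻¹) (Aᵀ * A) with hJ
  have hJs : Jᵀ = J := by
    have : IsSelfAdjoint J := cfc_predicate _ _
    rwa [isSelfAdjoint_iff, Matrix.star_eq_conjTranspose,
      Matrix.conjTranspose_eq_transpose_of_trivial] at this
  have hJH : J * (Aᵀ * A) = cfc (fun x : ℝ => x⁻¹ * x) (Aᵀ * A) := by
    rw [cfc_mul _ _ _ (hc _) (hc _), hid]
  have hHJ : (Aᵀ * A) * J = cfc (fun x : ℝ => x⁻¹ * x) (Aᵀ * A) := by
    have : (fun x : ℝ => x⁻¹ * x) = fun x => x * x⁻¹ := by ext x; ring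
    rw [this, cfc_mul _ _ _ (hc _) (hc _), hid]
  have hHJH : (Aᵀ * A) * J * (Aᵀ * A) = Aᵀ * A := by
    have h1 : cfc (fun x : ℝ => x⁻¹ * x * x) (Aᵀ * A)
        = cfc (fun x : ℝ => x⁻¹ * x) (Aᵀ * A) * cfc (fun x : ℝ => x) (Aᵀ * A) :=
      cfc_mul _ _ _ (hc _) (hc _)
    have h2 : (fun x : ℝ => x⁻¹ * x * x) = fun x => x := by
      ext x
      by_cases hx : x = 0 <;> simp [hx]
    rw [h2, hid] at h1
    rw [hHJ, ← h1]
  have hJHJ : J * (Aᵀ * A) * J = J := by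
    rw [hJH, hJ, ← cfc_mul _ _ _ (hc _) (hc _)]
    congr 1
    ext x
    by_cases hx : x = 0 <;> simp [hx]
  have hcomm : J * (Aᵀ * A) = (Aᵀ * A) * J := by rw [hJH, hHJ]
  have hA : A * (J * (Aᵀ * A)) = A := by
    have h0 : (A * (J * (Aᵀ * A)) - A)ᴴ * (A * (J * (Aᵀ * A)) - A) = 0 := by
      have e : A * (J * (Aᵀ * A)) - A = A * (J * (Aᵀ * A) - 1) := by
        rw [Matrix.mul_sub, Matrix.mul_one]
      have z : (Aᵀ * A) * (J * (Aᵀ * A) - 1) = 0 := by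
        rw [Matrix.mul_sub, Matrix.mul_one, ← Matrix.mul_assoc, hHJH, sub_self]
      rw [e, Matrix.conjTranspose_mul, Matrix.conjTranspose_eq_transpose_of_trivial A,
        Matrix.mul_assoc, ← Matrix.mul_assoc Aᵀ, z, Matrix.mul_zero]
    exact sub_eq_zero.mp (Matrix.conjTranspose_mul_self_eq_zero.mp h0)
  refine ⟨?_, ?_, ?_, ?_⟩
  · simp only [pinv, ← hJ, Matrix.mul_assoc] at hA ⊢
    exact hA
  · have : J * Aᵀ * A * (J * Aᵀ) = J * (Aᵀ * A) * J * Aᵀ := by simp only [Matrix.mul_assoc]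
    simp only [pinv, ← hJ]
    rw [this, hJHJ]
  · simp only [pinv, ← hJ, Matrix.transpose_mul, Matrix.transpose_transpose, hJs,
      Matrix.mul_assoc]
  · simp only [pinv, ← hJ]
    rw [Matrix.mul_assoc, Matrix.transpose_mul, hJs, Matrix.transpose_mul,
      Matrix.transpose_transpose, hcomm]

end Penrose

end

end SemiPar

/-! Parts (a)–(c) rest on the correlation of the errors with the lagged inputs. Fix a lag `j < T`, a
vector `v` in the unit ball and a direction `x`. The error at time `t` is known at time `t - T`,
hence before the input at time `t - j`. So `∑ (⟨x, e_t⟩ ⟨v, u_{t-j}⟩ - ⟨x, e_t⟩²)` is the logarithm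
of a supermartingale started at `1`, whose expectation stays at most `1`
(`lintegral_exp_block_le_one`). Averaging over a centred Gaussian `x` with covariance `V₀⁻¹ / 2`
turns this into an explicit quadratic form and determinant. Markov's inequality then gives a
self-normalized bound (`measure_selfNormalized_le`). A union bound over lags and over a net of the
unit ball of `ℝ^p` costs `log T + log (netCard p)`, which is at most `3 * pTilde T p`
(`log_add_log_netCard_le`). Gluing the `T` blocks by Cauchy–Schwarz costs `√T`.

For (b), the regularizer should be the square of the random number `‖Δ‖`, while `V₀` has to be
deterministic. The bound is therefore applied at all scales `κ 2^j` with summable failure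
probabilities, which produces the iterated logarithm (`measure_opNorm_cross_le`). For (c),
subtracting `φ k_t` only replaces the errors by other errors with the same measurability. The normal
equations then bound the estimation error by `2/N` times the correlation on the well-conditioned
event (`opNorm_sub_le_of_isMinOn`).

For (d), the event must be shown likely although the rows of `Ū` overlap. Up to edge terms, `‖Ū v‖²`
is the energy of the convolution of `v` with the inputs. Sampling `2T` frequencies writes this
energy as an average of smoothed periodograms, each a quadratic form in only `2p` real variables
(`sum_spectralForm_eq`, `abs_convForm_sub_le`). For fixed frequency and vector, the periodogram is a
banded Gaussian chaos and concentrates at rate `exp (-c ε² N / T)`. A net in dimension `2p`, instead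
of `Tp`, is then affordable. -/

namespace SemiPar

/-! ### Exponential supermartingales with predictable weights -/

section Supermartingale

variable {Ω : Type*} {ℋ : MeasurableSpace Ω} [mΩ : MeasurableSpace Ω] {μ : Measure Ω}

/-- `Y` has conditional Laplace transform at most `exp (a²)` given `ℋ`, in integrated form. -/
def SubgaussianGiven {Ω : Type*} (ℋ : MeasurableSpace Ω) [mΩ : MeasurableSpace Ω] (μ : Measure Ω)
    (Y : Ω → ℝ) : Prop :=
  ∀ (a : ℝ) (A : Set Ω), MeasurableSet[ℋ] A →
    ∫⁻ ω in A, ENNReal.ofReal (Real.exp (a * Y ω)) ∂μ ≤ ENNReal.ofReal (Real.exp (a ^ 2)) * μ A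

/-- The hypothesis compares `f dμ` with `c μ` on the sub-σ-algebra, and integrating an
`ℋ`-measurable `W` only sees these restrictions. This plays the role of conditional expectation
without any integrability requirement. -/
theorem lintegral_mul_le_of_setLIntegral_le [IsFiniteMeasure μ]
    (hH : ℋ ≤ mΩ) {f : Ω → ENNReal} (hf : Measurable f) {c : ENNReal}
    (h : ∀ A, MeasurableSet[ℋ] A → ∫⁻ ω in A, f ω ∂μ ≤ c * μ A)
    {W : Ω → ENNReal} (hW : Measurable[ℋ] W) :
    ∫⁻ ω, W ω * f ω ∂μ ≤ c * ∫⁻ ω, W ω ∂μ := by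
  have e1 : ∫⁻ ω, W ω * f ω ∂μ = ∫⁻ ω, W ω ∂((μ.withDensity f).trim hH) := by
    rw [lintegral_trim hH hW, lintegral_withDensity_eq_lintegral_mul _ hf (hW.mono hH le_rfl)]
    simp [mul_comm]
  have e2 : c * ∫⁻ ω, W ω ∂μ = ∫⁻ ω, W ω ∂(c • μ.trim hH) := by
    rw [lintegral_smul_measure, lintegral_trim hH hW, smul_eq_mul]
  rw [e1, e2]
  refine lintegral_mono' ?_ le_rfl
  refine Measure.le_iff.2 fun s hs => ?_
  rw [trim_measurableSet_eq hH hs, withDensity_apply _ (hH s hs), Measure.smul_apply,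
    trim_measurableSet_eq hH hs, smul_eq_mul]
  exact h s hs

/-- The subgaussian bound is given for deterministic multipliers. It passes to simple `ℋ`-measurable
ones level set by level set, and to general ones by Fatou's lemma. -/
theorem SubgaussianGiven.lintegral_mul_exp_le [IsFiniteMeasure μ]
    (hH : ℋ ≤ mΩ) {Y : Ω → ℝ} (hYm : Measurable Y) (hY : SubgaussianGiven ℋ μ Y) {d : Ω → ℝ}
    (hd : StronglyMeasurable[ℋ] d) {W : Ω → ENNReal} (hW : Measurable[ℋ] W) :
    ∫⁻ ω, W ω * ENNReal.ofReal (Real.exp (d ω * Y ω - d ω ^ 2)) ∂μ ≤ ∫⁻ ω, W ω ∂μ := by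
  have hconst : ∀ (a : ℝ) (W' : Ω → ENNReal), Measurable[ℋ] W' →
      ∫⁻ ω, W' ω * ENNReal.ofReal (Real.exp (a * Y ω - a ^ 2)) ∂μ ≤ ∫⁻ ω, W' ω ∂μ := by
    intro a W' hW'
    have := lintegral_mul_le_of_setLIntegral_le (μ := μ) hH
      (f := fun ω => ENNReal.ofReal (Real.exp (a * Y ω - a ^ 2))) (by fun_prop) (c := 1)
      ?_ hW'
    · simpa using this
    intro A hA
    have h2 := hY a A hA
    have e : ∀ ω, ENNReal.ofReal (Real.exp (a * Y ω - a ^ 2))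
        = ENNReal.ofReal (Real.exp (-a ^ 2)) * ENNReal.ofReal (Real.exp (a * Y ω)) := by
      intro ω
      rw [← ENNReal.ofReal_mul (Real.exp_pos _).le, ← Real.exp_add]
      congr 2; ring
    simp_rw [e]
    rw [lintegral_const_mul _ (by fun_prop)]
    calc _ ≤ ENNReal.ofReal (Real.exp (-a ^ 2)) * (ENNReal.ofReal (Real.exp (a ^ 2)) * μ A) := by
          gcongr
      _ = 1 * μ A := by
          rw [← mul_assoc, ← ENNReal.ofReal_mul (Real.exp_pos _).le, ← Real.exp_add]
          simp
  have hsimple : ∀ n, ∫⁻ ω, W ω * ENNReal.ofReal (Real.exp (hd.approx n ω * Y ω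
      - hd.approx n ω ^ 2)) ∂μ ≤ ∫⁻ ω, W ω ∂μ := by
    intro n
    set g := hd.approx n
    have hgH : Measurable[ℋ] g := @SimpleFunc.measurable _ _ ℋ _ g
    have hlevel : ∀ a : ℝ, MeasurableSet[ℋ] (g ⁻¹' {a}) := fun a =>
      hgH (measurableSet_singleton a)
    have key : ∀ F : Ω → ENNReal, Measurable F → ∫⁻ ω, F ω ∂μ
        = ∑ a ∈ @SimpleFunc.range _ _ ℋ g, ∫⁻ ω, (g ⁻¹' {a}).indicator F ω ∂μ := by
      intro F hF
      rw [← lintegral_finsetSum]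
      · refine lintegral_congr fun ω => ?_
        rw [Finset.sum_eq_single (g ω)]
        · simp
        · intro b _ hb
          simp [Ne.symm hb]
        · intro h; exact absurd (@SimpleFunc.mem_range_self _ _ ℋ g ω) h
      · intro a _
        exact hF.indicator (hH _ (hlevel a))
    have hgm : Measurable g := hgH.mono hH le_rfl
    have hWm : Measurable W := hW.mono hH le_rfl
    rw [key _ (by fun_prop), key W hWm]
    refine Finset.sum_le_sum fun a _ => ?_
    refine le_trans (le_of_eq ?_) (hconst a ((g ⁻¹' {a}).indicator W) (hW.indicator (hlevel a)))
    refine lintegral_congr fun ω => ?_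
    by_cases h : g ω = a
    · simp [Set.indicator, h]
    · simp [Set.indicator, h]
  have hlim : ∀ ω, Filter.Tendsto (fun n => W ω * ENNReal.ofReal (Real.exp (hd.approx n ω * Y ω
      - hd.approx n ω ^ 2))) Filter.atTop
      (nhds (W ω * ENNReal.ofReal (Real.exp (d ω * Y ω - d ω ^ 2)))) := by
    intro ω
    have h1 := hd.tendsto_approx ω
    have h2 : Filter.Tendsto (fun n => ENNReal.ofReal (Real.exp (hd.approx n ω * Y ω
      - hd.approx n ω ^ 2))) Filter.atTop
      (nhds (ENNReal.ofReal (Real.exp (d ω * Y ω - d ω ^ 2)))) := by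
      refine ENNReal.tendsto_ofReal ?_
      exact (Real.continuous_exp.tendsto _).comp ((h1.mul_const _).sub (h1.pow 2))
    -- `W` may be infinite; multiplication is still continuous here because the limit of the
    -- exponential factor is nonzero.
    refine ENNReal.Tendsto.const_mul h2 (Or.inl ?_)
    simp [Real.exp_pos]
  calc ∫⁻ ω, W ω * ENNReal.ofReal (Real.exp (d ω * Y ω - d ω ^ 2)) ∂μ
      = ∫⁻ ω, Filter.liminf (fun n => W ω * ENNReal.ofReal (Real.exp (hd.approx n ω * Y ω
      - hd.approx n ω ^ 2))) Filter.atTop ∂μ := by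
        refine lintegral_congr fun ω => ?_
        exact ((hlim ω).liminf_eq).symm
    _ ≤ Filter.liminf (fun n => ∫⁻ ω, W ω * ENNReal.ofReal (Real.exp (hd.approx n ω * Y ω
      - hd.approx n ω ^ 2)) ∂μ) Filter.atTop := by
        refine lintegral_liminf_le fun n => ?_
        have hgm : Measurable (hd.approx n) := (@SimpleFunc.measurable _ _ ℋ _ (hd.approx n)).mono hH le_rfl
        have hWm : Measurable W := hW.mono hH le_rfl
        fun_prop
    _ ≤ ∫⁻ ω, W ω ∂μ := by
        refine (Filter.liminf_le_liminf (v := fun _ => ∫⁻ ω, W ω ∂μ)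
          (Filter.Eventually.of_forall hsimple)).trans ?_
        simp

/-- Induction on the number of factors: the newest increment is integrated out with the product of
the earlier ones as the past-measurable weight `W`. -/
theorem lintegral_exp_sum_le_one [IsProbabilityMeasure μ] (ℱ : Filtration ℕ mΩ) (n : ℕ)
    (d Y : ℕ → Ω → ℝ) (hd : ∀ i < n, StronglyMeasurable[ℱ i] (d i))
    (hYm : ∀ i < n, StronglyMeasurable[ℱ (i + 1)] (Y i))
    (hY : ∀ i < n, SubgaussianGiven (ℱ i) μ (Y i)) :
    ∫⁻ ω, ENNReal.ofReal (Real.exp (∑ i ∈ Finset.range n, (d i ω * Y i ω - d i ω ^ 2))) ∂μ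
      ≤ 1 := by
  have hmeas : ∀ k ≤ n, StronglyMeasurable[ℱ k]
      (fun ω => ∑ i ∈ Finset.range k, (d i ω * Y i ω - d i ω ^ 2)) := by
    intro k hk
    refine Finset.stronglyMeasurable_fun_sum _ fun i hi => ?_
    have hi' := Finset.mem_range.1 hi
    have h1 := (hd i (by omega)).mono (ℱ.mono (show i ≤ k by omega))
    have h2 := (hYm i (by omega)).mono (ℱ.mono (show i + 1 ≤ k by omega))
    exact (h1.mul h2).sub (h1.pow 2)
  suffices ∀ k ≤ n, ∫⁻ ω, ENNReal.ofReal (Real.exp (∑ i ∈ Finset.range k,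
      (d i ω * Y i ω - d i ω ^ 2))) ∂μ ≤ 1 from this n le_rfl
  intro k
  induction k with
  | zero => intro _; simp
  | succ k ih =>
    intro hk
    refine le_trans (le_trans (le_of_eq ?_) ((hY k (by omega)).lintegral_mul_exp_le (ℱ.le k)
      ((hYm k (by omega)).mono (ℱ.le _)).measurable (hd k (by omega))
      (W := fun ω => ENNReal.ofReal (Real.exp (∑ i ∈ Finset.range k,
      (d i ω * Y i ω - d i ω ^ 2)))) ?_)) (ih (by omega))
    · refine lintegral_congr fun ω => ?_
      rw [← ENNReal.ofReal_mul (Real.exp_pos _).le, ← Real.exp_add, Finset.sum_range_succ]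
    · exact ENNReal.measurable_ofReal.comp
        (Real.measurable_exp.comp (hmeas k (by omega)).measurable)

end Supermartingale

end SemiPar

namespace SemiPar

/-! ### Laplace transforms of quadratic functions of Gaussian vectors -/

section GaussianIntegral

/-- Completing the square: the integrand times the density is a multiple of the Gaussian density
with mean `s / (1 + 2y)` and variance `(1 + 2y)⁻¹`. -/
theorem lintegral_exp_quadratic_gaussianReal (s y : ℝ) (hy : 0 < 1 + 2 * y) :
    ∫⁻ x, ENNReal.ofReal (Real.exp (s * x - y * x ^ 2)) ∂(gaussianReal 0 1)
      = ENNReal.ofReal ((Real.sqrt (1 + 2 * y))⁻¹ * Real.exp (s ^ 2 / (2 * (1 + 2 * y)))) := by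
  set w : NNReal := ⟨(1 + 2 * y)⁻¹, by positivity⟩ with hw
  have hwr : (w : ℝ) = (1 + 2 * y)⁻¹ := rfl
  have hw0 : w ≠ 0 := by
    intro h
    have : (w : ℝ) = 0 := by rw [h]; rfl
    rw [hwr] at this
    exact absurd this (inv_pos.2 hy).ne'
  rw [gaussianReal_of_var_ne_zero _ one_ne_zero,
    lintegral_withDensity_eq_lintegral_mul _ (measurable_gaussianPDF 0 1) (by fun_prop)]
  have key : ∀ x, (gaussianPDF 0 1 * fun x => ENNReal.ofReal (Real.exp (s * x - y * x ^ 2))) x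
      = ENNReal.ofReal ((Real.sqrt (1 + 2 * y))⁻¹ * Real.exp (s ^ 2 / (2 * (1 + 2 * y))))
        * gaussianPDF (s / (1 + 2 * y)) w x := by
    intro x
    simp only [Pi.mul_apply, gaussianPDF]
    rw [← ENNReal.ofReal_mul (gaussianPDFReal_nonneg _ _ _), ← ENNReal.ofReal_mul (by positivity)]
    congr 1
    simp only [gaussianPDFReal, hwr, NNReal.coe_one, sub_zero, mul_one]
    have e1 : Real.sqrt (2 * Real.pi * (1 + 2 * y)⁻¹)
        = Real.sqrt (2 * Real.pi) * (Real.sqrt (1 + 2 * y))⁻¹ := by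
      rw [Real.sqrt_mul (by positivity), Real.sqrt_inv]
    have e2 : (Real.sqrt (1 + 2 * y))⁻¹ * Real.exp (s ^ 2 / (2 * (1 + 2 * y)))
        * ((Real.sqrt (2 * Real.pi) * (Real.sqrt (1 + 2 * y))⁻¹)⁻¹
          * Real.exp (-(x - s / (1 + 2 * y)) ^ 2 / (2 * (1 + 2 * y)⁻¹)))
        = (Real.sqrt (2 * Real.pi))⁻¹ * (Real.exp (s ^ 2 / (2 * (1 + 2 * y)))
          * Real.exp (-(x - s / (1 + 2 * y)) ^ 2 / (2 * (1 + 2 * y)⁻¹))) := by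
      have : Real.sqrt (1 + 2 * y) ≠ 0 := (Real.sqrt_pos.2 hy).ne'
      field_simp
    rw [e1, e2, mul_assoc, ← Real.exp_add, ← Real.exp_add]
    congr 2
    have := hy.ne'
    field_simp
    ring
  rw [lintegral_congr key, lintegral_const_mul _ (measurable_gaussianPDF _ _),
    lintegral_gaussianPDF_eq_one _ hw0, mul_one]

/-- By rotation invariance the coordinates in an eigenbasis of `P` are independent standard
Gaussians, so the integral factors into one-dimensional ones. -/
theorem lintegral_exp_quadratic_stdGaussian {ι : Type*} [Fintype ι] [DecidableEq ι]
    {P : Matrix ι ι ℝ} (hP : P.IsHermitian) (hpos : ∀ i, 0 < 1 + 2 * hP.eigenvalues i)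
    (s : EuclideanSpace ℝ ι) :
    ∫⁻ z, ENNReal.ofReal (Real.exp (inner ℝ s z - inner ℝ z (Matrix.toEuclideanLin P z)))
        ∂(stdGaussian (EuclideanSpace ℝ ι))
      = ∏ i, ENNReal.ofReal ((Real.sqrt (1 + 2 * hP.eigenvalues i))⁻¹
          * Real.exp (inner ℝ s (hP.eigenvectorBasis i) ^ 2 / (2 * (1 + 2 * hP.eigenvalues i)))) := by
  set b := hP.eigenvectorBasis
  have hb : ∀ i, Matrix.toEuclideanLin P (b i) = hP.eigenvalues i • b i := by
    intro i
    have := hP.mulVec_eigenvectorBasis i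
    ext k
    simpa using congrFun this k
  rw [stdGaussian_eq_map_pi_orthonormalBasis b]
  have hcont : Continuous (fun z : EuclideanSpace ℝ ι => Matrix.toEuclideanLin P z) :=
    LinearMap.continuous_of_finiteDimensional _
  rw [lintegral_map (by fun_prop) (by fun_prop)]
  have e : ∀ x : ι → ℝ, ENNReal.ofReal (Real.exp (inner ℝ s (∑ i, x i • b i)
        - inner ℝ (∑ i, x i • b i) (Matrix.toEuclideanLin P (∑ i, x i • b i))))
      = ∏ i, ENNReal.ofReal (Real.exp (inner ℝ s (b i) * x i
        - hP.eigenvalues i * x i ^ 2)) := by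
    intro x
    rw [← ENNReal.ofReal_prod_of_nonneg (fun i _ => (Real.exp_pos _).le), ← Real.exp_sum,
      Finset.sum_sub_distrib]
    congr 3
    · rw [inner_sum]
      exact Finset.sum_congr rfl fun i _ => by rw [real_inner_smul_right, mul_comm]
    · rw [map_sum, sum_inner]
      refine Finset.sum_congr rfl fun i _ => ?_
      rw [inner_sum, Finset.sum_eq_single i]
      · rw [map_smul, hb, real_inner_smul_left, real_inner_smul_right, real_inner_smul_right,
          real_inner_self_eq_norm_sq, b.norm_eq_one]
        ring
      · intro j _ hj
        rw [map_smul, hb, real_inner_smul_left, real_inner_smul_right, real_inner_smul_right,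
          b.inner_eq_zero (Ne.symm hj)]
        ring
      · simp
  simp_rw [e]
  have hind : iIndepFun (fun i (x : ι → ℝ) => ENNReal.ofReal (Real.exp (inner ℝ s (b i) * x i
        - hP.eigenvalues i * x i ^ 2))) (Measure.pi fun _ : ι => gaussianReal 0 1) :=
    iIndepFun_pi (X := fun i (x : ℝ) => ENNReal.ofReal (Real.exp (inner ℝ s (b i) * x
        - hP.eigenvalues i * x ^ 2))) (fun i => by fun_prop)
  rw [lintegral_prod_eq_prod_lintegral_of_indepFun Finset.univ _ hind (fun i => by fun_prop)]
  refine Finset.prod_congr rfl fun i _ => ?_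
  rw [← lintegral_exp_quadratic_gaussianReal _ _ (hpos i)]
  exact (measurePreserving_eval (fun _ : ι => gaussianReal 0 1) i).lintegral_comp
    (f := fun x => ENNReal.ofReal (Real.exp (inner ℝ s (b i) * x
        - hP.eigenvalues i * x ^ 2))) (by fun_prop)

end GaussianIntegral

end SemiPar

namespace SemiPar

/-! ### Method of mixtures and the self-normalized vector bound -/

section Mixture

variable {ι κ : Type*} [Fintype ι] [DecidableEq ι] [Fintype κ] [DecidableEq κ]

theorem _root_.Matrix.IsHermitian.det_one_add_smul {P : Matrix ι ι ℝ} (hP : P.IsHermitian) (c : ℝ) :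
    (1 + c • P).det = ∏ i, (1 + c * hP.eigenvalues i) := by
  have h := hP.spectral_theorem
  set U := hP.eigenvectorUnitary
  have e : 1 + c • P = (U : Matrix ι ι ℝ) * Matrix.diagonal (fun i => 1 + c * hP.eigenvalues i)
      * (star U : Matrix ι ι ℝ) := by
    have hU : (U : Matrix ι ι ℝ) * (star U : Matrix ι ι ℝ) = 1 := Unitary.coe_mul_star_self U
    have hd : Matrix.diagonal (fun i => 1 + c * hP.eigenvalues i)
        = 1 + c • Matrix.diagonal hP.eigenvalues := by
      ext i j
      by_cases hij : i = j
      · subst hij; simp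
      · simp [hij]
    rw [hd, Matrix.mul_add, Matrix.add_mul, Matrix.mul_one, hU, Matrix.mul_smul, Matrix.smul_mul]
    congr 2
  have hU' : (star U : Matrix ι ι ℝ) * (U : Matrix ι ι ℝ) = 1 := Unitary.coe_star_mul_self U
  rw [e, Matrix.mul_assoc, Matrix.det_mul_comm, Matrix.mul_assoc, hU', Matrix.mul_one,
    Matrix.det_diagonal]

theorem inner_toEuclideanLin_eq_dotProduct {ι κ : Type*} [Fintype ι] [Fintype κ] [DecidableEq κ]
    (P : Matrix ι κ ℝ) (x : EuclideanSpace ℝ ι)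
    (y : EuclideanSpace ℝ κ) :
    inner ℝ x (Matrix.toEuclideanLin P y) = x.ofLp ⬝ᵥ (P *ᵥ y.ofLp) := by
  rw [EuclideanSpace.inner_eq_star_dotProduct, star_trivial, dotProduct_comm]
  rfl

/-- Coordinate-free form of the preceding product. The vector `w` stands for `(1 + 2P)⁻¹ s`;
prescribing the equation it solves keeps that inverse out of the statement. -/
theorem lintegral_exp_quadratic_stdGaussian_eq_det {P : Matrix ι ι ℝ} (hP : P.PosSemidef)
    {s w : EuclideanSpace ℝ ι} (hw : w + (2 : ℝ) • Matrix.toEuclideanLin P w = s) :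
    ∫⁻ z, ENNReal.ofReal (Real.exp (inner ℝ s z - inner ℝ z (Matrix.toEuclideanLin P z)))
        ∂(stdGaussian (EuclideanSpace ℝ ι))
      = ENNReal.ofReal ((Real.sqrt (1 + (2 : ℝ) • P).det)⁻¹ * Real.exp (inner ℝ s w / 2)) := by
  have hpos : ∀ i, 0 < 1 + 2 * hP.1.eigenvalues i := fun i => by
    have := hP.eigenvalues_nonneg i
    linarith
  set b := hP.1.eigenvectorBasis with hbdef
  have hb : ∀ i, Matrix.toEuclideanLin P (b i) = hP.1.eigenvalues i • b i := by
    intro i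
    have := hP.1.mulVec_eigenvectorBasis i
    ext k
    simpa using congrFun this k
  have hsym : ∀ x y, inner ℝ (Matrix.toEuclideanLin P x) y
      = inner ℝ x (Matrix.toEuclideanLin P y) :=
    (Matrix.isSymmetric_toEuclideanLin_iff.2 hP.1)
  rw [lintegral_exp_quadratic_stdGaussian hP.1 hpos,
    ← ENNReal.ofReal_prod_of_nonneg (fun i _ => by positivity), Finset.prod_mul_distrib,
    ← Real.exp_sum, hP.1.det_one_add_smul, Real.sqrt_prod _ (fun i _ => (hpos i).le),
    Finset.prod_inv_distrib]
  congr 3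
  have hs : ∀ i, inner ℝ s (b i) = (1 + 2 * hP.1.eigenvalues i) * inner ℝ w (b i) := by
    intro i
    rw [← hw, inner_add_left, real_inner_smul_left, hsym, hb, real_inner_smul_right]
    ring
  rw [← b.sum_inner_mul_inner s w, Finset.sum_div]
  refine Finset.sum_congr rfl fun i _ => ?_
  rw [← hbdef, real_inner_comm w (b i), hs]
  have := (hpos i).ne'
  field_simp

/-- Since `R Rᵀ = V₀⁻¹`, the vector `R z / √2` is Gaussian with density proportional to `exp (-xᵀ V₀
x)`. The exponent becomes `⟨x, Dᵀh⟩ - xᵀ (Dᵀ D + V₀) x`, whose maximum is the quadratic form on the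
right divided by `4`. -/
theorem lintegral_exp_regression {D : Matrix κ ι ℝ} (h : κ → ℝ) {V₀ R : Matrix ι ι ℝ}
    (hV : V₀.PosDef) (hR : Rᵀ * V₀ * R = 1) :
    ∫⁻ z, ENNReal.ofReal (Real.exp (∑ k, ((D *ᵥ ((Real.sqrt 2)⁻¹ • R *ᵥ z.ofLp)) k * h k
        - (D *ᵥ ((Real.sqrt 2)⁻¹ • R *ᵥ z.ofLp)) k ^ 2))) ∂(stdGaussian (EuclideanSpace ℝ ι))
      = ENNReal.ofReal ((Real.sqrt (1 + D * V₀⁻¹ * Dᵀ).det)⁻¹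
        * Real.exp ((Dᵀ *ᵥ h) ⬝ᵥ ((Dᵀ * D + V₀)⁻¹ *ᵥ (Dᵀ *ᵥ h)) / 4)) := by
  have hA : (Dᵀ * D + V₀).PosDef :=
    Matrix.PosDef.posSemidef_add (by simpa using Matrix.posSemidef_conjTranspose_mul_self D) hV
  have hAu : IsUnit (Dᵀ * D + V₀).det := (Matrix.isUnit_iff_isUnit_det _).1 hA.isUnit
  have hVu : IsUnit V₀.det := (Matrix.isUnit_iff_isUnit_det _).1 hV.isUnit
  have hRu : IsUnit R.det := by
    have := congrArg Matrix.det hR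
    rw [Matrix.det_mul, Matrix.det_one] at this
    exact IsUnit.of_mul_eq_one_right _ this
  have hRR : R * Rᵀ = V₀⁻¹ := by
    have h1 : (Rᵀ * V₀) * R = 1 := hR
    have h2 : R * (Rᵀ * V₀) = 1 := mul_eq_one_comm.1 h1
    rw [← Matrix.mul_assoc] at h2
    rw [← Matrix.mul_one (R * Rᵀ), ← Matrix.mul_nonsing_inv _ hVu, ← Matrix.mul_assoc, h2,
      Matrix.one_mul]
  set S := Dᵀ *ᵥ h with hS
  set A := Dᵀ * D + V₀ with hAdef
  set r := (Real.sqrt 2)⁻¹ with hr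
  have hr2 : r * r = 1 / 2 := by
    rw [hr, ← mul_inv, Real.mul_self_sqrt (by norm_num)]; norm_num
  have hP : ((1 / 2 : ℝ) • (Rᵀ * Dᵀ * (D * R))).PosSemidef := by
    have := Matrix.posSemidef_conjTranspose_mul_self (D * R)
    rw [Matrix.conjTranspose_eq_transpose_of_trivial, Matrix.transpose_mul] at this
    exact this.smul (by norm_num : (0 : ℝ) ≤ 1 / 2)
  -- The scaling by `1/√2` is chosen so that the precision matrix comes out as `Dᵀ D + V₀`, with no
  -- stray factor.
  have hQ : 1 + (2 : ℝ) • ((1 / 2 : ℝ) • (Rᵀ * Dᵀ * (D * R))) = Rᵀ * A * R := by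
    rw [smul_smul, hAdef, Matrix.mul_add, Matrix.add_mul, hR, add_comm]
    norm_num [Matrix.mul_assoc]
  have hmain := lintegral_exp_quadratic_stdGaussian_eq_det hP
    (s := WithLp.toLp 2 (r • Rᵀ *ᵥ S)) (w := WithLp.toLp 2 (r • R⁻¹ *ᵥ (A⁻¹ *ᵥ S))) ?_
  · rw [hQ] at hmain
    have hdet : (Rᵀ * A * R).det = (1 + D * V₀⁻¹ * Dᵀ).det := by
      rw [← hQ, smul_smul, ← hRR]
      norm_num
      rw [show D * (R * Rᵀ) * Dᵀ = (D * R) * (Rᵀ * Dᵀ) by simp only [Matrix.mul_assoc],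
        Matrix.det_one_add_mul_comm]
    have hin : inner ℝ (WithLp.toLp 2 (r • Rᵀ *ᵥ S) : EuclideanSpace ℝ ι)
        (WithLp.toLp 2 (r • R⁻¹ *ᵥ (A⁻¹ *ᵥ S))) / 2 = S ⬝ᵥ (A⁻¹ *ᵥ S) / 4 := by
      rw [EuclideanSpace.inner_toLp_toLp, star_trivial, smul_dotProduct, dotProduct_smul,
        dotProduct_comm, Matrix.mulVec_transpose, ← Matrix.dotProduct_mulVec, Matrix.mulVec_mulVec,
        Matrix.mul_nonsing_inv _ hRu, Matrix.one_mulVec, smul_eq_mul, smul_eq_mul, ← mul_assoc, hr2]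
      ring
    rw [hdet, hin] at hmain
    rw [← hmain]
    refine lintegral_congr fun z => ?_
    congr 2
    rw [Finset.sum_sub_distrib]
    congr 1
    · rw [show ∑ k, (D *ᵥ (r • R *ᵥ z.ofLp)) k * h k = (D *ᵥ (r • R *ᵥ z.ofLp)) ⬝ᵥ h from rfl]
      rw [show inner ℝ (WithLp.toLp 2 (r • Rᵀ *ᵥ S) : EuclideanSpace ℝ ι) z
        = z.ofLp ⬝ᵥ (r • Rᵀ *ᵥ S) by simp [EuclideanSpace.inner_eq_star_dotProduct]]
      rw [Matrix.mulVec_smul, smul_dotProduct, dotProduct_smul, hS, dotProduct_comm,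
        Matrix.mulVec_mulVec, Matrix.dotProduct_mulVec, Matrix.mulVec_mulVec,
        ← Matrix.transpose_mul, ← Matrix.mulVec_transpose, dotProduct_comm]
    · rw [show inner ℝ z (Matrix.toEuclideanLin ((1 / 2 : ℝ) • (Rᵀ * Dᵀ * (D * R))) z)
        = z.ofLp ⬝ᵥ (((1 / 2 : ℝ) • (Rᵀ * Dᵀ * (D * R))) *ᵥ z.ofLp) by
          rw [inner_toEuclideanLin_eq_dotProduct]]
      rw [show ∑ k, (D *ᵥ (r • R *ᵥ z.ofLp)) k ^ 2
        = (D *ᵥ (r • R *ᵥ z.ofLp)) ⬝ᵥ (D *ᵥ (r • R *ᵥ z.ofLp)) by simp [dotProduct, sq]]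
      rw [Matrix.mulVec_smul, smul_dotProduct, dotProduct_smul, smul_eq_mul, smul_eq_mul,
        ← mul_assoc, hr2, Matrix.smul_mulVec, dotProduct_smul, smul_eq_mul, Matrix.mulVec_mulVec,
        ← Matrix.transpose_mul, ← Matrix.mulVec_mulVec z.ofLp (D * R)ᵀ,
        Matrix.dotProduct_mulVec z.ofLp (D * R)ᵀ, Matrix.vecMul_transpose]
  · have : (Rᵀ * A * R) *ᵥ (r • R⁻¹ *ᵥ (A⁻¹ *ᵥ S)) = r • Rᵀ *ᵥ S := by
      rw [Matrix.mulVec_smul, Matrix.mulVec_mulVec, Matrix.mul_assoc, Matrix.mul_nonsing_inv _ hRu,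
        Matrix.mul_one, Matrix.mulVec_mulVec, Matrix.mul_assoc, Matrix.mul_nonsing_inv _ hAu,
        Matrix.mul_one]
    rw [← hQ, Matrix.add_mulVec, Matrix.one_mulVec, Matrix.smul_mulVec] at this
    exact congrArg (WithLp.toLp 2) this

theorem _root_.Matrix.PosDef.exists_transpose_mul_mul_eq_one {V₀ : Matrix ι ι ℝ} (hV : V₀.PosDef) :
    ∃ R : Matrix ι ι ℝ, Rᵀ * V₀ * R = 1 := by
  have hB : (CFC.sqrt V₀)ᵀ = CFC.sqrt V₀ := by
    have := (Matrix.nonneg_iff_posSemidef.1 (CFC.sqrt_nonneg V₀)).1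
    rwa [Matrix.IsHermitian, Matrix.conjTranspose_eq_transpose_of_trivial] at this
  have hBB : CFC.sqrt V₀ * CFC.sqrt V₀ = V₀ :=
    CFC.sqrt_mul_sqrt_self V₀ hV.posSemidef.nonneg
  have hu : IsUnit (CFC.sqrt V₀).det := by
    have h1 : IsUnit V₀.det := (Matrix.isUnit_iff_isUnit_det _).1 hV.isUnit
    rw [← hBB, Matrix.det_mul] at h1
    exact isUnit_of_mul_isUnit_left h1
  refine ⟨(CFC.sqrt V₀)⁻¹, ?_⟩
  rw [Matrix.transpose_nonsing_inv, hB]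
  nth_rw 2 [← hBB]
  rw [← Matrix.mul_assoc, Matrix.nonsing_inv_mul _ hu, Matrix.one_mul, Matrix.mul_nonsing_inv _ hu]

/-- The assumed bound holds for each fixed `x`, so by Tonelli it holds after averaging over the
Gaussian mixture. That average is explicit, and Markov's inequality at level `1/δ` is the claim. -/
theorem measure_selfNormalized_le {Ω : Type*} [mΩ : MeasurableSpace Ω] {μ : Measure Ω}
    [IsProbabilityMeasure μ] {D : Ω → Matrix κ ι ℝ} {h : Ω → κ → ℝ}
    (hD : ∀ k i, Measurable fun ω => D ω k i) (hh : ∀ k, Measurable fun ω => h ω k)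
    (hexp : ∀ x : ι → ℝ, ∫⁻ ω, ENNReal.ofReal (Real.exp
      (∑ k, ((D ω *ᵥ x) k * h ω k - (D ω *ᵥ x) k ^ 2))) ∂μ ≤ 1)
    {V₀ : Matrix ι ι ℝ} (hV : V₀.PosDef) {δ : ℝ} (hδ : 0 < δ) :
    μ {ω | 4 * (Real.log (1 / δ) + Real.log (Real.sqrt (1 + D ω * V₀⁻¹ * (D ω)ᵀ).det))
        < ((D ω)ᵀ *ᵥ h ω) ⬝ᵥ (((D ω)ᵀ * D ω + V₀)⁻¹ *ᵥ ((D ω)ᵀ *ᵥ h ω))} ≤ ENNReal.ofReal δ := by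
  obtain ⟨R, hR⟩ := hV.exists_transpose_mul_mul_eq_one
  set F : Ω → EuclideanSpace ℝ ι → ENNReal := fun ω z =>
    ENNReal.ofReal (Real.exp (∑ k, ((D ω *ᵥ ((Real.sqrt 2)⁻¹ • R *ᵥ z.ofLp)) k * h ω k
        - (D ω *ᵥ ((Real.sqrt 2)⁻¹ • R *ᵥ z.ofLp)) k ^ 2))) with hF
  have hFm : Measurable (Function.uncurry F) := by
    simp only [hF, Function.uncurry_def, Matrix.mulVec, dotProduct, Pi.smul_apply]
    fun_prop
  have hZ : ∀ ω, ∫⁻ z, F ω z ∂(stdGaussian (EuclideanSpace ℝ ι)) = _ := fun ω =>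
    lintegral_exp_regression (D := D ω) (h ω) hV hR
  have hint : ∫⁻ ω, ∫⁻ z, F ω z ∂(stdGaussian (EuclideanSpace ℝ ι)) ∂μ ≤ 1 := by
    rw [lintegral_lintegral_swap hFm.aemeasurable]
    calc _ ≤ ∫⁻ _ : EuclideanSpace ℝ ι, 1 ∂(stdGaussian (EuclideanSpace ℝ ι)) :=
          lintegral_mono fun z => hexp _
      _ = 1 := by simp
  have hmarkov := meas_ge_le_lintegral_div (μ := μ)
    (f := fun ω => ∫⁻ z, F ω z ∂(stdGaussian (EuclideanSpace ℝ ι)))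
    (hFm.lintegral_prod_right).aemeasurable (ε := ENNReal.ofReal (1 / δ))
    (by simpa using hδ) (by simp)
  refine (measure_mono ?_).trans (hmarkov.trans ?_)
  · intro ω hω
    simp only [Set.mem_ofPred_eq] at hω ⊢
    rw [hZ]
    refine ENNReal.ofReal_le_ofReal ?_
    have hdet : 0 < (1 + D ω * V₀⁻¹ * (D ω)ᵀ).det := by
      have h1 : (D ω * V₀⁻¹ * (D ω)ᵀ).PosSemidef := by
        simpa using hV.inv.posSemidef.mul_mul_conjTranspose_same (D ω)
      exact (Matrix.PosDef.one.add_posSemidef h1).det_pos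
    set q := ((D ω)ᵀ *ᵥ h ω) ⬝ᵥ (((D ω)ᵀ * D ω + V₀)⁻¹ *ᵥ ((D ω)ᵀ *ᵥ h ω))
    set g := Real.sqrt (1 + D ω * V₀⁻¹ * (D ω)ᵀ).det with hg
    have hgpos : 0 < g := Real.sqrt_pos.2 hdet
    have h2 : Real.log (1 / δ) + Real.log g ≤ q / 4 := by linarith
    have h3 := Real.exp_le_exp.2 h2
    rw [Real.exp_add, Real.exp_log (by positivity), Real.exp_log hgpos] at h3
    rw [inv_mul_eq_div, le_div_iff₀ hgpos]
    exact h3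
  · calc _ ≤ 1 / ENNReal.ofReal (1 / δ) := by gcongr
      _ = ENNReal.ofReal δ := by
        rw [one_div, one_div, ENNReal.ofReal_inv_of_pos hδ, inv_inv]

end Mixture

end SemiPar

namespace SemiPar

/-! ### Nets of unit balls -/

section Nets

/-- Finite-dimensional unit balls have `1/2`-nets of cardinality at most `5 ^ d`. -/
theorem exists_halfNet (E : Type*) [NormedAddCommGroup E] [NormedSpace ℝ E]
    [FiniteDimensional ℝ E] :
    ∃ S : Finset E, (∀ s ∈ S, ‖s‖ ≤ 1) ∧ S.card ≤ 5 ^ Module.finrank ℝ E ∧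
      ∀ x : E, ‖x‖ ≤ 1 → ∃ s ∈ S, ‖x - s‖ ≤ 1 / 2 := by
  classical
  have hbound : ∀ S : Finset E, (∀ s ∈ S, ‖s‖ ≤ 1) →
      (∀ a ∈ S, ∀ b ∈ S, a ≠ b → 1 / 2 ≤ ‖a - b‖) → S.card ≤ 5 ^ Module.finrank ℝ E := by
    intro S h1 h2
    -- Doubling turns the unit ball and separation `1/2` into radius `2` and separation `1`, the
    -- normalization of `Besicovitch.card_le_of_separated`.
    have hinj : Function.Injective (fun x : E => (2 : ℝ) • x) :=
      smul_right_injective E two_ne_zero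
    rw [← Finset.card_image_of_injective S hinj]
    refine Besicovitch.card_le_of_separated _ ?_ ?_
    · simp only [Finset.mem_image, forall_exists_index, and_imp]
      rintro _ s hs rfl
      rw [norm_smul, Real.norm_ofNat]
      linarith [h1 s hs]
    · simp only [Finset.mem_image, forall_exists_index, and_imp]
      rintro _ s hs rfl _ t ht rfl hne
      rw [← smul_sub, norm_smul, Real.norm_ofNat]
      have := h2 s hs t ht (fun h => hne (by rw [h]))
      linarith
  by_contra hcon
  push Not at hcon
  -- If no separated set of admissible size were a net, each could be enlarged by an uncovered
  -- point, giving separated sets of every size against `hbound`.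
  have hex : ∀ n : ℕ, ∃ S : Finset E, S.card = n ∧ (∀ s ∈ S, ‖s‖ ≤ 1) ∧
      (∀ a ∈ S, ∀ b ∈ S, a ≠ b → 1 / 2 ≤ ‖a - b‖) := by
    intro n
    induction n with
    | zero => exact ⟨∅, by simp⟩
    | succ n ih =>
      obtain ⟨S, hc, h1, h2⟩ := ih
      obtain ⟨x, hx, hxS⟩ := hcon S h1 (hbound S h1 h2)
      have hnot : x ∉ S := fun h => by
        have := hxS x h
        norm_num at this
      refine ⟨insert x S, by rw [Finset.card_insert_of_notMem hnot, hc], ?_, ?_⟩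
      · intro s hs
        rcases Finset.mem_insert.1 hs with rfl | hs
        · exact hx
        · exact h1 s hs
      · intro a ha b hb hab
        rcases Finset.mem_insert.1 ha with ha' | ha' <;>
          rcases Finset.mem_insert.1 hb with hb' | hb'
        · exact absurd (ha'.trans hb'.symm) hab
        · rw [ha']; exact (hxS b hb').le
        · rw [hb', norm_sub_rev]; exact (hxS a ha').le
        · exact h2 a ha' b hb' hab
  obtain ⟨S, hc, h1, h2⟩ := hex (5 ^ Module.finrank ℝ E + 1)
  have := hbound S h1 h2
  omega

/-- A unit vector is a net point plus a remainder of norm at most `1/2`, so `‖f‖ ≤ r + ‖f‖ / 2`. -/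
theorem opNorm_le_two_mul_of_halfNet {E F : Type*} [NormedAddCommGroup E] [NormedSpace ℝ E]
    [NormedAddCommGroup F] [NormedSpace ℝ F] {S : Finset E}
    (hS : ∀ x : E, ‖x‖ ≤ 1 → ∃ s ∈ S, ‖x - s‖ ≤ 1 / 2) (f : E →L[ℝ] F) {r : ℝ} (hr : 0 ≤ r)
    (h : ∀ s ∈ S, ‖f s‖ ≤ r) : ‖f‖ ≤ 2 * r := by
  have key : ‖f‖ ≤ r + ‖f‖ * (1 / 2) := by
    refine ContinuousLinearMap.opNorm_le_of_unit_norm (by positivity) fun x hx => ?_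
    obtain ⟨s, hs, hxs⟩ := hS x hx.le
    calc ‖f x‖ = ‖f s + f (x - s)‖ := by rw [← map_add]; congr 2; abel
      _ ≤ ‖f s‖ + ‖f (x - s)‖ := norm_add_le _ _
      _ ≤ r + ‖f‖ * (1 / 2) := by
        gcongr
        · exact h s hs
        · exact (f.le_opNorm _).trans (by gcongr)
  linarith

/-- The cardinality of the nets of the unit ball of `ℝ^p` used to control operator norms. -/
def netCard (p : ℕ) : ℕ := if p = 1 then 1 else 5 ^ p

theorem netCard_pos (p : ℕ) : 0 < netCard p := by
  unfold netCard; split_ifs <;> positivity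

/-- For `p = 1` one vector already determines the norm. This case must be separated: `pTilde`
vanishes at `T = p = 1`, leaving no room for a `log 5`. -/
theorem exists_normingNet (p : ℕ) :
    ∃ S : Finset (EuclideanSpace ℝ (Fin p)), (∀ s ∈ S, ‖s‖ ≤ 1) ∧ S.card ≤ netCard p ∧
      ∀ (m : ℕ) (M : Matrix (Fin m) (Fin p) ℝ) (r : ℝ), 0 ≤ r →
        (∀ s ∈ S, ‖Matrix.toEuclideanLin M s‖ ≤ r) → ‖M‖ ≤ 2 * r := by
  have hdef : ∀ (m : ℕ) (M : Matrix (Fin m) (Fin p) ℝ),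
      ‖M‖ = ‖LinearMap.toContinuousLinearMap (Matrix.toEuclideanLin M)‖ := fun m M => rfl
  by_cases hp : p = 1
  · subst hp
    refine ⟨{EuclideanSpace.single 0 1}, by simp, by simp [netCard], fun m M r hr h => ?_⟩
    rw [hdef]
    refine ContinuousLinearMap.opNorm_le_of_unit_norm (by positivity) fun x hx => ?_
    have hx' : x = x 0 • EuclideanSpace.single 0 (1 : ℝ) := by
      ext i
      fin_cases i
      simp
    have habs : |x 0| ≤ 1 := by
      have := PiLp.norm_apply_le x 0
      rwa [hx] at this
    have h1 := h _ (Finset.mem_singleton_self _)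
    rw [hx', LinearMap.coe_toContinuousLinearMap', map_smul, norm_smul, Real.norm_eq_abs]
    nlinarith [norm_nonneg (Matrix.toEuclideanLin M (EuclideanSpace.single 0 (1 : ℝ))),
      abs_nonneg (x 0)]
  · obtain ⟨S, h1, h2, h3⟩ := exists_halfNet (EuclideanSpace ℝ (Fin p))
    refine ⟨S, h1, by simpa [netCard, hp] using h2, fun m M r hr h => ?_⟩
    exact opNorm_le_two_mul_of_halfNet h3 _ hr h

end Nets

/-! ### Operator norms of block matrices -/

section Blocks

theorem toEuclideanLin_eq_toLp_mulVec {ι κ : Type*} [Fintype κ] [DecidableEq κ]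
    (M : Matrix ι κ ℝ) (x : EuclideanSpace ℝ κ) :
    Matrix.toEuclideanLin M x = WithLp.toLp 2 (M *ᵥ x.ofLp) := rfl

theorem opNorm_eq_norm_toEuclideanLin {ι κ : Type*} [Fintype ι] [Fintype κ] [DecidableEq κ]
    (M : Matrix ι κ ℝ) :
    ‖M‖ = ‖LinearMap.toContinuousLinearMap (Matrix.toEuclideanLin M)‖ := rfl

theorem norm_toEuclideanLin_le {ι κ : Type*} [Fintype ι] [Fintype κ] [DecidableEq κ]
    (M : Matrix ι κ ℝ) (x : EuclideanSpace ℝ κ) : ‖Matrix.toEuclideanLin M x‖ ≤ ‖M‖ * ‖x‖ :=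
  Matrix.l2_opNorm_mulVec M x

theorem opNorm_le_of_forall {ι κ : Type*} [Fintype ι] [Fintype κ] [DecidableEq κ]
    {M : Matrix ι κ ℝ} {r : ℝ} (hr : 0 ≤ r) (h : ∀ x, ‖Matrix.toEuclideanLin M x‖ ≤ r * ‖x‖) :
    ‖M‖ ≤ r := by
  rw [opNorm_eq_norm_toEuclideanLin]
  exact ContinuousLinearMap.opNorm_le_bound _ hr h

/-- The triangle inequality over the column blocks followed by Cauchy–Schwarz on the `T` block norms
of `x`. -/
theorem opNorm_le_sqrt_mul_of_blocks {T p m : ℕ} (M : Matrix (Fin m) (Fin T × Fin p) ℝ) {r : ℝ}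
    (hr : 0 ≤ r) (h : ∀ j : Fin T, ‖M.submatrix id (fun i : Fin p => (j, i))‖ ≤ r) :
    ‖M‖ ≤ Real.sqrt T * r := by
  refine opNorm_le_of_forall (by positivity) fun x => ?_
  have hx : Matrix.toEuclideanLin M x = ∑ j : Fin T,
      Matrix.toEuclideanLin (M.submatrix id (fun i : Fin p => (j, i)))
        (WithLp.toLp 2 fun i => x (j, i)) := by
    ext k
    rw [WithLp.ofLp_sum, Finset.sum_apply]
    simp only [toEuclideanLin_eq_toLp_mulVec, Matrix.mulVec, dotProduct, Fintype.sum_prod_type,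
      Matrix.submatrix_apply, id]
  have hn : ‖x‖ ^ 2 = ∑ j : Fin T,
      ‖(WithLp.toLp 2 fun i => x (j, i) : EuclideanSpace ℝ (Fin p))‖ ^ 2 := by
    simp only [EuclideanSpace.norm_sq_eq, Fintype.sum_prod_type]
  rw [hx]
  set z : Fin T → ℝ := fun j => ‖(WithLp.toLp 2 fun i => x (j, i) : EuclideanSpace ℝ (Fin p))‖
  have hcs : (∑ j, z j) ≤ Real.sqrt T * ‖x‖ := by
    have h1 := sq_sum_le_card_mul_sum_sq (s := Finset.univ) (f := z)
    rw [Finset.card_univ, Fintype.card_fin, ← hn] at h1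
    refine le_of_sq_le_sq ?_ (by positivity)
    rwa [mul_pow, Real.sq_sqrt (by positivity)]
  calc _ ≤ ∑ j, r * z j := by
        refine (norm_sum_le _ _).trans (Finset.sum_le_sum fun j _ => ?_)
        exact (norm_toEuclideanLin_le _ _).trans (mul_le_mul_of_nonneg_right (h j) (norm_nonneg _))
    _ = r * ∑ j, z j := by rw [Finset.mul_sum]
    _ ≤ r * (Real.sqrt T * ‖x‖) := by gcongr
    _ = _ := by ring

theorem norm_inv_sqrt_mulVec_sq {ι : Type*} [Fintype ι] [DecidableEq ι] {A : Matrix ι ι ℝ}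
    (hA : A.PosDef) (S : EuclideanSpace ℝ ι) :
    ‖Matrix.toEuclideanLin (CFC.sqrt A)⁻¹ S‖ ^ 2 = S.ofLp ⬝ᵥ (A⁻¹ *ᵥ S.ofLp) := by
  have hB : ((CFC.sqrt A)⁻¹)ᵀ = (CFC.sqrt A)⁻¹ := by
    have := (Matrix.nonneg_iff_posSemidef.1 (CFC.sqrt_nonneg A)).inv.1
    rwa [Matrix.IsHermitian, Matrix.conjTranspose_eq_transpose_of_trivial] at this
  have hBB : (CFC.sqrt A)⁻¹ * (CFC.sqrt A)⁻¹ = A⁻¹ := by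
    rw [hA.posSemidef.inv_sqrt]
    exact CFC.sqrt_mul_sqrt_self _ hA.inv.posSemidef.nonneg
  rw [← real_inner_self_eq_norm_sq, inner_toEuclideanLin_eq_dotProduct, ← hBB,
    ← Matrix.mulVec_mulVec, Matrix.dotProduct_mulVec _ (CFC.sqrt A)⁻¹, Matrix.dotProduct_mulVec S.ofLp (CFC.sqrt A)⁻¹,
    ← Matrix.mulVec_transpose, ← Matrix.mulVec_transpose, hB, Matrix.dotProduct_mulVec,
    ← Matrix.mulVec_transpose, hB]
  rfl

end Blocks

/-! ### Self-normalized bound for the operator norm -/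

section SelfNormalized

variable {Ω : Type*} [mΩ : MeasurableSpace Ω] {μ : Measure Ω}
  {T N₁ N p m : ℕ}

/-- All one-dimensional projections of the inputs along vectors of the unit ball are subgaussian
given the past. -/
def SubgaussianInputs (μ : Measure Ω) (ℱ : Filtration ℕ mΩ) (N : ℕ)
    (u : ℕ → Ω → EuclideanSpace ℝ (Fin p)) : Prop :=
  ∀ t ∈ Finset.Icc 1 N, ∀ v : EuclideanSpace ℝ (Fin p), ‖v‖ ≤ 1 →
    SubgaussianGiven (ℱ (t - 1)) μ (fun ω => inner ℝ v (u t ω))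

theorem measurable_rowMatrix_apply {ℱ : Filtration ℕ mΩ} {e : ℕ → Ω → EuclideanSpace ℝ (Fin m)}
    (he : ∀ t ∈ Finset.Icc N₁ N, StronglyMeasurable[ℱ (t - T)] (e t))
    (t : Finset.Icc N₁ N) (i : Fin m) : Measurable fun ω => rowMatrix N₁ N e ω t i := by
  have h := ((he t t.2).mono (ℱ.le _)).measurable
  exact (by fun_prop : Measurable fun x : EuclideanSpace ℝ (Fin m) => x i).comp h

variable [IsProbabilityMeasure μ]

/-- Because `j < T`, the error at time `t` is measurable at time `t - j - 1`, just before the input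
at time `t - j` arrives. For a single lag the errors are thus predictable weights. -/
theorem lintegral_exp_block_le_one {ℱ : Filtration ℕ mΩ} (hTN : T ≤ N₁) (hN : N₁ ≤ N)
    {u : ℕ → Ω → EuclideanSpace ℝ (Fin p)} {e : ℕ → Ω → EuclideanSpace ℝ (Fin m)}
    (hu : ∀ t ∈ Finset.Icc 1 N, StronglyMeasurable[ℱ t] (u t))
    (he : ∀ t ∈ Finset.Icc N₁ N, StronglyMeasurable[ℱ (t - T)] (e t))
    (hsub : SubgaussianInputs μ ℱ N u) (j : Fin T) {v : EuclideanSpace ℝ (Fin p)} (hv : ‖v‖ ≤ 1)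
    (x : Fin m → ℝ) :
    ∫⁻ ω, ENNReal.ofReal (Real.exp (∑ t : Finset.Icc N₁ N,
      ((rowMatrix N₁ N e ω *ᵥ x) t * inner ℝ v (u (t - j) ω)
        - (rowMatrix N₁ N e ω *ᵥ x) t ^ 2))) ∂μ ≤ 1 := by
  have hj := j.2
  -- The clock is shifted so that index `i` is the time just before the input paired with the error
  -- at `N₁ + i`. Since `j < T ≤ N₁`, the natural subtraction does not truncate.
  set 𝒢 : Filtration ℕ mΩ :=
    { seq := fun i => ℱ (N₁ - 1 - j + i)
      mono' := fun a b hab => ℱ.mono (by omega)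
      le' := fun i => ℱ.le _ } with h𝒢
  set d : ℕ → Ω → ℝ := fun i ω => (e (N₁ + i) ω).ofLp ⬝ᵥ x
  set Y : ℕ → Ω → ℝ := fun i ω => inner ℝ v (u (N₁ + i - j) ω)
  have h := lintegral_exp_sum_le_one (μ := μ) 𝒢 (N + 1 - N₁) d Y ?_ ?_ ?_
  · refine le_trans (le_of_eq (lintegral_congr fun ω => ?_)) h
    congr 2
    refine Eq.trans (Finset.sum_coe_sort (Finset.Icc N₁ N) (fun t => ((e t ω).ofLp ⬝ᵥ x) * inner ℝ v (u (t - j) ω)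
        - ((e t ω).ofLp ⬝ᵥ x) ^ 2)) ?_
    rw [← Finset.Ico_add_one_right_eq_Icc, Finset.sum_Ico_eq_sum_range]
  · intro i hi
    have h1 := (he (N₁ + i) (Finset.mem_Icc.2 (by omega))).mono
      (ℱ.mono (show N₁ + i - T ≤ N₁ - 1 - j + i by omega))
    have hc : Continuous fun z : EuclideanSpace ℝ (Fin m) => z.ofLp ⬝ᵥ x := by
      simp only [dotProduct]; fun_prop
    exact hc.comp_stronglyMeasurable h1
  · intro i hi
    have h1 := (hu (N₁ + i - j) (Finset.mem_Icc.2 (by omega))).mono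
      (ℱ.mono (show N₁ + i - j ≤ N₁ - 1 - j + (i + 1) by omega))
    have hc : Continuous fun z : EuclideanSpace ℝ (Fin p) => inner ℝ v z := by fun_prop
    exact hc.comp_stronglyMeasurable h1
  · intro i hi
    have h1 := hsub (N₁ + i - j) (Finset.mem_Icc.2 (by omega)) v hv
    have : N₁ + i - j - 1 = N₁ - 1 - j + i := by omega
    rw [this] at h1
    exact h1

/-- Union bound over the `T` lags and the net vectors, each allotted failure probability `δ / (T *
netCard p)`; the blocks are then glued at the price of `√T`. -/
theorem measure_selfNormalized_opNorm_le {ℱ : Filtration ℕ mΩ} (hT : 1 ≤ T) (hTN : T ≤ N₁)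
    (hN : N₁ ≤ N)
    {u : ℕ → Ω → EuclideanSpace ℝ (Fin p)} {e : ℕ → Ω → EuclideanSpace ℝ (Fin m)}
    (hu : ∀ t ∈ Finset.Icc 1 N, StronglyMeasurable[ℱ t] (u t))
    (he : ∀ t ∈ Finset.Icc N₁ N, StronglyMeasurable[ℱ (t - T)] (e t))
    (hsub : SubgaussianInputs μ ℱ N u)
    {V₀ : Matrix (Fin m) (Fin m) ℝ} (hV : V₀.PosDef) {δ : ℝ} (hδ : 0 < δ) :
    μ {ω | ¬ ‖(CFC.sqrt ((rowMatrix N₁ N e ω)ᵀ * rowMatrix N₁ N e ω + V₀))⁻¹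
          * (rowMatrix N₁ N e ω)ᵀ * Ubar T N₁ N u ω‖
        ≤ Real.sqrt T * (4 * Real.sqrt (Real.log T + Real.log (netCard p) + Real.log (1 / δ)
          + Real.log (Real.sqrt (1 + rowMatrix N₁ N e ω * V₀⁻¹ * (rowMatrix N₁ N e ω)ᵀ).det)))}
      ≤ ENNReal.ofReal δ := by
  obtain ⟨S, hS1, hScard, hSnorm⟩ := exists_normingNet p
  have hT0 : (0 : ℝ) < T := by exact_mod_cast hT
  have hK0 : (0 : ℝ) < netCard p := by exact_mod_cast netCard_pos p
  set δ' : ℝ := δ / (T * netCard p) with hδ'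
  have hδ'0 : 0 < δ' := by positivity
  have hlog : Real.log (1 / δ') = Real.log T + Real.log (netCard p) + Real.log (1 / δ) := by
    rw [hδ', one_div_div, mul_div_assoc, Real.log_mul hT0.ne' (by positivity),
      div_eq_mul_one_div (netCard p : ℝ), Real.log_mul hK0.ne' (by positivity), add_assoc]
  set bad : Fin T → EuclideanSpace ℝ (Fin p) → Set Ω := fun j s =>
    {ω | 4 * (Real.log (1 / δ') + Real.log (Real.sqrt (1 + rowMatrix N₁ N e ω * V₀⁻¹
          * (rowMatrix N₁ N e ω)ᵀ).det))
        < ((rowMatrix N₁ N e ω)ᵀ *ᵥ (fun t : Finset.Icc N₁ N => inner ℝ s (u (t - j) ω))) ⬝ᵥ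
          (((rowMatrix N₁ N e ω)ᵀ * rowMatrix N₁ N e ω + V₀)⁻¹ *ᵥ ((rowMatrix N₁ N e ω)ᵀ *ᵥ
            (fun t : Finset.Icc N₁ N => inner ℝ s (u (t - j) ω))))} with hbad
  have hbadle : ∀ j, ∀ s ∈ S, μ (bad j s) ≤ ENNReal.ofReal δ' := by
    intro j s hs
    refine measure_selfNormalized_le (measurable_rowMatrix_apply he) (fun t => ?_)
      (lintegral_exp_block_le_one hTN hN hu he hsub j (hS1 s hs)) hV hδ'0
    have ht := Finset.mem_Icc.1 t.2
    have hj := j.2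
    have h1 := ((hu (t - j) (Finset.mem_Icc.2 (by omega))).mono (ℱ.le _)).measurable
    fun_prop
  have hunion : μ (⋃ j : Fin T, ⋃ s ∈ S, bad j s) ≤ ENNReal.ofReal δ := by
    calc μ (⋃ j : Fin T, ⋃ s ∈ S, bad j s) ≤ ∑ j : Fin T, ∑ s ∈ S, μ (bad j s) := by
          refine (measure_iUnion_fintype_le _ _).trans (Finset.sum_le_sum fun j _ => ?_)
          exact measure_biUnion_finset_le _ _
      _ ≤ ∑ j : Fin T, ∑ s ∈ S, ENNReal.ofReal δ' :=
          Finset.sum_le_sum fun j _ => Finset.sum_le_sum fun s hs => hbadle j s hs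
      _ = (T : ENNReal) * ((S.card : ENNReal) * ENNReal.ofReal δ') := by simp
      _ ≤ (T : ENNReal) * ((netCard p : ENNReal) * ENNReal.ofReal δ') := by gcongr
      _ = ENNReal.ofReal δ := by
          rw [← ENNReal.ofReal_natCast T, ← ENNReal.ofReal_natCast (netCard p),
            ← ENNReal.ofReal_mul hK0.le, ← ENNReal.ofReal_mul hT0.le]
          congr 1
          rw [hδ']; field_simp
  refine (measure_mono fun ω hω => ?_).trans hunion
  by_contra hgood
  simp only [Set.mem_iUnion, not_exists] at hgood
  apply hω
  rw [← hlog]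
  set D := rowMatrix N₁ N e ω
  set X := Real.log (1 / δ') + Real.log (Real.sqrt (1 + D * V₀⁻¹ * Dᵀ).det)
  have hA : (Dᵀ * D + V₀).PosDef :=
    Matrix.PosDef.posSemidef_add (by simpa using Matrix.posSemidef_conjTranspose_mul_self D) hV
  refine opNorm_le_sqrt_mul_of_blocks _ (by positivity) fun j => ?_
  -- One factor `2` is lost to the net, the other is the square root of the `4` in the
  -- self-normalized bound.
  rw [show (4 : ℝ) * Real.sqrt X = 2 * (2 * Real.sqrt X) by ring]
  refine hSnorm _ _ _ (by positivity) fun s hs => ?_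
  have h1 : _ ≤ 4 * X := not_lt.1 (hgood j s hs)
  have h2 : Matrix.toEuclideanLin (((CFC.sqrt (Dᵀ * D + V₀))⁻¹ * Dᵀ * Ubar T N₁ N u ω).submatrix id
      (fun i : Fin p => (j, i))) s = Matrix.toEuclideanLin (CFC.sqrt (Dᵀ * D + V₀))⁻¹
        (WithLp.toLp 2 (Dᵀ *ᵥ (fun t : Finset.Icc N₁ N => inner ℝ s (u (t - j) ω)))) := by
    have h3 : (((CFC.sqrt (Dᵀ * D + V₀))⁻¹ * Dᵀ * Ubar T N₁ N u ω).submatrix id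
      (fun i : Fin p => (j, i))) = (CFC.sqrt (Dᵀ * D + V₀))⁻¹ * (Dᵀ * (Ubar T N₁ N u ω).submatrix id
      (fun i : Fin p => (j, i))) := by
      rw [← Matrix.mul_assoc]; rfl
    have h4 : (fun t : Finset.Icc N₁ N => inner ℝ s (u (t - j) ω))
        = ((Ubar T N₁ N u ω).submatrix id (fun i : Fin p => (j, i))) *ᵥ s.ofLp := by
      ext t
      simp [Matrix.mulVec, dotProduct, Ubar, rowMatrix, ubar, PiLp.inner_apply, mul_comm]
    rw [h3, h4, Matrix.mulVec_mulVec]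
    rw [toEuclideanLin_eq_toLp_mulVec, toEuclideanLin_eq_toLp_mulVec, ← Matrix.mulVec_mulVec]
  rw [h2]
  have h5 := norm_inv_sqrt_mulVec_sq hA
    (WithLp.toLp 2 (Dᵀ *ᵥ (fun t : Finset.Icc N₁ N => inner ℝ s (u (t - j) ω))))
  -- No bound `δ < 1` is needed: off the bad event, `4X` dominates a squared norm.
  have h6 : 0 ≤ X := by
    have : 0 ≤ 4 * X := le_trans (by rw [← h5]; positivity) h1
    linarith
  refine le_of_sq_le_sq ?_ (by positivity)
  rw [h5, mul_pow, Real.sq_sqrt h6]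
  linarith

end SelfNormalized

end SemiPar

namespace SemiPar

/-! ### Singular values, pseudo-inverse and regularization -/

section Deterministic

variable {ι κ : Type*} [Fintype ι] [DecidableEq ι] [Fintype κ] [DecidableEq κ]

theorem opNorm_transpose (M : Matrix ι κ ℝ) : ‖Mᵀ‖ = ‖M‖ := by
  rw [← Matrix.conjTranspose_eq_transpose_of_trivial, Matrix.l2_opNorm_conjTranspose]

/-- A nonzero eigenvalue of `Uᵀ U` is the square of a singular value whose index lies below the
rank, hence below both dimensions; the singular values decrease. -/
theorem sigmaMin_sq_le_of_mem_spectrum (U : Matrix ι κ ℝ) {x : ℝ} (hx : x ∈ spectrum ℝ (Uᵀ * U))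
    (hx0 : x ≠ 0) : sigmaMin U ^ 2 ≤ x := by
  set L := Matrix.toEuclideanLin U with hL
  have hadj : Matrix.toEuclideanLin (Uᵀ * U) = LinearMap.adjoint L ∘ₗ L := by
    rw [hL, ← Matrix.toEuclideanLin_conjTranspose_eq_adjoint,
      Matrix.conjTranspose_eq_transpose_of_trivial]
    ext v i
    simp [toEuclideanLin_eq_toLp_mulVec, Matrix.mulVec_mulVec]
  rw [← Matrix.spectrum_toLpLin 2, ← Module.End.hasEigenvalue_iff_mem_spectrum, hadj] at hx
  obtain ⟨i, hi⟩ := L.isSymmetric_adjoint_comp_self.exists_eigenvalues_eq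
    (finrank_euclideanSpace (ι := κ) (𝕜 := ℝ)) hx
  rw [← L.sq_singularValues_fin] at hi
  have hi' : L.singularValues i ^ 2 = x := by exact_mod_cast hi
  have hne : L.singularValues i ≠ 0 := fun h => hx0 (by rw [← hi', h]; ring)
  have hlt : (i : ℕ) < Module.finrank ℝ L.range :=
    L.singularValues_pos_iff_lt_finrank_range.1 ((L.singularValues_pos_iff_ne_zero i).2 hne)
  have hr1 : Module.finrank ℝ L.range ≤ Fintype.card ι := by
    simpa using L.range.finrank_le
  have hr2 : Module.finrank ℝ L.range ≤ Fintype.card κ := by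
    simpa using L.finrank_range_le
  have hle : L.singularValues (min (Fintype.card ι) (Fintype.card κ) - 1) ≤ L.singularValues i :=
    L.singularValues_antitone (by omega)
  rw [← hi']
  exact pow_le_pow_left₀ (L.singularValues_nonneg _) hle 2

/-- The pseudo-inverse applies the reciprocal function of `Uᵀ U` to `Uᵀ D`, and this function is at
most `σ_min⁻²` on the spectrum. If `σ_min = 0` the left side vanishes. -/
theorem sigmaMin_sq_mul_opNorm_pinv_mul_le {ν : Type*} [Fintype ν] [DecidableEq ν]
    (U : Matrix ι κ ℝ) (D : Matrix ι ν ℝ) : sigmaMin U ^ 2 * ‖pinv U * D‖ ≤ ‖Dᵀ * U‖ := by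
  have h1 : ‖Dᵀ * U‖ = ‖Uᵀ * D‖ := by
    rw [← opNorm_transpose (Uᵀ * D), Matrix.transpose_mul, Matrix.transpose_transpose]
  rw [h1, pinv, Matrix.mul_assoc]
  rcases eq_or_ne (sigmaMin U) 0 with h0 | h0
  · rw [h0]; simp
  have hpos : 0 < sigmaMin U ^ 2 := by positivity
  have hJ : ‖cfc (fun x : ℝ => x⁻¹) (Uᵀ * U)‖ ≤ (sigmaMin U ^ 2)⁻¹ := by
    refine norm_cfc_le (by positivity) fun x hx => ?_
    rcases eq_or_ne x 0 with hx0 | hx0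
    -- A zero eigenvalue can occur with `σ_min > 0` when `U` has fewer rows than columns; it is
    -- harmless because `0⁻¹ = 0`.
    · rw [hx0]; simpa using hpos.le
    · have h2 := sigmaMin_sq_le_of_mem_spectrum U hx hx0
      rw [Real.norm_eq_abs, abs_of_nonneg (inv_nonneg.2 (hpos.le.trans h2))]
      exact inv_anti₀ hpos h2
  calc _ ≤ sigmaMin U ^ 2 * ((sigmaMin U ^ 2)⁻¹ * ‖Uᵀ * D‖) := by
        gcongr
        exact (Matrix.l2_opNorm_mul _ _).trans (by gcongr)
    _ = ‖Uᵀ * D‖ := by field_simp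

theorem eigenvalues_le_opNorm {P : Matrix ι ι ℝ} (hP : P.IsHermitian) (i : ι) :
    |hP.eigenvalues i| ≤ ‖P‖ := by
  have h := norm_toEuclideanLin_le P (hP.eigenvectorBasis i)
  have hb : Matrix.toEuclideanLin P (hP.eigenvectorBasis i)
      = hP.eigenvalues i • hP.eigenvectorBasis i := by
    rw [toEuclideanLin_eq_toLp_mulVec, hP.mulVec_eigenvectorBasis]
    rfl
  rwa [hb, norm_smul, OrthonormalBasis.norm_eq_one, mul_one, mul_one] at h

/-- Sylvester's identity moves the determinant to the smaller-side matrix `1 + K⁻² Dᵀ D`, each of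
whose eigenvalues is at most `2`. This is the origin of the term `m` in (b) and (c). -/
theorem log_sqrt_det_le {D : Matrix κ ι ℝ} {K : ℝ} (hK : 0 < K) (hD : ‖D‖ ≤ K) :
    Real.log (Real.sqrt (1 + D * (K ^ 2 • (1 : Matrix ι ι ℝ))⁻¹ * Dᵀ).det) ≤ Fintype.card ι := by
  have hinv : (K ^ 2 • (1 : Matrix ι ι ℝ))⁻¹ = (K ^ 2)⁻¹ • 1 := by
    refine Matrix.inv_eq_right_inv ?_
    rw [Matrix.smul_mul, Matrix.one_mul, smul_smul, mul_inv_cancel₀ (by positivity), one_smul]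
  have hP : (Dᵀ * D).PosSemidef := by simpa using Matrix.posSemidef_conjTranspose_mul_self D
  have hdet : (1 + D * (K ^ 2 • (1 : Matrix ι ι ℝ))⁻¹ * Dᵀ).det
      = ∏ i, (1 + (K ^ 2)⁻¹ * hP.1.eigenvalues i) := by
    rw [hinv, ← hP.1.det_one_add_smul, Matrix.mul_smul, Matrix.mul_one,
      ← Matrix.mul_smul Dᵀ, Matrix.det_one_add_mul_comm]
  have hDD : ‖Dᵀ * D‖ ≤ K ^ 2 := by
    have := Matrix.l2_opNorm_conjTranspose_mul_self D
    rw [Matrix.conjTranspose_eq_transpose_of_trivial] at this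
    rw [this, sq]
    gcongr
  have hle : ∏ i, (1 + (K ^ 2)⁻¹ * hP.1.eigenvalues i) ≤ 2 ^ Fintype.card ι := by
    have h1 : ∀ i, (1 + (K ^ 2)⁻¹ * hP.1.eigenvalues i) ≤ 2 := fun i => by
      have h2 := (le_abs_self _).trans ((eigenvalues_le_opNorm hP.1 i).trans hDD)
      have h3 : (K ^ 2)⁻¹ * hP.1.eigenvalues i ≤ (K ^ 2)⁻¹ * K ^ 2 := by gcongr
      rw [inv_mul_cancel₀ (by positivity)] at h3
      linarith
    refine (Finset.prod_le_prod (fun i _ => ?_) (fun i _ => h1 i)).trans ?_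
    · have := hP.eigenvalues_nonneg i
      positivity
    · simp
  have hge : 0 < ∏ i, (1 + (K ^ 2)⁻¹ * hP.1.eigenvalues i) :=
    Finset.prod_pos fun i _ => by
      have := hP.eigenvalues_nonneg i
      positivity
  rw [hdet, Real.log_sqrt hge.le]
  have h2 := Real.log_le_log hge hle
  rw [Real.log_pow] at h2
  have h3 : Real.log 2 ≤ 1 := by linarith [Real.log_two_lt_d9]
  have h4 : (Fintype.card ι : ℝ) * Real.log 2 ≤ Fintype.card ι * 1 := by gcongr
  have h5 : (0 : ℝ) ≤ Fintype.card ι := by positivity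
  linarith

/-- The normalization is undone by multiplying with the square root of `Dᵀ D + K²`, whose norm is at
most `√2 K` once `K` dominates `‖D‖`. -/
theorem opNorm_mul_le_of_selfNormalized {ι κ ν : Type*} [Fintype ι] [DecidableEq ι] [Fintype κ]
    [Fintype ν] [DecidableEq ν]
    {D : Matrix κ ι ℝ} (U : Matrix κ ν ℝ) {K : ℝ} (hK : 0 < K) (hD : ‖D‖ ≤ K) :
    ‖Dᵀ * U‖ ≤ 2 * K * ‖(CFC.sqrt (Dᵀ * D + K ^ 2 • (1 : Matrix ι ι ℝ)))⁻¹ * Dᵀ * U‖ := by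
  set A := Dᵀ * D + K ^ 2 • (1 : Matrix ι ι ℝ) with hAdef
  have hA : A.PosDef :=
    Matrix.PosDef.posSemidef_add (by simpa using Matrix.posSemidef_conjTranspose_mul_self D)
      (Matrix.PosDef.one.smul (by positivity))
  have hBB : CFC.sqrt A * CFC.sqrt A = A := CFC.sqrt_mul_sqrt_self A hA.posSemidef.nonneg
  have hu : IsUnit (CFC.sqrt A).det := by
    have h1 : IsUnit A.det := (Matrix.isUnit_iff_isUnit_det _).1 hA.isUnit
    rw [← hBB, Matrix.det_mul] at h1
    exact isUnit_of_mul_isUnit_left h1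
  have hnorm : ‖CFC.sqrt A‖ ≤ 2 * K := by
    have h1 := Matrix.l2_opNorm_conjTranspose_mul_self (CFC.sqrt A)
    rw [(Matrix.nonneg_iff_posSemidef.1 (CFC.sqrt_nonneg A)).1, hBB] at h1
    have h2 : ‖A‖ ≤ K ^ 2 + K ^ 2 := by
      refine (norm_add_le _ _).trans (add_le_add ?_ ?_)
      · have := Matrix.l2_opNorm_conjTranspose_mul_self D
        rw [Matrix.conjTranspose_eq_transpose_of_trivial] at this
        rw [this, sq]
        gcongr
      · refine opNorm_le_of_forall (by positivity) fun x => ?_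
        rw [map_smul, LinearMap.smul_apply, norm_smul, Matrix.toLpLin_one, LinearMap.id_apply,
          Real.norm_eq_abs, abs_of_nonneg (by positivity)]
    nlinarith [norm_nonneg (CFC.sqrt A)]
  have : Dᵀ * U = CFC.sqrt A * ((CFC.sqrt A)⁻¹ * Dᵀ * U) := by
    rw [← Matrix.mul_assoc, ← Matrix.mul_assoc, Matrix.mul_nonsing_inv _ hu, Matrix.one_mul]
  calc ‖Dᵀ * U‖ = ‖CFC.sqrt A * ((CFC.sqrt A)⁻¹ * Dᵀ * U)‖ := by rw [← this]
    _ ≤ ‖CFC.sqrt A‖ * ‖(CFC.sqrt A)⁻¹ * Dᵀ * U‖ := Matrix.l2_opNorm_mul _ _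
    _ ≤ _ := by gcongr

end Deterministic

/-! ### Peeling over dyadic scales -/

section Peeling

/-- Take the least `j` that works. When `j ≥ 1`, the failure of `j - 1` bounds the scale from above
and `j` by a logarithm, so `log (j + 1)` is an iterated logarithm. -/
theorem exists_dyadic_scale {x κ : ℝ} (hκ : 0 < κ) (hx : 0 ≤ x) :
    ∃ j : ℕ, x ≤ κ * 2 ^ j ∧ κ * 2 ^ j ≤ 2 * (x + κ) ∧
      Real.log (j + 1) ≤ Real.log 2 + lilOne (x / κ) := by
  classical
  have hl2 : 0 < Real.log 2 := Real.log_pos (by norm_num)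
  have hlog1 : 0 ≤ Real.log (1 + x / κ) := Real.log_nonneg (by
    have : 0 ≤ x / κ := by positivity
    linarith)
  have hex : ∃ j : ℕ, x ≤ κ * 2 ^ j := by
    obtain ⟨j, hj⟩ := pow_unbounded_of_one_lt (x / κ) (one_lt_two)
    exact ⟨j, by rw [div_lt_iff₀ hκ] at hj; linarith⟩
  have hmin := fun i (hi : i < Nat.find hex) => Nat.find_min hex hi
  have hj := Nat.find_spec hex
  set j := Nat.find hex
  refine ⟨j, hj, ?_, ?_⟩
  · rcases Nat.eq_zero_or_pos j with h0 | h0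
    · rw [h0]; simp; linarith
    · have h1 := hmin (j - 1) (by omega)
      have h2 : (2 : ℝ) ^ j = 2 * 2 ^ (j - 1) := by
        rw [← pow_succ']; congr 1; omega
      rw [h2]
      nlinarith
  -- The factor `2` covers `1 / log 2`.
  · have hj1 : (j : ℝ) + 1 ≤ 2 * (1 + Real.log (1 + x / κ)) := by
      rcases Nat.eq_zero_or_pos j with h0 | h0
      · rw [h0]; simp; linarith
      · have h1 := not_le.1 (hmin (j - 1) (by omega))
        have h2 : (2 : ℝ) ^ (j - 1) < 1 + x / κ := by
          have : (2 : ℝ) ^ (j - 1) < x / κ := by rw [lt_div_iff₀ hκ]; linarith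
          linarith
        have h3 := Real.log_lt_log (by positivity) h2
        rw [Real.log_pow, Nat.cast_sub h0, Nat.cast_one] at h3
        have h4 := Real.log_two_gt_d9
        have h5 : (1 : ℝ) ≤ j := by exact_mod_cast h0
        nlinarith
    have := Real.log_le_log (by positivity) hj1
    rwa [Real.log_mul (by norm_num) (by positivity)] at this

/-- The weights sum to `δ π² / 12`, below `δ`; their logarithmic cost at scale `j` is only `2 log (j
+ 1)`. -/
theorem tsum_ofReal_div_sq_le {δ : ℝ} (hδ : 0 < δ) :
    ∑' j : ℕ, ENNReal.ofReal (δ / (2 * ((j : ℝ) + 1) ^ 2)) ≤ ENNReal.ofReal δ := by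
  have h1 : HasSum (fun j : ℕ => 1 / (((j + 1 : ℕ) : ℝ)) ^ 2) (Real.pi ^ 2 / 6) := by
    have := (hasSum_nat_add_iff' 1).2 hasSum_zeta_two
    simpa using this
  have h2 : HasSum (fun j : ℕ => δ / (2 * ((j : ℝ) + 1) ^ 2)) (δ / 2 * (Real.pi ^ 2 / 6)) := by
    have h := h1.mul_left (δ / 2)
    have e : (fun j : ℕ => δ / (2 * ((j : ℝ) + 1) ^ 2))
        = fun j : ℕ => δ / 2 * (1 / (((j + 1 : ℕ) : ℝ)) ^ 2) := by
      funext j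
      push_cast
      field_simp
    rw [e]
    exact h
  rw [← ENNReal.ofReal_tsum_of_nonneg (fun j => by positivity) h2.summable, h2.tsum_eq]
  refine ENNReal.ofReal_le_ofReal ?_
  have hpi : Real.pi ^ 2 ≤ 12 := by nlinarith [Real.pi_lt_d2, Real.pi_pos]
  nlinarith

variable {Ω : Type*} [mΩ : MeasurableSpace Ω] {μ : Measure Ω} [IsProbabilityMeasure μ]
  {T N₁ N p m : ℕ}

theorem lilOne_nonneg {x : ℝ} (hx : 0 ≤ x) : 0 ≤ lilOne x :=
  Real.log_nonneg (by linarith [Real.log_nonneg (show 1 ≤ 1 + x by linarith)])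

/-- The self-normalized bound holds simultaneously with `V₀ = (κ 2^j)² I` for all `j`, with failure
probabilities summing to at most `δ`. The scale may then be chosen depending on `ω`, comparable with
`‖Δ‖ + κ`. -/
theorem measure_opNorm_cross_le {ℱ : Filtration ℕ mΩ} (hT : 1 ≤ T) (hTN : T ≤ N₁)
    (hN : N₁ ≤ N) (hm : 1 ≤ m)
    {u : ℕ → Ω → EuclideanSpace ℝ (Fin p)} {e : ℕ → Ω → EuclideanSpace ℝ (Fin m)}
    (hu : ∀ t ∈ Finset.Icc 1 N, StronglyMeasurable[ℱ t] (u t))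
    (he : ∀ t ∈ Finset.Icc N₁ N, StronglyMeasurable[ℱ (t - T)] (e t))
    (hsub : SubgaussianInputs μ ℱ N u) {κ : ℝ} (hκ : 0 < κ) {δ : ℝ} (hδ : 0 < δ) (hδ1 : δ < 1) :
    μ {ω | ¬ ‖(rowMatrix N₁ N e ω)ᵀ * Ubar T N₁ N u ω‖
        ≤ 32 * Real.sqrt T * (‖rowMatrix N₁ N e ω‖ + κ)
          * Real.sqrt (Real.log T + Real.log (netCard p) + m + Real.log (1 / δ)
            + lilOne (‖rowMatrix N₁ N e ω‖ / κ))}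
      ≤ ENNReal.ofReal δ := by
  set δs : ℕ → ℝ := fun j => δ / (2 * ((j : ℝ) + 1) ^ 2) with hδs
  have hδs0 : ∀ j, 0 < δs j := fun j => by simp only [hδs]; positivity
  set bad : ℕ → Set Ω := fun j =>
    {ω | ¬ ‖(CFC.sqrt ((rowMatrix N₁ N e ω)ᵀ * rowMatrix N₁ N e ω
            + (κ * 2 ^ j) ^ 2 • (1 : Matrix (Fin m) (Fin m) ℝ)))⁻¹
          * (rowMatrix N₁ N e ω)ᵀ * Ubar T N₁ N u ω‖
        ≤ Real.sqrt T * (4 * Real.sqrt (Real.log T + Real.log (netCard p) + Real.log (1 / δs j)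
          + Real.log (Real.sqrt (1 + rowMatrix N₁ N e ω
            * ((κ * 2 ^ j) ^ 2 • (1 : Matrix (Fin m) (Fin m) ℝ))⁻¹
            * (rowMatrix N₁ N e ω)ᵀ).det)))} with hbad
  have hbadle : ∀ j, μ (bad j) ≤ ENNReal.ofReal (δs j) := fun j =>
    measure_selfNormalized_opNorm_le hT hTN hN hu he hsub
      (Matrix.PosDef.one.smul (by positivity)) (hδs0 j)
  have hunion : μ (⋃ j, bad j) ≤ ENNReal.ofReal δ :=
    (measure_iUnion_le _).trans ((ENNReal.tsum_le_tsum hbadle).trans (tsum_ofReal_div_sq_le hδ))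
  refine (measure_mono fun ω hω => ?_).trans hunion
  by_contra hgood
  simp only [Set.mem_iUnion, not_exists] at hgood
  apply hω
  set D := rowMatrix N₁ N e ω with hDdef
  obtain ⟨j, hj1, hj2, hj3⟩ := exists_dyadic_scale hκ (norm_nonneg D)
  have h1 := not_not.1 (hgood j)
  have hK : 0 < κ * 2 ^ j := by positivity
  have h2 := opNorm_mul_le_of_selfNormalized (Ubar T N₁ N u ω) hK hj1
  have h3 := log_sqrt_det_le hK hj1
  rw [Fintype.card_fin] at h3
  have hlil : 0 ≤ lilOne (‖D‖ / κ) := lilOne_nonneg (by positivity)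
  have hlogT : 0 ≤ Real.log T := Real.log_natCast_nonneg T
  have hlogK : 0 ≤ Real.log (netCard p) := Real.log_natCast_nonneg _
  have hlogδ : 0 ≤ Real.log (1 / δ) := Real.log_nonneg (by
    rw [le_div_iff₀ hδ]; linarith)
  have hm' : (1 : ℝ) ≤ m := by exact_mod_cast hm
  have hlogδs : Real.log (1 / δs j) ≤ Real.log (1 / δ) + 3 + 2 * lilOne (‖D‖ / κ) := by
    have : 1 / δs j = (1 / δ) * (2 * ((j : ℝ) + 1) ^ 2) := by
      simp only [hδs]; field_simp
    rw [this, Real.log_mul (by positivity) (by positivity), Real.log_mul (by norm_num)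
      (by positivity), Real.log_pow]
    have := Real.log_two_lt_d9
    push_cast
    linarith
  set X := Real.log T + Real.log (netCard p) + m + Real.log (1 / δ) + lilOne (‖D‖ / κ) with hX
  have hX0 : 0 ≤ X := by positivity
  -- The additive constant `3` from the weights is absorbed by `m ≥ 1`: `3 + m ≤ 4m`.
  have h4 : Real.sqrt (Real.log T + Real.log (netCard p) + Real.log (1 / δs j)
          + Real.log (Real.sqrt (1 + D * ((κ * 2 ^ j) ^ 2 • (1 : Matrix (Fin m) (Fin m) ℝ))⁻¹
            * Dᵀ).det)) ≤ 2 * Real.sqrt X := by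
    rw [show (2 : ℝ) * Real.sqrt X = Real.sqrt (4 * X) by
      rw [Real.sqrt_mul (by norm_num), show (4 : ℝ) = 2 ^ 2 by norm_num, Real.sqrt_sq (by norm_num)]]
    refine Real.sqrt_le_sqrt ?_
    rw [hX]
    linarith
  calc ‖Dᵀ * Ubar T N₁ N u ω‖ ≤ 2 * (κ * 2 ^ j) * (Real.sqrt T * (4 * (2 * Real.sqrt X))) :=
        h2.trans (by gcongr; exact h1.trans (by gcongr))
    _ ≤ 2 * (2 * (‖D‖ + κ)) * (Real.sqrt T * (4 * (2 * Real.sqrt X))) := by gcongr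
    _ = _ := by ring

end Peeling

end SemiPar

namespace SemiPar

/-! ### Comparing the logarithmic terms -/

section Dimension

theorem pTilde_nonneg (T p : ℕ) : 0 ≤ pTilde T p := by unfold pTilde; positivity

/-- For `T = p = 1` both sides vanish. Otherwise `x = log (T p) ≥ log 2` gives `(1 + x) x ≥ 1`, so
the minimum in `pTilde` is at least `1` and dominates `log T`, while `log 5 ≤ 2` handles the net. -/
theorem log_add_log_netCard_le {T p : ℕ} (hT : 1 ≤ T) (hp : 1 ≤ p) :
    Real.log T + Real.log (netCard p) ≤ 3 * pTilde T p := by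
  have hT' : (1 : ℝ) ≤ T := by exact_mod_cast hT
  have hp' : (1 : ℝ) ≤ p := by exact_mod_cast hp
  have hlogT : Real.log T ≤ T := (Real.log_le_sub_one_of_pos (by positivity)).trans (by linarith)
  set x := Real.log ((T : ℝ) * p) with hx
  have hTx : Real.log T ≤ x := Real.log_le_log (by positivity) (by nlinarith)
  have hlogT0 : 0 ≤ Real.log T := Real.log_nonneg hT'
  have hex : Real.log (Real.exp 1 * (T : ℝ) * p) = 1 + x := by
    rw [mul_assoc, Real.log_mul (Real.exp_pos _).ne' (by positivity), Real.log_exp]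
  unfold pTilde
  rw [hex, ← hx]
  have hl2 := Real.log_two_gt_d9
  by_cases h : T = 1 ∧ p = 1
  · obtain ⟨rfl, rfl⟩ := h
    simp [netCard, hx]
  · have hTp : (2 : ℝ) ≤ (T : ℝ) * p := by
      have : 2 ≤ T * p := by
        by_contra hcon
        have h1 : T * p < 2 := by omega
        have h2 : T < 2 := lt_of_le_of_lt (Nat.le_mul_of_pos_right T hp) h1
        have h3 : p < 2 := lt_of_le_of_lt (Nat.le_mul_of_pos_left p hT) h1
        exact h ⟨by omega, by omega⟩
      exact_mod_cast this
    have hx2 : Real.log 2 ≤ x := Real.log_le_log (by norm_num) hTp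
    have hx0 : (0.69 : ℝ) ≤ x := by linarith
    have hprod1 : x ≤ (1 + x) ^ 2 * x ^ 2 := by nlinarith [mul_self_nonneg x]
    have hprod2 : 1 ≤ (1 + x) ^ 2 * x ^ 2 := by
      have : 1 ≤ (1 + x) * x := by nlinarith
      calc (1 : ℝ) = 1 ^ 2 := by norm_num
        _ ≤ ((1 + x) * x) ^ 2 := by gcongr
        _ = _ := by ring
    set M := min (T : ℝ) ((1 + x) ^ 2 * x ^ 2) with hM
    have hM1 : 1 ≤ M := le_min hT' hprod2
    have hMT : Real.log T ≤ M := le_min hlogT (hTx.trans hprod1)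
    have h1 : Real.log T ≤ p * M := by nlinarith
    have h2 : Real.log (netCard p) ≤ 2 * (p * M) := by
      unfold netCard
      split_ifs with hp1
      · simp; positivity
      · have h5 : Real.log 5 ≤ 2 := by
          have : Real.log 5 ≤ Real.log (2 ^ 2 * 1.25) := Real.log_le_log (by norm_num) (by norm_num)
          rw [Real.log_mul (by norm_num) (by norm_num), Real.log_pow] at this
          have h6 := Real.log_le_sub_one_of_pos (show (0 : ℝ) < 1.25 by norm_num)
          have h7 := Real.log_two_lt_d9
          push_cast at this
          linarith
        push_cast
        rw [Real.log_pow]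
        nlinarith
    linarith

theorem one_le_logPlus (x : ℝ) : 1 ≤ logPlus x := le_max_left _ _

theorem lilOne_le_three_mul_lil {x : ℝ} (hx : 0 ≤ x) : lilOne x ≤ 3 * lil x := by
  have hl2 := Real.log_two_lt_d9
  have h1 := one_le_logPlus x
  have h0 := one_le_logPlus (logPlus x)
  have hlog : Real.log (1 + x) ≤ 1 + logPlus x := by
    rcases le_total x 1 with h | h
    · have : Real.log (1 + x) ≤ Real.log 2 := Real.log_le_log (by linarith) (by linarith)
      linarith
    · have : Real.log (1 + x) ≤ Real.log (2 * x) := Real.log_le_log (by linarith) (by linarith)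
      rw [Real.log_mul (by norm_num) (by linarith)] at this
      have h3 : Real.log x ≤ logPlus x := le_max_right _ _
      linarith
  have hnn : 0 ≤ Real.log (1 + x) := Real.log_nonneg (by linarith)
  have h2 : lilOne x ≤ Real.log (2 ^ 2 * logPlus x) := by
    unfold lilOne
    exact Real.log_le_log (by linarith) (by linarith)
  rw [Real.log_mul (by norm_num) (by linarith), Real.log_pow] at h2
  have h3 : Real.log (logPlus x) ≤ lil x := le_max_right _ _
  have h4 : 1 ≤ lil x := h0
  push_cast at h2
  linarith

theorem opNorm_eq_zero_of_isEmpty {ι κ : Type*} [Fintype ι] [Fintype κ] [DecidableEq κ]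
    (h : IsEmpty ι ∨ IsEmpty κ) (M : Matrix ι κ ℝ) : ‖M‖ = 0 := by
  rw [norm_eq_zero]
  ext i j
  rcases h with h | h
  · exact h.elim i
  · exact h.elim j

end Dimension

/-! ### Deterministic analysis of least squares -/

section LeastSquares

variable {Ω : Type*} {T N₁ N p m L : ℕ}

theorem eq_zero_of_forall_quadratic_nonneg {a b : ℝ} (h : ∀ s : ℝ, 0 ≤ -2 * s * a + s ^ 2 * b) :
    a = 0 := by
  have h1 : discrim b (-2 * a) 0 ≤ 0 := discrim_le_zero fun s => by
    have := h s
    nlinarith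
  unfold discrim at h1
  nlinarith [sq_nonneg a, pow_eq_zero_iff (two_ne_zero) |>.1 (le_antisymm (by nlinarith) (sq_nonneg a))]

/-- The normal equations of the least-squares problem, tested against rank-one perturbations. -/
theorem sum_residual_mul_eq_zero {u : ℕ → Ω → EuclideanSpace ℝ (Fin p)}
    {x : ℕ → Ω → EuclideanSpace ℝ (Fin m)} {ω : Ω} {H : Matrix (Fin m) (Fin T × Fin p) ℝ}
    (hH : IsMinOn (lsObjective T N₁ N u x ω) Set.univ H) (z : EuclideanSpace ℝ (Fin m))
    (w : EuclideanSpace ℝ (Fin T × Fin p)) :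
    ∑ t ∈ Finset.Icc N₁ N, inner ℝ w (ubar T u t ω)
      * inner ℝ (x t ω - Matrix.toEuclideanLin H (ubar T u t ω)) z = 0 := by
  refine eq_zero_of_forall_quadratic_nonneg
    (b := ∑ t ∈ Finset.Icc N₁ N, (inner ℝ w (ubar T u t ω)) ^ 2 * ‖z‖ ^ 2) fun s => ?_
  have h := hH (Set.mem_univ (H + s • Matrix.vecMulVec z.ofLp w.ofLp))
  have hlin : ∀ v : EuclideanSpace ℝ (Fin T × Fin p),
      Matrix.toEuclideanLin (H + s • Matrix.vecMulVec z.ofLp w.ofLp) v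
        = Matrix.toEuclideanLin H v + (s * inner ℝ w v) • z := by
    intro v
    rw [map_add, LinearMap.add_apply, map_smul, LinearMap.smul_apply, mul_smul]
    congr 2
    ext i
    simp [toEuclideanLin_eq_toLp_mulVec, Matrix.vecMulVec_mulVec, PiLp.inner_apply, dotProduct,
      mul_comm]
  simp only [Set.mem_ofPred_eq, lsObjective] at h
  rw [Finset.mul_sum, Finset.mul_sum, ← Finset.sum_add_distrib]
  rw [← sub_nonneg, ← Finset.sum_sub_distrib] at h
  refine h.trans (le_of_eq (Finset.sum_congr rfl fun t _ => ?_))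
  rw [hlin, ← sub_sub, norm_sub_sq_real, real_inner_smul_right, norm_smul, mul_pow,
    Real.norm_eq_abs, sq_abs]
  ring

/-- The normal equations, tested against `w = (H - G)ᵀ z`, read `‖Ū w‖² = ⟨w, Ūᵀ Δ z⟩`. The lower
bound `Ūᵀ Ū ≥ N/2` then gives `‖w‖ ≤ (2/N) ‖Ūᵀ Δ‖ ‖z‖`. No closed formula for the minimizer is
needed. -/
theorem opNorm_sub_le_of_isMinOn {u : ℕ → Ω → EuclideanSpace ℝ (Fin p)}
    {x e : ℕ → Ω → EuclideanSpace ℝ (Fin m)} {ω : Ω} {G H : Matrix (Fin m) (Fin T × Fin p) ℝ}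
    (hN : 1 ≤ N)
    (hx : ∀ t ∈ Finset.Icc N₁ N, x t ω = Matrix.toEuclideanLin G (ubar T u t ω) + e t ω)
    (hH : IsMinOn (lsObjective T N₁ N u x ω) Set.univ H)
    (hE : ω ∈ wellConditioned T N₁ N u) :
    ‖H - G‖ ≤ 2 / N * ‖(rowMatrix N₁ N e ω)ᵀ * Ubar T N₁ N u ω‖ := by
  have hN0 : (0 : ℝ) < N := by exact_mod_cast hN
  rw [← opNorm_transpose (H - G), ← opNorm_transpose ((rowMatrix N₁ N e ω)ᵀ * _)]
  refine opNorm_le_of_forall (by positivity) fun z => ?_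
  set M := ((rowMatrix N₁ N e ω)ᵀ * Ubar T N₁ N u ω)ᵀ with hM
  set w := Matrix.toEuclideanLin (H - G)ᵀ z with hw
  have hres := sum_residual_mul_eq_zero hH z w
  have hUw : ∀ t : Finset.Icc N₁ N, (Ubar T N₁ N u ω *ᵥ w.ofLp) t = inner ℝ w (ubar T u t ω) := by
    intro t
    simp [Matrix.mulVec, dotProduct, Ubar, rowMatrix, PiLp.inner_apply]
  have h1 : ∀ t ∈ Finset.Icc N₁ N, inner ℝ w (ubar T u t ω)
      * inner ℝ (x t ω - Matrix.toEuclideanLin H (ubar T u t ω)) z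
      = inner ℝ w (ubar T u t ω) * inner ℝ (e t ω) z - (inner ℝ w (ubar T u t ω)) ^ 2 := by
    intro t ht
    have h2 : x t ω - Matrix.toEuclideanLin H (ubar T u t ω)
        = e t ω - Matrix.toEuclideanLin (H - G) (ubar T u t ω) := by
      rw [hx t ht, map_sub, LinearMap.sub_apply]; abel
    have h3 : inner ℝ (Matrix.toEuclideanLin (H - G) (ubar T u t ω)) z
        = inner ℝ w (ubar T u t ω) := by
      rw [real_inner_comm, inner_toEuclideanLin_eq_dotProduct, hw, real_inner_comm,
        inner_toEuclideanLin_eq_dotProduct, Matrix.dotProduct_mulVec, ← Matrix.mulVec_transpose,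
        dotProduct_comm]
    rw [h2, inner_sub_left, h3]
    ring
  rw [Finset.sum_congr rfl h1, Finset.sum_sub_distrib, sub_eq_zero] at hres
  have h4 : ∑ t ∈ Finset.Icc N₁ N, inner ℝ w (ubar T u t ω) * inner ℝ (e t ω) z
      = inner ℝ w (Matrix.toEuclideanLin M z) := by
    rw [inner_toEuclideanLin_eq_dotProduct, hM, Matrix.transpose_mul, Matrix.transpose_transpose,
      ← Matrix.mulVec_mulVec, Matrix.dotProduct_mulVec, Matrix.vecMul_transpose]
    refine Eq.trans (Finset.sum_coe_sort (Finset.Icc N₁ N) (fun t => inner ℝ w (ubar T u t ω)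
      * inner ℝ (e t ω) z)).symm ?_
    refine Finset.sum_congr rfl fun t _ => ?_
    rw [hUw]
    congr 1
    simp [Matrix.mulVec, dotProduct, rowMatrix, PiLp.inner_apply, mul_comm]
  have h5 : ∑ t ∈ Finset.Icc N₁ N, (inner ℝ w (ubar T u t ω)) ^ 2
      = w.ofLp ⬝ᵥ (((Ubar T N₁ N u ω)ᵀ * Ubar T N₁ N u ω) *ᵥ w.ofLp) := by
    rw [← Matrix.mulVec_mulVec, Matrix.dotProduct_mulVec, Matrix.vecMul_transpose]
    refine Eq.trans (Finset.sum_coe_sort (Finset.Icc N₁ N) (fun t =>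
      (inner ℝ w (ubar T u t ω)) ^ 2)).symm ?_
    refine Finset.sum_congr rfl fun t _ => ?_
    rw [hUw, sq]
  have h6 := (Matrix.le_iff.1 hE.1).dotProduct_mulVec_nonneg w.ofLp
  rw [star_trivial, Matrix.sub_mulVec, dotProduct_sub, Matrix.smul_mulVec, Matrix.one_mulVec,
    dotProduct_smul, ← h5, ← hres, h4, smul_eq_mul] at h6
  have h7 : w.ofLp ⬝ᵥ w.ofLp = ‖w‖ ^ 2 := by
    rw [EuclideanSpace.norm_sq_eq]; simp [dotProduct, sq]
  have h8 : inner ℝ w (Matrix.toEuclideanLin M z) ≤ ‖w‖ * (‖M‖ * ‖z‖) :=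
    (real_inner_le_norm _ _).trans (by gcongr; exact norm_toEuclideanLin_le _ _)
  rw [h7] at h6
  rcases eq_or_lt_of_le (norm_nonneg w) with h0 | h0
  · rw [← h0]; positivity
  · have h9 : N / 2 * ‖w‖ ≤ ‖M‖ * ‖z‖ := by
      refine le_of_mul_le_mul_left ?_ h0
      nlinarith
    have : ‖w‖ ≤ 2 / N * (‖M‖ * ‖z‖) := by
      rw [div_mul_eq_mul_div, le_div_iff₀ hN0]
      linarith
    linarith

end LeastSquares

/-! ### Fixed-filter estimator on the well-conditioned event -/

section FixedFilter

variable {Ω : Type*} [mΩ : MeasurableSpace Ω] {μ : Measure Ω} [IsProbabilityMeasure μ]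
  {T N₁ N p m L : ℕ}

theorem filterRate_nonneg {κ δ D : ℝ} (hκ : 0 < κ) (hD : 0 ≤ D) :
    0 ≤ filterRate T N p m κ δ D := by
  unfold filterRate
  positivity

/-- The filtered observations follow the same model with errors `e_t - φ k_t`, still measurable at
time `t - T`. The constant is `128 = 2 · 32 · 2`: least squares, peeling, comparison of logarithms.
-/
theorem measure_fixedFilter_le {ℱ : Filtration ℕ mΩ} (hT : 1 ≤ T) (hTN : T ≤ N₁)
    (hN : N₁ ≤ N) {G : Matrix (Fin m) (Fin T × Fin p) ℝ}
    {u : ℕ → Ω → EuclideanSpace ℝ (Fin p)} {y e : ℕ → Ω → EuclideanSpace ℝ (Fin m)}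
    (hmodel : SemiParametricModel ℱ T N₁ N G u y e)
    (hsub : SubgaussianInputs μ ℱ N u) {δ : ℝ} (hδ : 0 < δ) (hδ1 : δ < 1)
    {k : ℕ → Ω → EuclideanSpace ℝ (Fin L)}
    (hk : ∀ t ∈ Finset.Icc N₁ N, StronglyMeasurable[ℱ (t - T)] (k t))
    (φ : Matrix (Fin m) (Fin L) ℝ) {κ : ℝ} (hκ : 0 < κ) :
    μ {ω | ω ∈ wellConditioned T N₁ N u ∧
        ¬ ∀ H : Matrix (Fin m) (Fin T × Fin p) ℝ, IsFixedFilterEstimate N₁ N u y k φ ω H →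
          ‖H - G‖ ≤ 128 * filterRate T N p m κ δ ‖rowMatrix N₁ N (filtered φ k e) ω‖}
      ≤ ENNReal.ofReal δ := by
  by_cases hempty : m = 0 ∨ p = 0
  · refine (measure_mono_null (t := ∅) (fun ω hω => ?_) measure_empty).trans_le bot_le
    refine hω.2 fun H _ => ?_
    rw [opNorm_eq_zero_of_isEmpty]
    · have := filterRate_nonneg (T := T) (N := N) (p := p) (m := m) (δ := δ) hκ
        (norm_nonneg (rowMatrix N₁ N (filtered φ k e) ω))
      positivity
    · rcases hempty with rfl | rfl
      · exact Or.inl inferInstance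
      · exact Or.inr inferInstance
  push Not at hempty
  have hm : 1 ≤ m := by omega
  have hp : 1 ≤ p := by omega
  have hN1 : 1 ≤ N := by omega
  have hN0 : (0 : ℝ) < N := by exact_mod_cast hN1
  have hsN : 0 < Real.sqrt N := Real.sqrt_pos.2 hN0
  have hNN : Real.sqrt N * Real.sqrt N = N := Real.mul_self_sqrt hN0.le
  have he' : ∀ t ∈ Finset.Icc N₁ N, StronglyMeasurable[ℱ (t - T)] (filtered φ k e t) := by
    intro t ht
    have hc : Continuous (Matrix.toEuclideanLin φ) := LinearMap.continuous_of_finiteDimensional _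
    exact (hmodel.error_adapted t ht).sub (hc.comp_stronglyMeasurable (hk t ht))
  -- Peeling starts at the scale `κ √N`, so that dividing by `N` yields `(N^{-1/2} ‖Δ_φ‖ + κ) / √N`.
  refine (measure_mono fun ω hω => ?_).trans (measure_opNorm_cross_le hT hTN hN hm
    hmodel.input_adapted he' hsub (κ := κ * Real.sqrt N) (by positivity) hδ hδ1)
  intro hgood
  refine hω.2 fun H hH => ?_
  have h1 := opNorm_sub_le_of_isMinOn (x := filtered φ k y) (e := filtered φ k e) (G := G) hN1
    (fun t ht => by
      simp only [filtered]
      rw [hmodel.observation t ht ω]; abel) hH hω.1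
  set D := ‖rowMatrix N₁ N (filtered φ k e) ω‖ with hD
  have hD0 : 0 ≤ D := norm_nonneg _
  have hL : 0 ≤ Real.log (1 / δ) := Real.log_nonneg (by rw [le_div_iff₀ hδ]; linarith)
  have hlil := lilOne_le_three_mul_lil (x := D / (κ * Real.sqrt N)) (by positivity)
  have hlil0 : 0 ≤ lil (D / (κ * Real.sqrt N)) := zero_le_one.trans (one_le_logPlus _)
  have hdim := log_add_log_netCard_le hT hp
  have hpt := pTilde_nonneg T p
  set Y := pTilde T p + (m : ℝ) + Real.log (1 / δ) + lil (D / (κ * Real.sqrt N)) with hY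
  have hsq : Real.sqrt (Real.log T + Real.log (netCard p) + m + Real.log (1 / δ)
            + lilOne (D / (κ * Real.sqrt N))) ≤ 2 * Real.sqrt Y := by
    rw [show (2 : ℝ) * Real.sqrt Y = Real.sqrt (4 * Y) by
      rw [Real.sqrt_mul (by norm_num), show (4 : ℝ) = 2 ^ 2 by norm_num, Real.sqrt_sq (by norm_num)]]
    refine Real.sqrt_le_sqrt ?_
    rw [hY]
    have : (0 : ℝ) ≤ m := by positivity
    linarith
  calc ‖H - G‖ ≤ 2 / N * (32 * Real.sqrt T * (D + κ * Real.sqrt N) * (2 * Real.sqrt Y)) := by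
        refine h1.trans ?_
        gcongr
        exact hgood.trans (by gcongr)
    _ = 128 * filterRate T N p m κ δ D := by
        have h2 : (2 : ℝ) / N = 2 / (Real.sqrt N * Real.sqrt N) := by rw [hNN]
        unfold filterRate
        rw [← hY, h2]
        field_simp
        ring

end FixedFilter

end SemiPar

namespace SemiPar

/-! ### Consequences of the conditional laws of the inputs -/

section GaussianInputs

variable {Ω : Type*} {ℋ : MeasurableSpace Ω} [mΩ : MeasurableSpace Ω] {μ : Measure Ω}
  [IsProbabilityMeasure μ] {p : ℕ}

theorem CondStdGaussian.measure_inter_preimage {X : Ω → EuclideanSpace ℝ (Fin p)}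
    (h : CondStdGaussian μ X ℋ) (hH : ℋ ≤ mΩ) (hX : Measurable X) {A : Set Ω}
    (hA : MeasurableSet[ℋ] A) {B : Set (EuclideanSpace ℝ (Fin p))} (hB : MeasurableSet B) :
    μ (A ∩ X ⁻¹' B) = μ A * stdGaussian (EuclideanSpace ℝ (Fin p)) B := by
  have hint : Integrable ((X ⁻¹' B).indicator (fun _ => (1 : ℝ))) μ :=
    (integrable_const (1 : ℝ)).indicator (hX hB)
  have h1 := setIntegral_condExp hH hint hA
  have h2 : ∫ ω in A, (μ[(X ⁻¹' B).indicator (fun _ => (1 : ℝ)) | ℋ]) ω ∂μ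
      = ∫ _ω in A, (stdGaussian (EuclideanSpace ℝ (Fin p))).real B ∂μ :=
    setIntegral_congr_ae (hH A hA) ((h B hB).mono fun ω hω _ => hω)
  rw [h2, setIntegral_const, integral_indicator (hX hB), Measure.restrict_restrict (hX hB),
    setIntegral_const, smul_eq_mul, smul_eq_mul, mul_one, Set.inter_comm] at h1
  rw [← ENNReal.toReal_eq_toReal_iff' (measure_ne_top _ _)
    (ENNReal.mul_ne_top (measure_ne_top _ _) (measure_ne_top _ _)), ENNReal.toReal_mul]
  exact h1.symm

theorem CondStdGaussian.map_restrict {X : Ω → EuclideanSpace ℝ (Fin p)}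
    (h : CondStdGaussian μ X ℋ) (hH : ℋ ≤ mΩ) (hX : Measurable X) {A : Set Ω}
    (hA : MeasurableSet[ℋ] A) :
    (μ.restrict A).map X = μ A • stdGaussian (EuclideanSpace ℝ (Fin p)) := by
  ext B hB
  rw [Measure.map_apply hX hB, Measure.restrict_apply (hX hB), Set.inter_comm,
    h.measure_inter_preimage hH hX hA hB, Measure.smul_apply, smul_eq_mul]

theorem CondStdGaussian.map_eq {X : Ω → EuclideanSpace ℝ (Fin p)}
    (h : CondStdGaussian μ X ℋ) (hH : ℋ ≤ mΩ) (hX : Measurable X) :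
    μ.map X = stdGaussian (EuclideanSpace ℝ (Fin p)) := by
  have := h.map_restrict hH hX (A := Set.univ) MeasurableSet.univ
  simpa using this

/-- On every past event the law of `X` is a multiple of the standard Gaussian, whose Laplace
transform `exp (a² ‖v‖² / 2)` is within the allowed `exp (a²)`. -/
theorem CondStdGaussian.subgaussianGiven {X : Ω → EuclideanSpace ℝ (Fin p)}
    (h : CondStdGaussian μ X ℋ) (hH : ℋ ≤ mΩ) (hX : Measurable X)
    {v : EuclideanSpace ℝ (Fin p)} (hv : ‖v‖ ≤ 1) :
    SubgaussianGiven ℋ μ (fun ω => inner ℝ v (X ω)) := by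
  intro a A hA
  have hlap := lintegral_exp_quadratic_stdGaussian_eq_det
    (P := (0 : Matrix (Fin p) (Fin p) ℝ)) Matrix.PosSemidef.zero (s := a • v) (w := a • v) (by simp)
  simp only [map_zero, LinearMap.zero_apply, inner_zero_right, sub_zero, smul_zero, add_zero,
    Matrix.det_one, Real.sqrt_one, inv_one, one_mul, real_inner_smul_left,
    real_inner_self_eq_norm_sq] at hlap
  rw [← lintegral_map (μ := μ.restrict A)
    (f := fun x => ENNReal.ofReal (Real.exp (a * inner ℝ v x))) (by fun_prop) hX,
    h.map_restrict hH hX hA, lintegral_smul_measure, hlap, smul_eq_mul, mul_comm]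
  gcongr
  rw [norm_smul, mul_pow, Real.norm_eq_abs, sq_abs]
  have : ‖v‖ ^ 2 ≤ 1 := pow_le_one₀ (norm_nonneg _) hv
  nlinarith [sq_nonneg a]

theorem CondSubgaussian.subgaussianGiven {X : Ω → EuclideanSpace ℝ (Fin p)}
    (h : CondSubgaussian μ X ℋ) (hH : ℋ ≤ mΩ)
    {v : EuclideanSpace ℝ (Fin p)} (hv : ‖v‖ ≤ 1) :
    SubgaussianGiven ℋ μ (fun ω => inner ℝ v (X ω)) := by
  intro a A hA
  obtain ⟨hint, hle⟩ := h v a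
  have h1 : ∫ ω in A, Real.exp (a * inner ℝ v (X ω)) ∂μ
      ≤ ∫ _ω in A, Real.exp (a ^ 2 * ‖v‖ ^ 2) ∂μ := by
    rw [← setIntegral_condExp hH hint hA]
    exact setIntegral_mono_ae integrable_condExp.integrableOn (integrable_const _).integrableOn hle
  rw [← ofReal_integral_eq_lintegral_ofReal hint.integrableOn
    (Filter.Eventually.of_forall fun ω => (Real.exp_pos _).le)]
  rw [setIntegral_const, smul_eq_mul] at h1
  refine (ENNReal.ofReal_le_ofReal h1).trans ?_
  rw [ENNReal.ofReal_mul measureReal_nonneg, ofReal_measureReal, mul_comm]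
  gcongr
  have : ‖v‖ ^ 2 ≤ 1 := pow_le_one₀ (norm_nonneg _) hv
  nlinarith [sq_nonneg a]

variable {N : ℕ} {ℱ : Filtration ℕ mΩ} {u : ℕ → Ω → EuclideanSpace ℝ (Fin p)}

/-- Induction on `n`: the newest input is independent of the past sum because its conditional law is
constant, so characteristic functions multiply. -/
theorem integral_cexp_sum_inner (hu : ∀ t ∈ Finset.Icc 1 N, StronglyMeasurable[ℱ t] (u t))
    (hg : ∀ t ∈ Finset.Icc 1 N, CondStdGaussian μ (u t) (ℱ (t - 1)))
    (ξ : ℕ → EuclideanSpace ℝ (Fin p)) (n : ℕ) (hn : n ≤ N) :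
    ∫ ω, Complex.exp ((∑ t ∈ Finset.Icc 1 n, inner ℝ (u t ω) (ξ t) : ℝ) * Complex.I) ∂μ
      = Complex.exp (-(∑ t ∈ Finset.Icc 1 n, ‖ξ t‖ ^ 2 : ℝ) / 2) := by
  induction n with
  | zero => simp
  | succ n ih =>
    have hmem : n + 1 ∈ Finset.Icc 1 N := Finset.mem_Icc.2 (by omega)
    have hX : Measurable (u (n + 1)) := ((hu _ hmem).mono (ℱ.le _)).measurable
    have hpast : StronglyMeasurable[ℱ n] (fun ω => ∑ t ∈ Finset.Icc 1 n, inner ℝ (u t ω) (ξ t)) := by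
      refine Finset.stronglyMeasurable_fun_sum _ fun t ht => ?_
      have ht' := Finset.mem_Icc.1 ht
      have hc : Continuous fun z : EuclideanSpace ℝ (Fin p) => inner ℝ z (ξ t) := by fun_prop
      exact hc.comp_stronglyMeasurable ((hu t (Finset.mem_Icc.2 (by omega))).mono (ℱ.mono ht'.2))
    have hg' := hg _ hmem
    rw [Nat.add_sub_cancel] at hg'
    have hind : IndepFun (fun ω => ∑ t ∈ Finset.Icc 1 n, inner ℝ (u t ω) (ξ t)) (u (n + 1)) μ := by
      rw [indepFun_iff_measure_inter_preimage_eq_mul]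
      intro s t hs ht
      rw [hg'.measure_inter_preimage (ℱ.le n) hX (hpast.measurable hs) ht,
        ← hg'.map_eq (ℱ.le n) hX, Measure.map_apply hX ht]
    have hind' : IndepFun
        (fun ω => Complex.exp ((∑ t ∈ Finset.Icc 1 n, inner ℝ (u t ω) (ξ t) : ℝ) * Complex.I))
        (fun ω => Complex.exp ((inner ℝ (u (n + 1) ω) (ξ (n + 1)) : ℝ) * Complex.I)) μ :=
      hind.comp (φ := fun x : ℝ => Complex.exp (x * Complex.I))
        (ψ := fun z => Complex.exp ((inner ℝ z (ξ (n + 1)) : ℝ) * Complex.I))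
        (by fun_prop) (by fun_prop)
    have hpm := (hpast.mono (ℱ.le n)).measurable
    have hlast : ∫ ω, Complex.exp ((inner ℝ (u (n + 1) ω) (ξ (n + 1)) : ℝ) * Complex.I) ∂μ
        = Complex.exp (-(‖ξ (n + 1)‖ ^ 2 : ℝ) / 2) := by
      have h1 := charFun_stdGaussian (E := EuclideanSpace ℝ (Fin p)) (ξ (n + 1))
      rw [← hg'.map_eq (ℱ.le n) hX, charFun_apply, integral_map hX.aemeasurable
        (Measurable.aestronglyMeasurable (by fun_prop))] at h1
      rw [h1]
      push_cast
      rfl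
    have hsum : ∀ f : ℕ → ℝ, ∑ t ∈ Finset.Icc 1 (n + 1), f t
        = ∑ t ∈ Finset.Icc 1 n, f t + f (n + 1) := fun f =>
      Finset.sum_Icc_succ_top (by omega) f
    simp_rw [hsum, Complex.ofReal_add, add_mul, Complex.exp_add]
    rw [hind'.integral_fun_mul_eq_mul_integral (Measurable.aestronglyMeasurable (by fun_prop))
      (Measurable.aestronglyMeasurable (by fun_prop)), ih (by omega), hlast, ← Complex.exp_add]
    congr 1
    ring

/-- The inputs with times in `W`, stacked in one vector. -/
def stack (W : Finset ℕ) (u : ℕ → Ω → EuclideanSpace ℝ (Fin p)) (ω : Ω) :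
    EuclideanSpace ℝ (W × Fin p) :=
  WithLp.toLp 2 fun si => u si.1 ω si.2

theorem measurable_stack {W : Finset ℕ} (hW : W ⊆ Finset.Icc 1 N)
    (hu : ∀ t ∈ Finset.Icc 1 N, StronglyMeasurable[ℱ t] (u t)) : Measurable (stack W u) := by
  refine (WithLp.measurable_toLp 2 _).comp (measurable_pi_lambda _ fun si => ?_)
  have h := ((hu si.1 (hW si.1.2)).mono (ℱ.le _)).measurable
  exact (by fun_prop : Measurable fun x : EuclideanSpace ℝ (Fin p) => x si.2).comp h

/-- Characteristic functions determine the law. Extending `ξ` by zero outside `W` reduces any set of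
times to the full range `1, …, N`. -/
theorem map_stack_eq_stdGaussian {W : Finset ℕ} (hW : W ⊆ Finset.Icc 1 N)
    (hu : ∀ t ∈ Finset.Icc 1 N, StronglyMeasurable[ℱ t] (u t))
    (hg : ∀ t ∈ Finset.Icc 1 N, CondStdGaussian μ (u t) (ℱ (t - 1))) :
    μ.map (stack W u) = stdGaussian (EuclideanSpace ℝ (W × Fin p)) := by
  classical
  have hm := measurable_stack hW hu
  have : IsProbabilityMeasure (μ.map (stack W u)) := Measure.isProbabilityMeasure_map hm.aemeasurable
  refine Measure.ext_of_charFun ?_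
  ext ξ
  rw [charFun_stdGaussian, charFun_apply, integral_map hm.aemeasurable
    (Measurable.aestronglyMeasurable (by fun_prop))]
  set ξ' : ℕ → EuclideanSpace ℝ (Fin p) := fun t =>
    if h : t ∈ W then WithLp.toLp 2 fun i => ξ (⟨t, h⟩, i) else 0 with hξ'
  have hin : ∀ (s : W), ξ' s = WithLp.toLp 2 fun i => ξ (s, i) := fun s => by
    simp [hξ']
  have h1 : ∀ ω, (inner ℝ (stack W u ω) ξ : ℝ) = ∑ t ∈ Finset.Icc 1 N, inner ℝ (u t ω) (ξ' t) := by
    intro ω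
    rw [← Finset.sum_subset hW (fun t _ ht => by simp [hξ', ht]), ← Finset.sum_coe_sort W,
      PiLp.inner_apply, Fintype.sum_prod_type]
    refine Finset.sum_congr rfl fun s _ => ?_
    rw [hin, PiLp.inner_apply]
    rfl
  have h2 : ‖ξ‖ ^ 2 = ∑ t ∈ Finset.Icc 1 N, ‖ξ' t‖ ^ 2 := by
    rw [← Finset.sum_subset hW (fun t _ ht => by simp [hξ', ht]), ← Finset.sum_coe_sort W,
      EuclideanSpace.norm_sq_eq, Fintype.sum_prod_type]
    refine Finset.sum_congr rfl fun s _ => ?_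
    rw [hin, EuclideanSpace.norm_sq_eq]
  have h3 := integral_cexp_sum_inner (μ := μ) hu hg ξ' N le_rfl
  simp_rw [← h1] at h3
  rw [← h2] at h3
  rw [h3]
  push_cast
  rfl

end GaussianInputs

end SemiPar

namespace SemiPar

/-! ### Concentration of Gaussian quadratic forms -/

section Chaos

variable {ι : Type*} [Fintype ι] [DecidableEq ι]

theorem _root_.Matrix.IsHermitian.sum_eigenvalues_sq {P : Matrix ι ι ℝ} (hP : P.IsHermitian) :
    ∑ i, hP.eigenvalues i ^ 2 = ∑ i, ∑ j, P i j ^ 2 := by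
  have h := hP.spectral_theorem
  set U := hP.eigenvectorUnitary
  have hU' : (star U : Matrix ι ι ℝ) * (U : Matrix ι ι ℝ) = 1 := Unitary.coe_star_mul_self U
  have h1 : (P * P).trace = ∑ i, hP.eigenvalues i ^ 2 := by
    have h2 : P * P = Unitary.conjStarAlgAut ℝ (Matrix ι ι ℝ) U
        (Matrix.diagonal hP.eigenvalues * Matrix.diagonal hP.eigenvalues) := by
      rw [map_mul]
      conv_lhs => rw [h]
      rfl
    rw [h2, Unitary.conjStarAlgAut_apply, Matrix.trace_mul_comm, ← Matrix.mul_assoc, hU',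
      Matrix.one_mul, Matrix.diagonal_mul_diagonal, Matrix.trace_diagonal]
    simp [sq]
  rw [← h1, Matrix.trace]
  refine Finset.sum_congr rfl fun i _ => ?_
  rw [Matrix.diag_apply, Matrix.mul_apply]
  refine Finset.sum_congr rfl fun j _ => ?_
  have : P j i = P i j := by
    have := congrFun (congrFun hP i) j
    simpa using this
  rw [this, sq]

theorem abs_eigenvalues_le_of_quadratic {P : Matrix ι ι ℝ} (hP : P.IsHermitian) {K : ℝ}
    (h : ∀ z : EuclideanSpace ℝ ι, |inner ℝ z (Matrix.toEuclideanLin P z)| ≤ K * ‖z‖ ^ 2) (i : ι) :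
    |hP.eigenvalues i| ≤ K := by
  have h1 := h (hP.eigenvectorBasis i)
  have hb : Matrix.toEuclideanLin P (hP.eigenvectorBasis i)
      = hP.eigenvalues i • hP.eigenvectorBasis i := by
    rw [toEuclideanLin_eq_toLp_mulVec, hP.mulVec_eigenvectorBasis]
    rfl
  rwa [hb, real_inner_smul_right, real_inner_self_eq_norm_sq, OrthonormalBasis.norm_eq_one,
    one_pow, mul_one, mul_one] at h1

/-- The first-order Taylor error of `log (1 + 2y)` is at most `(2y)² / (1 - |2y|) ≤ 8 y²`; half of
it gives the `4 y²`. -/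
theorem inv_sqrt_one_add_le_exp {y : ℝ} (hy : |y| ≤ 1 / 4) :
    (Real.sqrt (1 + 2 * y))⁻¹ ≤ Real.exp (-y + 4 * y ^ 2) := by
  obtain ⟨h1, h2⟩ := abs_le.1 hy
  have hpos : 0 < 1 + 2 * y := by linarith
  have h := Real.abs_log_sub_add_sum_range_le (x := -2 * y) (by
    rw [abs_mul]; norm_num; linarith) 1
  simp only [Finset.sum_range_one, zero_add, pow_one, Nat.cast_zero, div_one] at h
  have hden : (1 : ℝ) / 2 ≤ 1 - |-2 * y| := by rw [abs_mul]; norm_num; linarith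
  have h3 : |-2 * y| ^ (1 + 1) / (1 - |-2 * y|) ≤ 8 * y ^ 2 := by
    rw [div_le_iff₀ (by linarith), sq_abs]
    nlinarith [sq_nonneg y]
  have h4 := (abs_le.1 (h.trans h3)).1
  rw [show 1 - -2 * y = 1 + 2 * y by ring] at h4
  rw [← Real.exp_log (inv_pos.2 (Real.sqrt_pos.2 hpos)), Real.log_inv, Real.log_sqrt hpos.le]
  refine Real.exp_le_exp.2 ?_
  linarith

/-- The exact integral is a product over eigenvalues. Bounding each factor, the linear terms add up
to the trace and the quadratic ones to the squared Frobenius norm. -/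
theorem lintegral_exp_neg_quadratic_le {P : Matrix ι ι ℝ} (hP : P.IsHermitian)
    (h : ∀ z : EuclideanSpace ℝ ι, |inner ℝ z (Matrix.toEuclideanLin P z)| ≤ 1 / 4 * ‖z‖ ^ 2) :
    ∫⁻ z, ENNReal.ofReal (Real.exp (-inner ℝ z (Matrix.toEuclideanLin P z)))
        ∂(stdGaussian (EuclideanSpace ℝ ι))
      ≤ ENNReal.ofReal (Real.exp (-P.trace + 4 * ∑ i, ∑ j, P i j ^ 2)) := by
  have hev := abs_eigenvalues_le_of_quadratic hP h
  have hpos : ∀ i, 0 < 1 + 2 * hP.eigenvalues i := fun i => by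
    linarith [(abs_le.1 (hev i)).1]
  have key := lintegral_exp_quadratic_stdGaussian hP hpos 0
  simp only [inner_zero_left, zero_sub, ne_eq, OfNat.ofNat_ne_zero, not_false_eq_true, zero_pow,
    zero_div, Real.exp_zero, mul_one] at key
  rw [key, ← ENNReal.ofReal_prod_of_nonneg (fun i _ => by positivity)]
  refine ENNReal.ofReal_le_ofReal ?_
  calc ∏ i, (Real.sqrt (1 + 2 * hP.eigenvalues i))⁻¹
      ≤ ∏ i, Real.exp (-hP.eigenvalues i + 4 * hP.eigenvalues i ^ 2) :=
        Finset.prod_le_prod (fun i _ => by positivity) fun i _ => inv_sqrt_one_add_le_exp (hev i)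
    _ = _ := by
        rw [← Real.exp_sum, Finset.sum_add_distrib, Finset.sum_neg_distrib, ← Finset.mul_sum,
          hP.sum_eigenvalues_sq, hP.trace_eq_sum_eigenvalues]
        rfl

/-- Chernoff's bound; the sign of `r` selects the tail, and together the two signs give a
Hanson–Wright inequality. -/
theorem measure_quadratic_ge_le {B : Matrix ι ι ℝ} (hB : B.IsHermitian) {K F r x : ℝ}
    (hK : ∀ z : EuclideanSpace ℝ ι, |inner ℝ z (Matrix.toEuclideanLin B z)| ≤ K * ‖z‖ ^ 2)
    (hF : ∑ i, ∑ j, B i j ^ 2 ≤ F) (hr : |r| * K ≤ 1 / 4) :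
    stdGaussian (EuclideanSpace ℝ ι)
        {z | |r| * x ≤ r * (inner ℝ z (Matrix.toEuclideanLin B z) - B.trace)}
      ≤ ENNReal.ofReal (Real.exp (-|r| * x + 4 * r ^ 2 * F)) := by
  have hP : ((-r) • B).IsHermitian := by
    rw [Matrix.IsHermitian, Matrix.conjTranspose_smul, hB]
    simp
  have hcont : Continuous (fun z : EuclideanSpace ℝ ι => Matrix.toEuclideanLin B z) :=
    LinearMap.continuous_of_finiteDimensional _
  have hq : ∀ z : EuclideanSpace ℝ ι, inner ℝ z (Matrix.toEuclideanLin ((-r) • B) z)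
      = -r * inner ℝ z (Matrix.toEuclideanLin B z) := fun z => by
    rw [map_smul, LinearMap.smul_apply, real_inner_smul_right]
  have h1 := lintegral_exp_neg_quadratic_le hP fun z => by
    rw [hq, abs_mul, abs_neg]
    calc |r| * |inner ℝ z (Matrix.toEuclideanLin B z)| ≤ |r| * (K * ‖z‖ ^ 2) := by
          gcongr; exact hK z
      _ = |r| * K * ‖z‖ ^ 2 := by ring
      _ ≤ _ := by gcongr
  simp only [hq, Matrix.trace_smul, Matrix.smul_apply, smul_eq_mul, mul_pow, neg_mul, neg_neg,
    neg_sq, ← Finset.mul_sum] at h1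
  have hmarkov := meas_ge_le_lintegral_div (μ := stdGaussian (EuclideanSpace ℝ ι))
    (f := fun z => ENNReal.ofReal (Real.exp (r * inner ℝ z (Matrix.toEuclideanLin B z))))
    (by fun_prop) (ε := ENNReal.ofReal (Real.exp (|r| * x + r * B.trace)))
    (by simpa using Real.exp_pos _) (by simp)
  refine (measure_mono fun z hz => ?_).trans (hmarkov.trans ?_)
  · have hz' : |r| * x ≤ r * (inner ℝ z (Matrix.toEuclideanLin B z) - B.trace) := hz
    refine ENNReal.ofReal_le_ofReal (Real.exp_le_exp.2 ?_)
    linarith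
  · refine (ENNReal.div_le_div_right h1 _).trans ?_
    rw [← ENNReal.ofReal_div_of_pos (Real.exp_pos _), ← Real.exp_sub]
    refine ENNReal.ofReal_le_ofReal (Real.exp_le_exp.2 ?_)
    nlinarith [sq_nonneg r]

theorem measure_abs_quadratic_sub_trace_gt_le {B : Matrix ι ι ℝ} (hB : B.IsHermitian)
    {K F r x : ℝ}
    (hK : ∀ z : EuclideanSpace ℝ ι, |inner ℝ z (Matrix.toEuclideanLin B z)| ≤ K * ‖z‖ ^ 2)
    (hF : ∑ i, ∑ j, B i j ^ 2 ≤ F) (hr0 : 0 < r) (hr : r * K ≤ 1 / 4) :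
    stdGaussian (EuclideanSpace ℝ ι)
        {z | x < |inner ℝ z (Matrix.toEuclideanLin B z) - B.trace|}
      ≤ ENNReal.ofReal (2 * Real.exp (-r * x + 4 * r ^ 2 * F)) := by
  have h1 := measure_quadratic_ge_le hB (x := x) hK hF (r := r) (by rwa [abs_of_pos hr0])
  have h2 := measure_quadratic_ge_le hB (x := x) hK hF (r := -r) (by rwa [abs_neg, abs_of_pos hr0])
  rw [abs_neg, neg_sq] at h2
  rw [abs_of_pos hr0] at h1 h2
  refine (measure_mono fun z hz => ?_).trans ((measure_union_le _ _).trans (add_le_add h1 h2) |>.trans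
    (le_of_eq ?_))
  · have hz' : x < |inner ℝ z (Matrix.toEuclideanLin B z) - B.trace| := hz
    rcases lt_abs.1 hz' with h | h
    · exact Or.inl (show r * x ≤ _ by gcongr)
    · refine Or.inr (show r * x ≤ _ from ?_)
      nlinarith
  · rw [← ENNReal.ofReal_add (Real.exp_pos _).le (Real.exp_pos _).le]
    congr 1
    ring

end Chaos

/-! ### Banded quadratic forms in the inputs -/

section BandedChaos

variable {p : ℕ}

/-- Two times are close if they differ by less than `T`. -/
def Close (T s s' : ℕ) : Prop := s < s' + T ∧ s' < s + T

instance (T s s' : ℕ) : Decidable (Close T s s') := by unfold Close; infer_instance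

theorem close_comm {T s s' : ℕ} : Close T s s' ↔ Close T s' s := and_comm

/-- The banded quadratic form `∑_{|s - s'| < T} ⟨a_s, x_s⟩ ⟨a_{s'}, x_{s'}⟩` over `s, s' ∈ W`. -/
noncomputable def bandedForm (W : Finset ℕ) (T : ℕ) (a x : ℕ → EuclideanSpace ℝ (Fin p)) : ℝ :=
  ∑ s ∈ W, ∑ s' ∈ W, if Close T s s' then inner ℝ (a s) (x s) * inner ℝ (a s') (x s') else 0

theorem sum_close_le (W : Finset ℕ) (T s : ℕ) {c : ℝ} (hc : 0 ≤ c) :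
    ∑ s' ∈ W, (if Close T s s' then c else 0) ≤ 2 * T * c := by
  rw [← Finset.sum_filter, Finset.sum_const, nsmul_eq_mul]
  have h : (W.filter fun s' => Close T s s') ⊆ Finset.Ico (s + 1 - T) (s + T) := by
    intro s' hs'
    have := (Finset.mem_filter.1 hs').2
    unfold Close at this
    rw [Finset.mem_Ico]
    omega
  have h1 := Finset.card_le_card h
  rw [Nat.card_Ico] at h1
  have h2 : (W.filter fun s' => Close T s s').card ≤ 2 * T := by omega
  have h3 : ((W.filter fun s' => Close T s s').card : ℝ) ≤ 2 * T := by exact_mod_cast h2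
  gcongr

/-- Schur's test: `|ab| ≤ (a² + b²) / 2`, and each index has at most `2T` close ones. -/
theorem sum_sum_close_mul_le (W : Finset ℕ) (T : ℕ) (g : ℕ → ℝ) :
    |∑ s ∈ W, ∑ s' ∈ W, if Close T s s' then g s * g s' else 0| ≤ 2 * T * ∑ s ∈ W, g s ^ 2 := by
  have h1 : ∀ s s', |if Close T s s' then g s * g s' else 0|
      ≤ (if Close T s s' then g s ^ 2 / 2 else 0) + (if Close T s' s then g s' ^ 2 / 2 else 0) := by
    intro s s'
    by_cases h : Close T s s'
    · have h' := close_comm.1 h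
      simp only [h, h', if_true]
      rw [abs_le]
      constructor <;> nlinarith [sq_nonneg (g s + g s'), sq_nonneg (g s - g s')]
    · have h' : ¬ Close T s' s := fun hc => h (close_comm.1 hc)
      simp [h, h']
  have h2 : ∑ s ∈ W, ∑ s' ∈ W, (if Close T s s' then g s ^ 2 / 2 else 0)
      ≤ ∑ s ∈ W, 2 * T * (g s ^ 2 / 2) :=
    Finset.sum_le_sum fun s _ => sum_close_le W T s (by positivity)
  calc _ ≤ ∑ s ∈ W, ∑ s' ∈ W, |if Close T s s' then g s * g s' else 0| :=
        (Finset.abs_sum_le_sum_abs _ _).trans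
          (Finset.sum_le_sum fun s _ => Finset.abs_sum_le_sum_abs _ _)
    _ ≤ ∑ s ∈ W, ∑ s' ∈ W, ((if Close T s s' then g s ^ 2 / 2 else 0)
          + (if Close T s' s then g s' ^ 2 / 2 else 0)) :=
        Finset.sum_le_sum fun s _ => Finset.sum_le_sum fun s' _ => h1 s s'
    _ = 2 * ∑ s ∈ W, ∑ s' ∈ W, (if Close T s s' then g s ^ 2 / 2 else 0) := by
        simp_rw [Finset.sum_add_distrib]
        rw [Finset.sum_comm (f := fun s s' => if Close T s' s then g s' ^ 2 / 2 else 0)]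
        ring
    _ ≤ 2 * ∑ s ∈ W, 2 * T * (g s ^ 2 / 2) := by gcongr
    _ = _ := by rw [← Finset.mul_sum, ← Finset.sum_div]; ring

/-- The matrix of `bandedForm`. -/
noncomputable def bandedMatrix (W : Finset ℕ) (T : ℕ) (a : ℕ → EuclideanSpace ℝ (Fin p)) :
    Matrix (W × Fin p) (W × Fin p) ℝ :=
  Matrix.of fun si si' => if Close T si.1 si'.1 then a si.1 si.2 * a si'.1 si'.2 else 0

theorem bandedMatrix_isHermitian (W : Finset ℕ) (T : ℕ) (a : ℕ → EuclideanSpace ℝ (Fin p)) :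
    (bandedMatrix W T a).IsHermitian := by
  ext si si'
  simp only [bandedMatrix, Matrix.conjTranspose_apply, Matrix.of_apply, star_trivial,
    close_comm (s := (si'.1 : ℕ)), mul_comm]

theorem trace_bandedMatrix (W : Finset ℕ) {T : ℕ} (hT : 1 ≤ T)
    (a : ℕ → EuclideanSpace ℝ (Fin p)) :
    (bandedMatrix W T a).trace = ∑ s ∈ W, ‖a s‖ ^ 2 := by
  have hc : ∀ s, Close T s s := fun s => ⟨by omega, by omega⟩
  rw [Matrix.trace, Fintype.sum_prod_type, ← Finset.sum_coe_sort W]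
  refine Finset.sum_congr rfl fun s _ => ?_
  rw [EuclideanSpace.norm_sq_eq]
  simp [bandedMatrix, hc, sq]

theorem sum_sq_bandedMatrix_le (W : Finset ℕ) (T : ℕ) {a : ℕ → EuclideanSpace ℝ (Fin p)} {R : ℝ}
    (hR : 0 ≤ R) (ha : ∀ s, ‖a s‖ ^ 2 ≤ R) :
    ∑ i, ∑ j, bandedMatrix W T a i j ^ 2 ≤ 2 * T * W.card * R ^ 2 := by
  have h1 : ∑ i, ∑ j, bandedMatrix W T a i j ^ 2
      = ∑ s ∈ W, ∑ s' ∈ W, if Close T s s' then ‖a s‖ ^ 2 * ‖a s'‖ ^ 2 else 0 := by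
    rw [Fintype.sum_prod_type, ← Finset.sum_coe_sort W]
    refine Finset.sum_congr rfl fun s _ => ?_
    rw [← Finset.sum_coe_sort W]
    simp_rw [Fintype.sum_prod_type]
    rw [Finset.sum_comm]
    refine Finset.sum_congr rfl fun s' _ => ?_
    simp only [bandedMatrix, Matrix.of_apply]
    split_ifs
    · simp_rw [EuclideanSpace.norm_sq_eq, Finset.sum_mul_sum, mul_pow, Real.norm_eq_abs, sq_abs]
    · simp
  rw [h1]
  calc _ ≤ ∑ s ∈ W, ∑ s' ∈ W, (if Close T s s' then R * R else 0) := by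
        refine Finset.sum_le_sum fun s _ => Finset.sum_le_sum fun s' _ => ?_
        split_ifs
        · exact mul_le_mul (ha s) (ha s') (by positivity) hR
        · exact le_rfl
    _ ≤ ∑ s ∈ W, 2 * T * (R * R) := Finset.sum_le_sum fun s _ => sum_close_le W T s (by positivity)
    _ = _ := by rw [Finset.sum_const, nsmul_eq_mul]; ring

theorem inner_bandedMatrix (W : Finset ℕ) (T : ℕ) (a : ℕ → EuclideanSpace ℝ (Fin p))
    (z : EuclideanSpace ℝ (W × Fin p)) {x : ℕ → EuclideanSpace ℝ (Fin p)}
    (hx : ∀ s : W, x s = WithLp.toLp 2 fun i => z (s, i)) :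
    inner ℝ z (Matrix.toEuclideanLin (bandedMatrix W T a) z) = bandedForm W T a x := by
  rw [inner_toEuclideanLin_eq_dotProduct, bandedForm, ← Finset.sum_coe_sort W]
  simp only [dotProduct, Matrix.mulVec, Fintype.sum_prod_type, bandedMatrix, Matrix.of_apply]
  refine Finset.sum_congr rfl fun s _ => ?_
  rw [← Finset.sum_coe_sort W]
  simp_rw [Finset.mul_sum]
  rw [Finset.sum_comm]
  refine Finset.sum_congr rfl fun s' _ => ?_
  split_ifs
  · rw [hx, hx, PiLp.inner_apply, PiLp.inner_apply, Finset.sum_mul_sum]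
    refine Finset.sum_congr rfl fun i _ => Finset.sum_congr rfl fun i' _ => ?_
    simp
    ring
  · simp

theorem abs_inner_bandedMatrix_le (W : Finset ℕ) (T : ℕ) {a : ℕ → EuclideanSpace ℝ (Fin p)} {R : ℝ}
    (ha : ∀ s, ‖a s‖ ^ 2 ≤ R) (z : EuclideanSpace ℝ (W × Fin p)) :
    |inner ℝ z (Matrix.toEuclideanLin (bandedMatrix W T a) z)| ≤ 2 * T * R * ‖z‖ ^ 2 := by
  classical
  set x : ℕ → EuclideanSpace ℝ (Fin p) := fun t =>
    if h : t ∈ W then WithLp.toLp 2 fun i => z (⟨t, h⟩, i) else 0 with hxdef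
  have hx : ∀ s : W, x s = WithLp.toLp 2 fun i => z (s, i) := fun s => by simp [hxdef]
  rw [inner_bandedMatrix W T a z hx]
  have hz : ‖z‖ ^ 2 = ∑ s ∈ W, ‖x s‖ ^ 2 := by
    rw [← Finset.sum_coe_sort W, EuclideanSpace.norm_sq_eq, Fintype.sum_prod_type]
    refine Finset.sum_congr rfl fun s _ => ?_
    rw [hx, EuclideanSpace.norm_sq_eq]
  refine (sum_sum_close_mul_le W T fun s => inner ℝ (a s) (x s)).trans ?_
  rw [mul_assoc (2 * (T : ℝ)), hz]
  have hle : ∑ s ∈ W, (inner ℝ (a s) (x s)) ^ 2 ≤ ∑ s ∈ W, R * ‖x s‖ ^ 2 := by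
    refine Finset.sum_le_sum fun s _ => ?_
    have h1 : (inner ℝ (a s) (x s)) ^ 2 ≤ (‖a s‖ * ‖x s‖) ^ 2 := by
      rw [← sq_abs]
      exact pow_le_pow_left₀ (abs_nonneg _) (abs_real_inner_le_norm _ _) 2
    rw [mul_pow] at h1
    exact h1.trans (by gcongr; exact ha s)
  rw [Finset.mul_sum W _ R]
  exact mul_le_mul_of_nonneg_left hle (by positivity)

variable {Ω : Type*} [mΩ : MeasurableSpace Ω] {μ : Measure Ω} [IsProbabilityMeasure μ]
  {N : ℕ} {ℱ : Filtration ℕ mΩ} {u : ℕ → Ω → EuclideanSpace ℝ (Fin p)}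

/-- Bandedness gives form norm `O(TR)` and squared Frobenius norm `O(TNR²)`, so the Hanson–Wright
exponent is of order `ε² N / T`. -/
theorem measure_bandedForm_deviation_le {W : Finset ℕ} (hW : W ⊆ Finset.Icc 1 N)
    (hu : ∀ t ∈ Finset.Icc 1 N, StronglyMeasurable[ℱ t] (u t))
    (hg : ∀ t ∈ Finset.Icc 1 N, CondStdGaussian μ (u t) (ℱ (t - 1)))
    {T : ℕ} (hT : 1 ≤ T) {a : ℕ → EuclideanSpace ℝ (Fin p)} {R ε : ℝ} (hR : 0 < R)
    (ha : ∀ s, ‖a s‖ ^ 2 ≤ R) (hε : 0 < ε) (hε1 : ε ≤ 1) :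
    μ {ω | ε * R * N < |bandedForm W T a (fun t => u t ω) - ∑ s ∈ W, ‖a s‖ ^ 2|}
      ≤ ENNReal.ofReal (2 * Real.exp (-(ε ^ 2 * N / (32 * T)))) := by
  have hT0 : (0 : ℝ) < T := by exact_mod_cast hT
  have hcard : (W.card : ℝ) ≤ N := by
    have := Finset.card_le_card hW
    rw [Nat.card_Icc] at this
    exact_mod_cast this
  -- This `r` minimizes `-r x + 4 r² F`, and `r K = ε / 8` stays within the admissible range.
  have h := measure_abs_quadratic_sub_trace_gt_le (bandedMatrix_isHermitian W T a)
    (K := 2 * T * R) (F := 2 * T * N * R ^ 2) (r := ε / (16 * T * R)) (x := ε * R * N)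
    (abs_inner_bandedMatrix_le W T ha)
    ((sum_sq_bandedMatrix_le W T hR.le ha).trans (by gcongr)) (by positivity) (by
      rw [div_mul_eq_mul_div, div_le_iff₀ (by positivity)]
      have : 0 < T * R := by positivity
      nlinarith)
  rw [trace_bandedMatrix W hT, ← map_stack_eq_stdGaussian hW hu hg] at h
  have hm := (measurable_stack hW hu).aemeasurable (μ := μ)
  refine le_trans (le_trans (le_of_eq ?_) (Measure.le_map_apply hm _))
    (h.trans (ENNReal.ofReal_le_ofReal ?_))
  · congr 1
    ext ω
    simp only [Set.mem_preimage, Set.mem_ofPred_eq]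
    rw [inner_bandedMatrix W T a (stack W u ω) (x := fun t => u t ω) (fun s => rfl)]
  · refine mul_le_mul_of_nonneg_left (Real.exp_le_exp.2 (le_of_eq ?_)) zero_le_two
    field_simp
    ring

end BandedChaos

end SemiPar

namespace SemiPar

/-! ### Quadratic forms on nets -/

section QuadraticNet

/-- Polarization converts control on sums and differences of net points into `|b s s'| ≤ r / 2`. The
net argument, applied once in each variable, multiplies this by `4`. -/
theorem abs_quadratic_le_of_halfNet {F : Type*} [NormedAddCommGroup F] [NormedSpace ℝ F]
    [FiniteDimensional ℝ F] {S : Finset F}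
    (hS : ∀ x : F, ‖x‖ ≤ 1 → ∃ s ∈ S, ‖x - s‖ ≤ 1 / 2) (b : F →ₗ[ℝ] F →ₗ[ℝ] ℝ)
    (hb : ∀ x y, b x y = b y x) {r : ℝ} (hr : 0 ≤ r)
    (h : ∀ s ∈ S, ∀ s' ∈ S, |b (s + s') (s + s')| ≤ r ∧ |b (s - s') (s - s')| ≤ r) (x : F) :
    |b x x| ≤ 2 * r * ‖x‖ ^ 2 := by
  set f : F →L[ℝ] F →L[ℝ] ℝ := LinearMap.toContinuousLinearMap
    ((LinearMap.toContinuousLinearMap : (F →ₗ[ℝ] ℝ) ≃ₗ[ℝ] F →L[ℝ] ℝ).toLinearMap ∘ₗ b) with hf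
  have hfb : ∀ x y, f x y = b x y := fun x y => rfl
  have hpol : ∀ s ∈ S, ∀ s' ∈ S, ‖f s s'‖ ≤ r / 2 := by
    intro s hs s' hs'
    obtain ⟨h1, h2⟩ := h s hs s' hs'
    have e : b (s + s') (s + s') - b (s - s') (s - s') = 4 * b s s' := by
      simp only [map_add, map_sub, LinearMap.add_apply, LinearMap.sub_apply, hb s' s]
      ring
    rw [hfb, Real.norm_eq_abs, abs_le]
    rw [abs_le] at h1 h2
    constructor <;> linarith
  have h1 : ‖f‖ ≤ 2 * (2 * (r / 2)) :=
    opNorm_le_two_mul_of_halfNet hS f (by positivity) fun s hs =>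
      opNorm_le_two_mul_of_halfNet hS (f s) (by positivity) fun s' hs' => hpol s hs s' hs'
  have h2 := f.le_opNorm₂ x x
  rw [hfb, Real.norm_eq_abs] at h2
  calc |b x x| ≤ ‖f‖ * ‖x‖ * ‖x‖ := h2
    _ ≤ 2 * (2 * (r / 2)) * ‖x‖ * ‖x‖ := by gcongr
    _ = _ := by ring

end QuadraticNet

/-! ### Localization of convolution forms in frequency -/

section Fourier

/-- The sum is the real part of a geometric sum over powers of an `M`-th root of unity. -/
theorem sum_cos_eq_ite {M : ℕ} (hM : 0 < M) (n : ℤ) :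
    ∑ k ∈ Finset.range M, Real.cos (2 * Real.pi * k / M * n) = if (M : ℤ) ∣ n then (M : ℝ) else 0 := by
  have hprim := Complex.isPrimitiveRoot_exp M hM.ne'
  set ζ := Complex.exp (2 * Real.pi * Complex.I / M) with hζ
  have hre : ∀ k : ℕ, Real.cos (2 * Real.pi * k / M * n) = ((ζ ^ n) ^ k).re := by
    intro k
    rw [hζ, ← Complex.exp_int_mul, ← Complex.exp_nat_mul,
      show (k : ℂ) * ((n : ℂ) * (2 * Real.pi * Complex.I / M))
        = ((2 * Real.pi * k / M * n : ℝ) : ℂ) * Complex.I by push_cast; ring,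
      Complex.exp_ofReal_mul_I_re]
  simp_rw [hre]
  rw [← Complex.re_sum]
  split_ifs with h
  · rw [(hprim.zpow_eq_one_iff_dvd n).2 h]; simp
  · have hne : ζ ^ n ≠ 1 := fun hc => h ((hprim.zpow_eq_one_iff_dvd n).1 hc)
    rw [geom_sum_eq hne, ← zpow_natCast, ← zpow_mul, mul_comm, zpow_mul, zpow_natCast,
      hprim.pow_eq_one]
    simp

variable {p : ℕ}

/-- The quadratic form `∑_t (∑_{s + j = t} ⟨v_j, x_s⟩)²` of the convolution of `(v_j)_{j < T}`
with `(x_s)_{s ∈ W}`. -/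
noncomputable def convForm (W : Finset ℕ) (T : ℕ) (v x : ℕ → EuclideanSpace ℝ (Fin p)) : ℝ :=
  ∑ s ∈ W, ∑ s' ∈ W, ∑ j ∈ Finset.range T, ∑ j' ∈ Finset.range T,
    if s + j = s' + j' then inner ℝ (v j) (x s) * inner ℝ (v j') (x s') else 0

/-- The pairs of vectors of `ℝ^p`, with the Euclidean norm. -/
abbrev Pair (p : ℕ) : Type := WithLp 2 (EuclideanSpace ℝ (Fin p) × EuclideanSpace ℝ (Fin p))

/-- The real part of `e^{iθs} (w₁ + i w₂)`. -/
noncomputable def rotRe (θ : ℝ) (w : Pair p) (s : ℕ) : EuclideanSpace ℝ (Fin p) :=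
  Real.cos (θ * s) • w.fst - Real.sin (θ * s) • w.snd

/-- The imaginary part of `e^{iθs} (w₁ + i w₂)`. -/
noncomputable def rotIm (θ : ℝ) (w : Pair p) (s : ℕ) : EuclideanSpace ℝ (Fin p) :=
  Real.sin (θ * s) • w.fst + Real.cos (θ * s) • w.snd

theorem norm_sq_rotRe_add_norm_sq_rotIm (θ : ℝ) (w : Pair p) (s : ℕ) :
    ‖rotRe θ w s‖ ^ 2 + ‖rotIm θ w s‖ ^ 2 = ‖w‖ ^ 2 := by
  rw [rotRe, rotIm, norm_sub_sq_real, norm_add_sq_real, WithLp.prod_norm_sq_eq_of_L2]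
  simp only [norm_smul, mul_pow, Real.norm_eq_abs, sq_abs, real_inner_smul_left,
    real_inner_smul_right]
  have := Real.sin_sq_add_cos_sq (θ * s)
  linear_combination (‖w.fst‖ ^ 2 + ‖w.snd‖ ^ 2) * this

/-- The smoothed periodogram of `(x_s)_{s ∈ W}` at the frequency `θ`. -/
noncomputable def spectralForm (W : Finset ℕ) (T : ℕ) (x : ℕ → EuclideanSpace ℝ (Fin p)) (θ : ℝ)
    (w : Pair p) : ℝ :=
  bandedForm W T (rotRe θ w) x + bandedForm W T (rotIm θ w) x

/-- The discrete Fourier transform of `(v_j)_{j < T}`. -/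
noncomputable def fourierPair (T : ℕ) (v : ℕ → EuclideanSpace ℝ (Fin p)) (θ : ℝ) : Pair p :=
  WithLp.toLp 2 (∑ j ∈ Finset.range T, Real.cos (θ * j) • v j,
    ∑ j ∈ Finset.range T, Real.sin (θ * j) • v j)

theorem fourierPair_fst (T : ℕ) (v : ℕ → EuclideanSpace ℝ (Fin p)) (θ : ℝ) :
    (fourierPair T v θ).fst = ∑ j ∈ Finset.range T, Real.cos (θ * j) • v j := rfl

theorem fourierPair_snd (T : ℕ) (v : ℕ → EuclideanSpace ℝ (Fin p)) (θ : ℝ) :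
    (fourierPair T v θ).snd = ∑ j ∈ Finset.range T, Real.sin (θ * j) • v j := rfl

theorem rotRe_fourierPair (T : ℕ) (v : ℕ → EuclideanSpace ℝ (Fin p)) (θ : ℝ) (s : ℕ) :
    rotRe θ (fourierPair T v θ) s
      = ∑ j ∈ Finset.range T, Real.cos (θ * ((s + j : ℕ) : ℝ)) • v j := by
  simp only [rotRe, fourierPair_fst, fourierPair_snd, Finset.smul_sum, ← Finset.sum_sub_distrib]
  refine Finset.sum_congr rfl fun j _ => ?_
  rw [smul_smul, smul_smul, ← sub_smul]
  push_cast
  rw [mul_add, Real.cos_add]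

theorem rotIm_fourierPair (T : ℕ) (v : ℕ → EuclideanSpace ℝ (Fin p)) (θ : ℝ) (s : ℕ) :
    rotIm θ (fourierPair T v θ) s
      = ∑ j ∈ Finset.range T, Real.sin (θ * ((s + j : ℕ) : ℝ)) • v j := by
  simp only [rotIm, fourierPair_fst, fourierPair_snd, Finset.smul_sum, ← Finset.sum_add_distrib]
  refine Finset.sum_congr rfl fun j _ => ?_
  rw [smul_smul, smul_smul, ← add_smul]
  push_cast
  rw [mul_add, Real.sin_add]

/-- Rotating the Fourier transform of `v` by `s` shifts the phases to `θ (s + j)`. Real and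
imaginary parts then combine by the cosine difference formula. -/
theorem spectralForm_fourierPair (W : Finset ℕ) (T : ℕ) (v x : ℕ → EuclideanSpace ℝ (Fin p))
    (θ : ℝ) :
    spectralForm W T x θ (fourierPair T v θ)
      = ∑ s ∈ W, ∑ s' ∈ W, if Close T s s' then ∑ j ∈ Finset.range T, ∑ j' ∈ Finset.range T,
          inner ℝ (v j) (x s) * inner ℝ (v j') (x s')
            * Real.cos (θ * (((s : ℤ) + j - (s' + j') : ℤ) : ℝ)) else 0 := by
  simp only [spectralForm, bandedForm, ← Finset.sum_add_distrib]
  refine Finset.sum_congr rfl fun s _ => Finset.sum_congr rfl fun s' _ => ?_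
  split_ifs
  · simp only [rotRe_fourierPair, rotIm_fourierPair, sum_inner, real_inner_smul_left,
      Finset.sum_mul_sum, ← Finset.sum_add_distrib]
    refine Finset.sum_congr rfl fun j _ => Finset.sum_congr rfl fun j' _ => ?_
    push_cast
    rw [mul_sub, Real.cos_sub]
    ring
  · simp

theorem norm_sq_fourierPair (T : ℕ) (v : ℕ → EuclideanSpace ℝ (Fin p)) (θ : ℝ) :
    ‖fourierPair T v θ‖ ^ 2 = ∑ j ∈ Finset.range T, ∑ j' ∈ Finset.range T,
      inner ℝ (v j) (v j') * Real.cos (θ * (((j : ℤ) - j' : ℤ) : ℝ)) := by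
  rw [WithLp.prod_norm_sq_eq_of_L2]
  simp only [fourierPair_fst, fourierPair_snd, ← real_inner_self_eq_norm_sq, sum_inner, inner_sum, real_inner_smul_left,
    real_inner_smul_right, ← Finset.sum_add_distrib]
  refine Finset.sum_congr rfl fun j _ => Finset.sum_congr rfl fun j' _ => ?_
  push_cast
  rw [mul_sub, Real.cos_sub, real_inner_comm]
  ring

theorem dvd_two_mul_iff_of_close {T : ℕ} {n : ℤ} (h1 : n < 2 * T) (h2 : -n < 2 * T) :
    ((2 * T : ℕ) : ℤ) ∣ n ↔ n = 0 := by
  constructor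
  · intro h
    refine Int.eq_zero_of_abs_lt_dvd h ?_
    push_cast
    exact abs_lt.2 ⟨by linarith, h1⟩
  · rintro rfl
    exact dvd_zero _

/-- The frequencies `2πk / (2T)`. -/
noncomputable def freq (T k : ℕ) : ℝ := 2 * Real.pi * k / (2 * T : ℕ)

/-- Summing over `2T` frequencies keeps the terms with `s + j ≡ s' + j'` modulo `2T`. The band `|s -
s'| < T` rules out aliasing, since both differences are then below `T`; conversely every term of the
convolution form lies in the band. -/
theorem sum_spectralForm_eq (W : Finset ℕ) {T : ℕ} (hT : 1 ≤ T)
    (v x : ℕ → EuclideanSpace ℝ (Fin p)) :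
    ∑ k ∈ Finset.range (2 * T), spectralForm W T x (freq T k) (fourierPair T v (freq T k))
      = 2 * T * convForm W T v x := by
  simp only [spectralForm_fourierPair]
  rw [Finset.sum_comm, convForm, Finset.mul_sum]
  refine Finset.sum_congr rfl fun s _ => ?_
  rw [Finset.sum_comm, Finset.mul_sum]
  refine Finset.sum_congr rfl fun s' _ => ?_
  by_cases hc : Close T s s'
  · simp only [hc, if_true]
    rw [Finset.sum_comm, Finset.mul_sum]
    refine Finset.sum_congr rfl fun j hj => ?_
    rw [Finset.sum_comm, Finset.mul_sum]
    refine Finset.sum_congr rfl fun j' hj' => ?_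
    rw [← Finset.mul_sum]
    unfold freq
    rw [sum_cos_eq_ite (by omega)]
    have hj := Finset.mem_range.1 hj
    have hj' := Finset.mem_range.1 hj'
    unfold Close at hc
    have hiff : (((2 * T : ℕ) : ℤ) ∣ ((s : ℤ) + j - (s' + j'))) ↔ s + j = s' + j' := by
      rw [dvd_two_mul_iff_of_close (by omega) (by omega)]
      omega
    simp only [hiff]
    split_ifs
    · push_cast; ring
    · ring
  · simp only [hc, if_false, Finset.sum_const_zero]
    symm
    rw [mul_eq_zero]
    right
    refine Finset.sum_eq_zero fun j hj => Finset.sum_eq_zero fun j' hj' => ?_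
    have hj := Finset.mem_range.1 hj
    have hj' := Finset.mem_range.1 hj'
    unfold Close at hc
    rw [if_neg]
    omega

theorem sum_norm_sq_fourierPair_eq {T : ℕ} (hT : 1 ≤ T) (v : ℕ → EuclideanSpace ℝ (Fin p)) :
    ∑ k ∈ Finset.range (2 * T), ‖fourierPair T v (freq T k)‖ ^ 2
      = 2 * T * ∑ j ∈ Finset.range T, ‖v j‖ ^ 2 := by
  simp only [norm_sq_fourierPair]
  rw [Finset.sum_comm, Finset.mul_sum]
  refine Finset.sum_congr rfl fun j hj => ?_
  rw [Finset.sum_comm, Finset.sum_eq_single j]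
  · rw [← Finset.mul_sum]
    simp
    ring
  · intro j' hj' hne
    rw [← Finset.mul_sum]
    unfold freq
    rw [sum_cos_eq_ite (by omega), if_neg, mul_zero]
    have hj := Finset.mem_range.1 hj
    have hj' := Finset.mem_range.1 hj'
    rw [dvd_two_mul_iff_of_close (by omega) (by omega)]
    omega
  · intro h; exact absurd hj h

/-- Parseval gives `‖v‖²` the same frequency average, so a bound valid at each of the `2T`
frequencies transfers to all sequences `v`. -/
theorem abs_convForm_sub_le {W : Finset ℕ} {T : ℕ} (hT : 1 ≤ T)
    {x : ℕ → EuclideanSpace ℝ (Fin p)} {r : ℝ}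
    (h : ∀ k ∈ Finset.range (2 * T), ∀ w : Pair p,
      |spectralForm W T x (freq T k) w - W.card * ‖w‖ ^ 2| ≤ r * ‖w‖ ^ 2)
    (v : ℕ → EuclideanSpace ℝ (Fin p)) :
    |convForm W T v x - W.card * ∑ j ∈ Finset.range T, ‖v j‖ ^ 2|
      ≤ r * ∑ j ∈ Finset.range T, ‖v j‖ ^ 2 := by
  have hT0 : (0 : ℝ) < 2 * T := by
    have : (0 : ℝ) < T := by exact_mod_cast hT
    positivity
  have h1 := sum_spectralForm_eq W hT v x
  have h2 := sum_norm_sq_fourierPair_eq hT v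
  have h3 : |∑ k ∈ Finset.range (2 * T), (spectralForm W T x (freq T k) (fourierPair T v (freq T k))
      - W.card * ‖fourierPair T v (freq T k)‖ ^ 2)|
      ≤ ∑ k ∈ Finset.range (2 * T), r * ‖fourierPair T v (freq T k)‖ ^ 2 :=
    (Finset.abs_sum_le_sum_abs _ _).trans (Finset.sum_le_sum fun k hk => h k hk _)
  rw [Finset.sum_sub_distrib, ← Finset.mul_sum, ← Finset.mul_sum, h1, h2,
    show (2 * (T : ℝ)) * convForm W T v x - W.card * (2 * T * ∑ j ∈ Finset.range T, ‖v j‖ ^ 2)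
      = 2 * T * (convForm W T v x - W.card * ∑ j ∈ Finset.range T, ‖v j‖ ^ 2) by ring,
    abs_mul, abs_of_pos hT0] at h3
  refine le_of_mul_le_mul_left (h3.trans (le_of_eq ?_)) hT0
  ring

/-- The bilinear form polarizing `spectralForm W T x θ w - |W| ‖w‖²`. -/
theorem exists_bilinear_spectralForm (W : Finset ℕ) (T : ℕ) (x : ℕ → EuclideanSpace ℝ (Fin p))
    (θ : ℝ) :
    ∃ b : Pair p →ₗ[ℝ] Pair p →ₗ[ℝ] ℝ, (∀ w w', b w w' = b w' w) ∧
      ∀ w, b w w = spectralForm W T x θ w - W.card * ‖w‖ ^ 2 := by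
  set fstₗ : Pair p →ₗ[ℝ] EuclideanSpace ℝ (Fin p) :=
    LinearMap.fst ℝ _ _ ∘ₗ (WithLp.linearEquiv 2 ℝ _).toLinearMap
  set sndₗ : Pair p →ₗ[ℝ] EuclideanSpace ℝ (Fin p) :=
    LinearMap.snd ℝ _ _ ∘ₗ (WithLp.linearEquiv 2 ℝ _).toLinearMap
  set f : ℕ → Pair p →ₗ[ℝ] ℝ := fun s =>
    innerₗ _ (x s) ∘ₗ (Real.cos (θ * s) • fstₗ - Real.sin (θ * s) • sndₗ)
  set g : ℕ → Pair p →ₗ[ℝ] ℝ := fun s =>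
    innerₗ _ (x s) ∘ₗ (Real.sin (θ * s) • fstₗ + Real.cos (θ * s) • sndₗ)
  have hf : ∀ s w, f s w = inner ℝ (rotRe θ w s) (x s) := fun s w => by
    rw [real_inner_comm]; rfl
  have hg : ∀ s w, g s w = inner ℝ (rotIm θ w s) (x s) := fun s w => by
    rw [real_inner_comm]; rfl
  refine ⟨(∑ s ∈ W, ∑ s' ∈ W, if Close T s s' then
    (f s).smulRight (f s') + (g s).smulRight (g s') else 0) - (W.card : ℝ) • innerₗ (Pair p), ?_, ?_⟩
  · intro w w'
    simp only [LinearMap.sub_apply, LinearMap.sum_apply, LinearMap.smul_apply, innerₗ_apply_apply]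
    rw [Finset.sum_comm, real_inner_comm]
    congr 1
    refine Finset.sum_congr rfl fun s _ => Finset.sum_congr rfl fun s' _ => ?_
    by_cases hc : Close T s s'
    · simp [hc, close_comm.1 hc, mul_comm]
    · simp [hc, mt close_comm.1 hc]
  · intro w
    simp only [LinearMap.sub_apply, LinearMap.sum_apply, LinearMap.smul_apply, innerₗ_apply_apply,
      real_inner_self_eq_norm_sq, spectralForm, bandedForm, ← Finset.sum_add_distrib, smul_eq_mul]
    congr 1
    refine Finset.sum_congr rfl fun s _ => Finset.sum_congr rfl fun s' _ => ?_
    split_ifs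
    · simp [hf, hg]
    · simp

end Fourier

end SemiPar

namespace SemiPar

/-! ### From convolution energy to the design matrix -/

section Windows

variable {p : ℕ}

/-- The value at time `t` of the convolution of `(v_j)_{j < T}` with `(x_s)_{s ∈ W}`. -/
noncomputable def convAt (W : Finset ℕ) (T : ℕ) (v x : ℕ → EuclideanSpace ℝ (Fin p)) (t : ℕ) : ℝ :=
  ∑ s ∈ W, ∑ j ∈ Finset.range T, if s + j = t then inner ℝ (v j) (x s) else 0

theorem convForm_eq_sum_sq {W : Finset ℕ} {T B : ℕ} (hB : ∀ s ∈ W, s + T ≤ B)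
    (v x : ℕ → EuclideanSpace ℝ (Fin p)) :
    convForm W T v x = ∑ t ∈ Finset.range B, convAt W T v x t ^ 2 := by
  simp only [sq, convAt, Finset.sum_mul_sum]
  rw [convForm]
  conv_rhs => rw [Finset.sum_comm]
  refine Finset.sum_congr rfl fun s hs => ?_
  conv_rhs => rw [Finset.sum_comm]
  refine Finset.sum_congr rfl fun s' _ => ?_
  conv_rhs => rw [Finset.sum_comm]
  refine Finset.sum_congr rfl fun j hj => ?_
  conv_rhs => rw [Finset.sum_comm]
  refine Finset.sum_congr rfl fun j' _ => ?_
  have hj := Finset.mem_range.1 hj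
  rw [Finset.sum_eq_single (s + j)]
  · by_cases h : s + j = s' + j'
    · simp [h]
    · rw [if_neg h, if_neg (Ne.symm h), mul_zero]
  · intro t _ ht
    rw [if_neg (Ne.symm ht), zero_mul]
  · intro h
    exact absurd (Finset.mem_range.2 (lt_of_lt_of_le (by omega) (hB s hs))) h

theorem convAt_congr_window {W W' : Finset ℕ} {T t : ℕ} (hsub : W' ⊆ W)
    (h : ∀ s ∈ W, s ∉ W' → ∀ j < T, s + j ≠ t) (v x : ℕ → EuclideanSpace ℝ (Fin p)) :
    convAt W T v x t = convAt W' T v x t := by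
  refine (Finset.sum_subset hsub fun s hs hs' => ?_).symm
  exact Finset.sum_eq_zero fun j hj => if_neg (h s hs hs' j (Finset.mem_range.1 hj))

theorem convAt_eq_sum {W : Finset ℕ} {T t : ℕ} (h : ∀ j < T, j ≤ t ∧ t - j ∈ W)
    (v x : ℕ → EuclideanSpace ℝ (Fin p)) :
    convAt W T v x t = ∑ j ∈ Finset.range T, inner ℝ (v j) (x (t - j)) := by
  rw [convAt, Finset.sum_comm]
  refine Finset.sum_congr rfl fun j hj => ?_
  obtain ⟨h1, h2⟩ := h j (Finset.mem_range.1 hj)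
  rw [Finset.sum_eq_single (t - j)]
  · rw [if_pos (by omega)]
  · intro s _ hs
    rw [if_neg (by omega)]
  · intro hc; exact absurd h2 hc

/-- The full convolution energy equals the energy of the design plus the outputs before `N₁` and
after `N`. These edge outputs involve only the first or last `T - 1` inputs of the window, so they
are dominated by the energies of those short windows. -/
theorem convForm_window_bounds {T N₁ N : ℕ} (hT : 1 ≤ T) (hTN : T ≤ N₁) (hN : N₁ ≤ N)
    (v x : ℕ → EuclideanSpace ℝ (Fin p)) :
    (∑ t ∈ Finset.Icc N₁ N, (∑ j ∈ Finset.range T, inner ℝ (v j) (x (t - j))) ^ 2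
      ≤ convForm (Finset.Icc (N₁ + 1 - T) N) T v x) ∧
    convForm (Finset.Icc (N₁ + 1 - T) N) T v x
      ≤ ∑ t ∈ Finset.Icc N₁ N, (∑ j ∈ Finset.range T, inner ℝ (v j) (x (t - j))) ^ 2
        + convForm (Finset.Icc (N₁ + 1 - T) (N₁ - 1)) T v x
        + convForm (Finset.Icc (N + 2 - T) N) T v x := by
  have hmid : ∀ t ∈ Finset.Icc N₁ N, convAt (Finset.Icc (N₁ + 1 - T) N) T v x t
      = ∑ j ∈ Finset.range T, inner ℝ (v j) (x (t - j)) := by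
    intro t ht
    have ht := Finset.mem_Icc.1 ht
    exact convAt_eq_sum (fun j hj => ⟨by omega, Finset.mem_Icc.2 (by omega)⟩) v x
  have hsub : Finset.Icc N₁ N ⊆ Finset.range (N + T) := fun t ht => by
    have := Finset.mem_Icc.1 ht
    exact Finset.mem_range.2 (by omega)
  rw [convForm_eq_sum_sq (B := N + T) (fun s hs => by have := Finset.mem_Icc.1 hs; omega),
    convForm_eq_sum_sq (B := N + T) (fun s hs => by have := Finset.mem_Icc.1 hs; omega),
    convForm_eq_sum_sq (B := N + T) (fun s hs => by have := Finset.mem_Icc.1 hs; omega)]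
  have hmid' : ∑ t ∈ Finset.Icc N₁ N, (∑ j ∈ Finset.range T, inner ℝ (v j) (x (t - j))) ^ 2
      = ∑ t ∈ Finset.range (N + T), if t ∈ Finset.Icc N₁ N then
          convAt (Finset.Icc (N₁ + 1 - T) N) T v x t ^ 2 else 0 := by
    rw [← Finset.sum_filter, Finset.filter_mem_eq_inter, Finset.inter_eq_right.2 hsub]
    exact Finset.sum_congr rfl fun t ht => by rw [hmid t ht]
  rw [hmid', ← Finset.sum_add_distrib, ← Finset.sum_add_distrib]
  refine ⟨Finset.sum_le_sum fun t _ => ?_, Finset.sum_le_sum fun t _ => ?_⟩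
  · split_ifs
    · exact le_rfl
    · exact sq_nonneg _
  · by_cases h1 : t < N₁
    · rw [convAt_congr_window (W' := Finset.Icc (N₁ + 1 - T) (N₁ - 1)) (W := Finset.Icc (N₁ + 1 - T) N)
        (Finset.Icc_subset_Icc_right (by omega)) (fun s hs hs' j hj => by
          rw [Finset.mem_Icc] at hs hs'; omega),
        if_neg (by rw [Finset.mem_Icc]; omega), zero_add]
      exact le_add_of_nonneg_right (sq_nonneg _)
    · by_cases h2 : t ≤ N
      · rw [if_pos (Finset.mem_Icc.2 ⟨by omega, h2⟩), add_assoc]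
        exact le_add_of_nonneg_right (by positivity)
      · rw [convAt_congr_window (W' := Finset.Icc (N + 2 - T) N) (W := Finset.Icc (N₁ + 1 - T) N)
          (Finset.Icc_subset_Icc_left (by omega)) (fun s hs hs' j hj => by
            rw [Finset.mem_Icc] at hs hs'; omega),
          if_neg (by rw [Finset.mem_Icc]; omega), zero_add]
        exact le_add_of_nonneg_left (sq_nonneg _)

variable {Ω : Type*} {T N₁ N : ℕ}

theorem mem_wellConditioned_of_convForm (hT : 1 ≤ T) (hTN : T ≤ N₁) (hN : N₁ ≤ N)
    (hN10 : (N₁ : ℝ) ≤ N / 10)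
    {u : ℕ → Ω → EuclideanSpace ℝ (Fin p)} {ω : Ω}
    (h : ∀ W ∈ ({Finset.Icc (N₁ + 1 - T) N, Finset.Icc (N₁ + 1 - T) (N₁ - 1),
        Finset.Icc (N + 2 - T) N} : Finset (Finset ℕ)), ∀ v : ℕ → EuclideanSpace ℝ (Fin p),
      |convForm W T v (fun t => u t ω) - W.card * ∑ j ∈ Finset.range T, ‖v j‖ ^ 2|
        ≤ 2 / 25 * N * ∑ j ∈ Finset.range T, ‖v j‖ ^ 2) :
    ω ∈ wellConditioned T N₁ N u := by
  classical
  set U := Ubar T N₁ N u ω with hU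
  have hNr : (N₁ : ℝ) ≤ N := by exact_mod_cast hN
  have hTr : (T : ℝ) ≤ N₁ := by exact_mod_cast hTN
  have hT1 : (1 : ℝ) ≤ T := by exact_mod_cast hT
  have hquad : ∀ x : Fin T × Fin p → ℝ,
      N / 2 * (x ⬝ᵥ x) ≤ x ⬝ᵥ ((Uᵀ * U) *ᵥ x) ∧ x ⬝ᵥ ((Uᵀ * U) *ᵥ x) ≤ 2 * N * (x ⬝ᵥ x) := by
    intro x
    set v : ℕ → EuclideanSpace ℝ (Fin p) := fun j =>
      if h : j < T then WithLp.toLp 2 fun i => x (⟨j, h⟩, i) else 0 with hv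
    have hvj : ∀ j : Fin T, v j = WithLp.toLp 2 fun i => x (j, i) := fun j => by simp [hv]
    have hnorm : ∑ j ∈ Finset.range T, ‖v j‖ ^ 2 = x ⬝ᵥ x := by
      rw [Finset.sum_range (fun j => ‖v j‖ ^ 2)]
      simp only [hvj, EuclideanSpace.norm_sq_eq, dotProduct, Fintype.sum_prod_type,
        Real.norm_eq_abs, sq_abs]
      simp only [sq]
    have hUx : x ⬝ᵥ ((Uᵀ * U) *ᵥ x)
        = ∑ t ∈ Finset.Icc N₁ N, (∑ j ∈ Finset.range T, inner ℝ (v j) (u (t - j) ω)) ^ 2 := by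
      rw [← Matrix.mulVec_mulVec, Matrix.dotProduct_mulVec, Matrix.vecMul_transpose]
      refine Eq.trans ?_ (Finset.sum_coe_sort (Finset.Icc N₁ N) (fun t =>
        (∑ j ∈ Finset.range T, inner ℝ (v j) (u (t - j) ω)) ^ 2))
      refine Finset.sum_congr rfl fun t _ => ?_
      rw [sq, Finset.sum_range (fun j => inner ℝ (v j) (u (t - j) ω))]
      have : (U *ᵥ x) t = ∑ j : Fin T, inner ℝ (v j) (u (t - j) ω) := by
        simp only [hvj, PiLp.inner_apply, Matrix.mulVec, dotProduct, Fintype.sum_prod_type]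
        rfl
      rw [this]
    obtain ⟨h1, h2⟩ := convForm_window_bounds hT hTN hN v (fun t => u t ω)
    have hW := abs_le.1 (h (Finset.Icc (N₁ + 1 - T) N) (by simp) v)
    have hL := abs_le.1 (h (Finset.Icc (N₁ + 1 - T) (N₁ - 1)) (by simp) v)
    have hR := abs_le.1 (h (Finset.Icc (N + 2 - T) N) (by simp) v)
    have cW : ((Finset.Icc (N₁ + 1 - T) N).card : ℝ) = N - N₁ + T := by
      rw [Nat.card_Icc, ← Nat.cast_sub hN, ← Nat.cast_add]
      congr 1; omega
    have cast_pred : ((T - 1 : ℕ) : ℝ) = T - 1 := by rw [Nat.cast_sub hT, Nat.cast_one]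
    have cL : ((Finset.Icc (N₁ + 1 - T) (N₁ - 1)).card : ℝ) = T - 1 := by
      rw [Nat.card_Icc, ← cast_pred]
      congr 1; omega
    have cR : ((Finset.Icc (N + 2 - T) N).card : ℝ) = T - 1 := by
      rw [Nat.card_Icc, ← cast_pred]
      congr 1; omega
    rw [cW, hnorm] at hW
    rw [cL, hnorm] at hL
    rw [cR, hnorm] at hR
    rw [← hUx] at h1 h2
    have hx0 : 0 ≤ x ⬝ᵥ x := by rw [← hnorm]; positivity
    set q := x ⬝ᵥ x
    have m1 : (N₁ : ℝ) * q ≤ N / 10 * q := by gcongr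
    have m2 : (T : ℝ) * q ≤ N₁ * q := by gcongr
    have m3 : 0 ≤ (N : ℝ) * q := by positivity
    -- Lower bound: at least `N - N₁ - T - 0.24 N ≥ 0.56 N`, the three windows each losing `0.08 N`
    -- and `T ≤ N₁ ≤ N / 10`. The upper bound uses the full window alone.
    constructor <;> nlinarith
  have hherm : (Uᵀ * U).IsHermitian := by
    have := Matrix.isHermitian_conjTranspose_mul_self U
    rwa [Matrix.conjTranspose_eq_transpose_of_trivial] at this
  have hone : ∀ c : ℝ, (c • (1 : Matrix (Fin T × Fin p) (Fin T × Fin p) ℝ)).IsHermitian := by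
    intro c
    rw [Matrix.IsHermitian, Matrix.conjTranspose_smul, Matrix.conjTranspose_one]
    simp
  refine ⟨Matrix.le_iff.2 (Matrix.PosSemidef.of_dotProduct_mulVec_nonneg (hherm.sub (hone _)) fun x => ?_),
    Matrix.le_iff.2 (Matrix.PosSemidef.of_dotProduct_mulVec_nonneg ((hone _).sub hherm) fun x => ?_)⟩
  · rw [star_trivial, Matrix.sub_mulVec, dotProduct_sub, Matrix.smul_mulVec, Matrix.one_mulVec,
      dotProduct_smul, smul_eq_mul, sub_nonneg]
    exact (hquad x).1
  · rw [star_trivial, Matrix.sub_mulVec, dotProduct_sub, Matrix.smul_mulVec, Matrix.one_mulVec,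
      dotProduct_smul, smul_eq_mul, sub_nonneg]
    exact (hquad x).2

end Windows

/-! ### Probability of a well-conditioned Gaussian design -/

section DesignConcentration

variable {Ω : Type*} [mΩ : MeasurableSpace Ω] {μ : Measure Ω} [IsProbabilityMeasure μ]
  {T N₁ N p : ℕ} {ℱ : Filtration ℕ mΩ} {u : ℕ → Ω → EuclideanSpace ℝ (Fin p)}

/-- The periodogram is a sum of two banded forms whose coefficient norms squared add up to `‖w‖² ≤
4`. Radius `2` is needed because `w` will be a sum or difference of net points. -/
theorem measure_spectralForm_deviation_le {W : Finset ℕ} (hW : W ⊆ Finset.Icc 1 N)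
    (hu : ∀ t ∈ Finset.Icc 1 N, StronglyMeasurable[ℱ t] (u t))
    (hg : ∀ t ∈ Finset.Icc 1 N, CondStdGaussian μ (u t) (ℱ (t - 1))) (hT : 1 ≤ T)
    (θ : ℝ) {w : Pair p} (hw : ‖w‖ ≤ 2) {ε : ℝ} (hε : 0 < ε) (hε1 : ε ≤ 1) :
    μ {ω | 8 * ε * N < |spectralForm W T (fun t => u t ω) θ w - W.card * ‖w‖ ^ 2|}
      ≤ ENNReal.ofReal (4 * Real.exp (-(ε ^ 2 * N / (32 * T)))) := by
  have hrot := norm_sq_rotRe_add_norm_sq_rotIm θ w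
  have hw4 : ‖w‖ ^ 2 ≤ 4 := by nlinarith [norm_nonneg w]
  have h1 := measure_bandedForm_deviation_le hW hu hg hT (a := rotRe θ w) (R := 4) (by norm_num)
    (fun s => by nlinarith [hrot s, sq_nonneg ‖rotIm θ w s‖]) hε hε1
  have h2 := measure_bandedForm_deviation_le hW hu hg hT (a := rotIm θ w) (R := 4) (by norm_num)
    (fun s => by nlinarith [hrot s, sq_nonneg ‖rotRe θ w s‖]) hε hε1
  refine (measure_mono fun ω hω => ?_).trans ((measure_union_le _ _).trans (add_le_add h1 h2) |>.trans
    (le_of_eq ?_))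
  · by_contra hcon
    simp only [Set.mem_union, Set.mem_ofPred_eq, not_or, not_lt] at hcon hω
    have hsum : (W.card : ℝ) * ‖w‖ ^ 2
        = ∑ s ∈ W, ‖rotRe θ w s‖ ^ 2 + ∑ s ∈ W, ‖rotIm θ w s‖ ^ 2 := by
      rw [← Finset.sum_add_distrib, Finset.sum_congr rfl fun s _ => hrot s, Finset.sum_const,
        nsmul_eq_mul]
    rw [spectralForm, hsum, add_sub_add_comm] at hω
    have := abs_add_le (bandedForm W T (rotRe θ w) (fun t => u t ω) - ∑ s ∈ W, ‖rotRe θ w s‖ ^ 2)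
      (bandedForm W T (rotIm θ w) (fun t => u t ω) - ∑ s ∈ W, ‖rotIm θ w s‖ ^ 2)
    linarith [hcon.1, hcon.2]
  · rw [← ENNReal.ofReal_add (by positivity) (by positivity)]
    congr 1
    ring

theorem finrank_pair (p : ℕ) : Module.finrank ℝ (Pair p) = 2 * p := by
  rw [(WithLp.linearEquiv 2 ℝ (EuclideanSpace ℝ (Fin p) × EuclideanSpace ℝ (Fin p))).finrank_eq,
    Module.finrank_prod, finrank_euclideanSpace, Fintype.card_fin]
  ring

/-- Union bound over `2T` frequencies and at most `2 · 5^(4p)` sums and differences of net points.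
The entropy is of order `log T + p`, not `Tp`, because each frequency involves only `2p` real
dimensions. -/
theorem measure_convForm_deviation_le {W : Finset ℕ} (hW : W ⊆ Finset.Icc 1 N)
    (hu : ∀ t ∈ Finset.Icc 1 N, StronglyMeasurable[ℱ t] (u t))
    (hg : ∀ t ∈ Finset.Icc 1 N, CondStdGaussian μ (u t) (ℱ (t - 1))) (hT : 1 ≤ T)
    {ε : ℝ} (hε : 0 < ε) (hε1 : ε ≤ 1) :
    μ {ω | ¬ ∀ v : ℕ → EuclideanSpace ℝ (Fin p),
        |convForm W T v (fun t => u t ω) - W.card * ∑ j ∈ Finset.range T, ‖v j‖ ^ 2|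
          ≤ 16 * ε * N * ∑ j ∈ Finset.range T, ‖v j‖ ^ 2}
      ≤ ENNReal.ofReal (16 * T * 5 ^ (4 * p) * Real.exp (-(ε ^ 2 * N / (32 * T)))) := by
  classical
  obtain ⟨S, hS1, hScard, hSnet⟩ := exists_halfNet (Pair p)
  rw [finrank_pair] at hScard
  set S' : Finset (Pair p) := (S ×ˢ S).image (fun q => q.1 + q.2) ∪ (S ×ˢ S).image (fun q => q.1 - q.2)
    with hS'
  have hS'card : S'.card ≤ 2 * 5 ^ (4 * p) := by
    have h1 : S.card * S.card ≤ 5 ^ (2 * p) * 5 ^ (2 * p) := Nat.mul_le_mul hScard hScard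
    rw [← pow_add, show 2 * p + 2 * p = 4 * p by ring] at h1
    refine (Finset.card_union_le _ _).trans ?_
    have h2 := (Finset.card_image_le (s := S ×ˢ S) (f := fun q : Pair p × Pair p => q.1 + q.2))
    have h3 := (Finset.card_image_le (s := S ×ˢ S) (f := fun q : Pair p × Pair p => q.1 - q.2))
    rw [Finset.card_product] at h2 h3
    omega
  have hS'norm : ∀ w ∈ S', ‖w‖ ≤ 2 := by
    intro w hw
    rcases Finset.mem_union.1 hw with h | h <;> obtain ⟨q, hq, rfl⟩ := Finset.mem_image.1 h <;>
      obtain ⟨hq1, hq2⟩ := Finset.mem_product.1 hq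
    · exact (norm_add_le _ _).trans (by linarith [hS1 _ hq1, hS1 _ hq2])
    · exact (norm_sub_le _ _).trans (by linarith [hS1 _ hq1, hS1 _ hq2])
  set E := Real.exp (-(ε ^ 2 * N / (32 * T))) with hE
  set bad : ℕ → Pair p → Set Ω := fun k w =>
    {ω | 8 * ε * N < |spectralForm W T (fun t => u t ω) (freq T k) w - W.card * ‖w‖ ^ 2|} with hbad
  have hunion : μ (⋃ k ∈ Finset.range (2 * T), ⋃ w ∈ S', bad k w)
      ≤ ENNReal.ofReal (16 * T * 5 ^ (4 * p) * E) := by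
    calc _ ≤ ∑ k ∈ Finset.range (2 * T), ∑ w ∈ S', μ (bad k w) :=
          (measure_biUnion_finset_le _ _).trans
            (Finset.sum_le_sum fun k _ => measure_biUnion_finset_le _ _)
      _ ≤ ∑ k ∈ Finset.range (2 * T), ∑ w ∈ S', ENNReal.ofReal (4 * E) :=
          Finset.sum_le_sum fun k _ => Finset.sum_le_sum fun w hw =>
            measure_spectralForm_deviation_le hW hu hg hT _ (hS'norm w hw) hε hε1
      _ = ((2 * T : ℕ) : ENNReal) * ((S'.card : ENNReal) * ENNReal.ofReal (4 * E)) := by simp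
      _ ≤ ((2 * T : ℕ) : ENNReal) * (((2 * 5 ^ (4 * p) : ℕ) : ENNReal)
            * ENNReal.ofReal (4 * E)) := by gcongr
      _ = _ := by
          rw [← ENNReal.ofReal_natCast (2 * T), ← ENNReal.ofReal_natCast (2 * 5 ^ (4 * p)),
            ← ENNReal.ofReal_mul (by positivity), ← ENNReal.ofReal_mul (by positivity)]
          congr 1
          push_cast
          ring
  refine (measure_mono fun ω hω => ?_).trans hunion
  by_contra hgood
  simp only [Set.mem_iUnion, not_exists] at hgood
  refine hω (abs_convForm_sub_le hT fun k hk w => ?_)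
  obtain ⟨b, hsymm, hb⟩ := exists_bilinear_spectralForm W T (fun t => u t ω) (freq T k)
  have hle : ∀ w ∈ S', |b w w| ≤ 8 * ε * N := fun w hw => by
    rw [hb]
    exact not_lt.1 (hgood k hk w hw)
  rw [← hb]
  have := abs_quadratic_le_of_halfNet hSnet b hsymm (r := 8 * ε * N) (by positivity)
    (fun s hs s' hs' => ⟨hle _ ?_, hle _ ?_⟩) w
  · exact this.trans (le_of_eq (by ring))
  · exact Finset.mem_union_left _ (Finset.mem_image.2 ⟨(s, s'), Finset.mem_product.2 ⟨hs, hs'⟩, rfl⟩)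
  · exact Finset.mem_union_right _ (Finset.mem_image.2 ⟨(s, s'), Finset.mem_product.2 ⟨hs, hs'⟩, rfl⟩)

theorem deltaU_eq_exp {T N p : ℕ} (hN : 1 ≤ N) (hp : 1 ≤ p) :
    deltaU T N p = Real.exp (-(Real.log (2 * T * p) ^ 2 * Real.log (2 * N * p) ^ 2)) := by
  have hN0 : (0 : ℝ) < N := by exact_mod_cast hN
  have hp0 : (0 : ℝ) < p := by exact_mod_cast hp
  unfold deltaU
  rw [Real.rpow_def_of_pos (by positivity)]
  congr 1
  ring

theorem net_mul_exp_le_deltaU {T N p : ℕ} (hT : 1 ≤ T) (hTN : T ≤ N) (hp : 1 ≤ p)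
    (hc : 128000000 * (T : ℝ) * p * Real.log (2 * T * p) ^ 2 * Real.log (2 * N * p) ^ 2 ≤ N) :
    3 * (16 * T * 5 ^ (4 * p) * Real.exp (-((1 / 200) ^ 2 * N / (32 * T)))) ≤ deltaU T N p := by
  have hT1 : (1 : ℝ) ≤ T := by exact_mod_cast hT
  have hp1 : (1 : ℝ) ≤ p := by exact_mod_cast hp
  have hTN' : (T : ℝ) ≤ N := by exact_mod_cast hTN
  have hT0 : (0 : ℝ) < T := by linarith
  rw [deltaU_eq_exp (by omega) hp]
  have hl2 := Real.log_two_gt_d9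
  have hl2' := Real.log_two_lt_d9
  set x := Real.log (2 * (T : ℝ) * p)
  set y := Real.log (2 * (N : ℝ) * p)
  have hTx : Real.log T ≤ x := Real.log_le_log hT0 (by nlinarith)
  have hx : 0.69 ≤ x := by
    have : Real.log 2 ≤ x := Real.log_le_log (by norm_num) (by nlinarith)
    linarith
  have hy : 0.69 ≤ y := by
    have : Real.log 2 ≤ y := Real.log_le_log (by norm_num) (by nlinarith)
    linarith
  set Λ := x ^ 2 * y ^ 2 with hΛ
  have hy2 : 0.47 ≤ y ^ 2 := by nlinarith
  have hx2 : 0.69 * x ≤ x ^ 2 := by nlinarith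
  have hΛx : 0.32 * x ≤ Λ := by
    calc 0.32 * x ≤ 0.69 * x * 0.47 := by nlinarith
      _ ≤ x ^ 2 * y ^ 2 := by gcongr
  have hΛ1 : 0.22 ≤ Λ := by nlinarith
  have hpΛ : Λ ≤ p * Λ := by nlinarith
  have hpΛ' : 0.22 * p ≤ p * Λ := by nlinarith
  -- The sample-size constant is `128000000 = 100 · 200² · 32`; the multiple `100 p Λ` pays for the
  -- union bound and leaves `Λ` over.
  have hexpo : 100 * (p * Λ) ≤ (1 / 200) ^ 2 * N / (32 * T) := by
    rw [le_div_iff₀ (by positivity)]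
    rw [hΛ]
    nlinarith
  have h5 : Real.log 5 ≤ 2.1 := by
    have : Real.log 5 ≤ Real.log (2 ^ 3) := Real.log_le_log (by norm_num) (by norm_num)
    rw [Real.log_pow] at this
    push_cast at this
    linarith
  have h48 : Real.log 48 ≤ 4.2 := by
    have : Real.log 48 ≤ Real.log (2 ^ 6) := Real.log_le_log (by norm_num) (by norm_num)
    rw [Real.log_pow] at this
    push_cast at this
    linarith
  have hlhs : 3 * (16 * (T : ℝ) * 5 ^ (4 * p) * Real.exp (-((1 / 200) ^ 2 * N / (32 * T))))
      = Real.exp (Real.log 48 + Real.log T + (4 * p : ℕ) * Real.log 5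
          - (1 / 200) ^ 2 * N / (32 * T)) := by
    rw [Real.exp_sub, Real.exp_add, Real.exp_add, Real.exp_log (by norm_num), Real.exp_log hT0,
      ← Real.log_pow, Real.exp_log (by positivity), Real.exp_neg]
    ring
  rw [hlhs]
  refine Real.exp_le_exp.2 ?_
  push_cast
  nlinarith

theorem measure_not_wellConditioned_le (hT : 1 ≤ T) (hTN : T ≤ N₁) (hN : N₁ ≤ N) (hp : 1 ≤ p)
    (hu : ∀ t ∈ Finset.Icc 1 N, StronglyMeasurable[ℱ t] (u t))
    (hg : ∀ t ∈ Finset.Icc 1 N, CondStdGaussian μ (u t) (ℱ (t - 1)))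
    (hN10 : (N₁ : ℝ) ≤ N / 10)
    (hc : 128000000 * (T : ℝ) * p * Real.log (2 * T * p) ^ 2 * Real.log (2 * N * p) ^ 2 ≤ N) :
    μ {ω | ω ∉ wellConditioned T N₁ N u} ≤ ENNReal.ofReal (deltaU T N p) := by
  classical
  set ws : Finset (Finset ℕ) := {Finset.Icc (N₁ + 1 - T) N, Finset.Icc (N₁ + 1 - T) (N₁ - 1),
        Finset.Icc (N + 2 - T) N} with hws
  have hsub : ∀ W ∈ ws, W ⊆ Finset.Icc 1 N := by
    intro W hW
    simp only [hws, Finset.mem_insert, Finset.mem_singleton] at hW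
    rcases hW with rfl | rfl | rfl <;> exact Finset.Icc_subset_Icc (by omega) (by omega)
  set B := 16 * (T : ℝ) * 5 ^ (4 * p) * Real.exp (-((1 / 200) ^ 2 * N / (32 * T))) with hB
  have hB0 : 0 ≤ B := by positivity
  set bad : Finset ℕ → Set Ω := fun W => {ω | ¬ ∀ v : ℕ → EuclideanSpace ℝ (Fin p),
        |convForm W T v (fun t => u t ω) - W.card * ∑ j ∈ Finset.range T, ‖v j‖ ^ 2|
          ≤ 16 * (1 / 200) * N * ∑ j ∈ Finset.range T, ‖v j‖ ^ 2} with hbad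
  calc μ {ω | ω ∉ wellConditioned T N₁ N u} ≤ μ (⋃ W ∈ ws, bad W) := by
        refine measure_mono fun ω hω => ?_
        by_contra hgood
        simp only [Set.mem_iUnion, not_exists] at hgood
        refine hω (mem_wellConditioned_of_convForm hT hTN hN hN10 fun W hW v => ?_)
        refine (not_not.1 (hgood W hW) v).trans (le_of_eq ?_)
        norm_num
    _ ≤ ∑ W ∈ ws, μ (bad W) := measure_biUnion_finset_le _ _
    _ ≤ ∑ W ∈ ws, ENNReal.ofReal B := Finset.sum_le_sum fun W hW =>
        measure_convForm_deviation_le (hsub W hW) hu hg hT (by norm_num) (by norm_num)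
    _ ≤ ((3 : ℕ) : ENNReal) * ENNReal.ofReal B := by
        rw [Finset.sum_const, nsmul_eq_mul]
        have : ws.card ≤ 3 := Finset.card_le_three
        gcongr
    _ = ENNReal.ofReal (3 * B) := by
        rw [← ENNReal.ofReal_natCast, ← ENNReal.ofReal_mul (by positivity)]
        norm_num
    _ ≤ _ := ENNReal.ofReal_le_ofReal (net_mul_exp_le_deltaU hT (hTN.trans hN) hp hc)

end DesignConcentration

end SemiPar

namespace SemiPar

/-! ### Assembling the four statements -/

section Main

theorem one_le_det_one_add_of_posSemidef {ι : Type*} [Fintype ι] [DecidableEq ι]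
    {P : Matrix ι ι ℝ} (hP : P.PosSemidef) : 1 ≤ (1 + P).det := by
  have h := hP.1.det_one_add_smul 1
  rw [one_smul] at h
  rw [h]
  calc (1 : ℝ) = ∏ _i : ι, (1 : ℝ) := by simp
    _ ≤ _ := Finset.prod_le_prod (fun _ _ => zero_le_one)
        fun i _ => by linarith [hP.eigenvalues_nonneg i]

theorem log_sqrt_det_nonneg {ι κ : Type*} [Fintype ι] [DecidableEq ι] [Fintype κ] [DecidableEq κ]
    {V : Matrix κ κ ℝ} (hV : V.PosDef) (D : Matrix ι κ ℝ) :
    0 ≤ Real.log (Real.sqrt (1 + D * V⁻¹ * Dᵀ).det) := by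
  have h := hV.inv.posSemidef.mul_mul_conjTranspose_same D
  rw [Matrix.conjTranspose_eq_transpose_of_trivial] at h
  exact Real.log_nonneg (Real.one_le_sqrt.2 (one_le_det_one_add_of_posSemidef h))

theorem sqrt_le_two_mul_sqrt {a x y : ℝ} (hx : 0 ≤ x) (hy : 0 ≤ y) (ha : a ≤ 3 * x) :
    Real.sqrt (a + y) ≤ 2 * Real.sqrt (x + y) := by
  rw [show (2 : ℝ) = Real.sqrt (2 ^ 2) by rw [Real.sqrt_sq (by norm_num)],
    ← Real.sqrt_mul (by norm_num)]
  exact Real.sqrt_le_sqrt (by linarith)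

theorem measure_not_mono {Ω : Type*} [MeasurableSpace Ω] {μ : Measure Ω} {Q R : Ω → Prop} (h : ∀ ω, Q ω → R ω) :
    μ {ω | ¬ R ω} ≤ μ {ω | ¬ Q ω} :=
  measure_mono fun ω hω hQ => hω (h ω hQ)

theorem measure_not_le_of_forall {Ω : Type*} [MeasurableSpace Ω] {μ : Measure Ω} {Q : Ω → Prop} (h : ∀ ω, Q ω) (c : ENNReal) :
    μ {ω | ¬ Q ω} ≤ c := by
  simp [h]

variable {Ω : Type*} [mΩ : MeasurableSpace Ω] {μ : Measure Ω} [IsProbabilityMeasure μ]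
  {T N₁ N p m L : ℕ}

theorem measure_selfNormalized_opNorm_le_pTilde {ℱ : Filtration ℕ mΩ} (hT : 1 ≤ T) (hTN : T ≤ N₁)
    (hN : N₁ ≤ N)
    {u : ℕ → Ω → EuclideanSpace ℝ (Fin p)} {e : ℕ → Ω → EuclideanSpace ℝ (Fin m)}
    (hu : ∀ t ∈ Finset.Icc 1 N, StronglyMeasurable[ℱ t] (u t))
    (he : ∀ t ∈ Finset.Icc N₁ N, StronglyMeasurable[ℱ (t - T)] (e t))
    (hsub : SubgaussianInputs μ ℱ N u)
    {V₀ : Matrix (Fin m) (Fin m) ℝ} (hV : V₀.PosDef) {δ : ℝ} (hδ : 0 < δ) (hδ1 : δ < 1) :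
    μ {ω | ¬ ‖(CFC.sqrt ((rowMatrix N₁ N e ω)ᵀ * rowMatrix N₁ N e ω + V₀))⁻¹
          * (rowMatrix N₁ N e ω)ᵀ * Ubar T N₁ N u ω‖
        ≤ 128 * Real.sqrt T * Real.sqrt (pTilde T p + Real.log (1 / δ)
          + Real.log (Real.sqrt (1 + rowMatrix N₁ N e ω * V₀⁻¹ * (rowMatrix N₁ N e ω)ᵀ).det))}
      ≤ ENNReal.ofReal δ := by
  rcases Nat.eq_zero_or_pos p with rfl | hp
  · refine measure_not_le_of_forall (fun ω => ?_) _
    rw [opNorm_eq_zero_of_isEmpty (Or.inr inferInstance)]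
    positivity
  refine (measure_not_mono fun ω h => h.trans ?_).trans
    (measure_selfNormalized_opNorm_le hT hTN hN hu he hsub hV hδ)
  have hlog : 0 ≤ Real.log (1 / δ) := Real.log_nonneg (by rw [le_div_iff₀ hδ]; linarith)
  have hdet := log_sqrt_det_nonneg hV (rowMatrix N₁ N e ω)
  have h2 := sqrt_le_two_mul_sqrt (pTilde_nonneg T p) (add_nonneg hlog hdet)
    (log_add_log_netCard_le hT hp)
  rw [← add_assoc, ← add_assoc] at h2
  rw [mul_assoc, mul_left_comm (128 : ℝ)]
  refine mul_le_mul_of_nonneg_left ?_ (Real.sqrt_nonneg _)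
  linarith [Real.sqrt_nonneg (pTilde T p + Real.log (1 / δ)
    + Real.log (Real.sqrt (1 + rowMatrix N₁ N e ω * V₀⁻¹ * (rowMatrix N₁ N e ω)ᵀ).det))]

theorem measure_opNorm_cross_le_pTilde {ℱ : Filtration ℕ mΩ} (hT : 1 ≤ T) (hTN : T ≤ N₁)
    (hN : N₁ ≤ N)
    {u : ℕ → Ω → EuclideanSpace ℝ (Fin p)} {e : ℕ → Ω → EuclideanSpace ℝ (Fin m)}
    (hu : ∀ t ∈ Finset.Icc 1 N, StronglyMeasurable[ℱ t] (u t))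
    (he : ∀ t ∈ Finset.Icc N₁ N, StronglyMeasurable[ℱ (t - T)] (e t))
    (hsub : SubgaussianInputs μ ℱ N u) {κ : ℝ} (hκ : 0 < κ) {δ : ℝ} (hδ : 0 < δ) (hδ1 : δ < 1) :
    μ {ω | ¬ ‖(rowMatrix N₁ N e ω)ᵀ * Ubar T N₁ N u ω‖
        ≤ 128 * Real.sqrt T * (‖rowMatrix N₁ N e ω‖ + κ)
          * Real.sqrt (pTilde T p + (m : ℝ) + Real.log (1 / δ)
            + lilOne (‖rowMatrix N₁ N e ω‖ / κ))}
      ≤ ENNReal.ofReal δ := by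
  by_cases hempty : m = 0 ∨ p = 0
  · refine measure_not_le_of_forall (fun ω => ?_) _
    rw [opNorm_eq_zero_of_isEmpty]
    · positivity
    · rcases hempty with rfl | rfl
      · exact Or.inl inferInstance
      · exact Or.inr inferInstance
  rw [not_or] at hempty
  refine (measure_not_mono fun ω h => h.trans ?_).trans
    (measure_opNorm_cross_le hT hTN hN (Nat.one_le_iff_ne_zero.2 hempty.1) hu he hsub hκ hδ hδ1)
  have hlog : 0 ≤ Real.log (1 / δ) := Real.log_nonneg (by rw [le_div_iff₀ hδ]; linarith)
  have hlil : 0 ≤ lilOne (‖rowMatrix N₁ N e ω‖ / κ) := lilOne_nonneg (by positivity)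
  have hm : (0 : ℝ) ≤ m := Nat.cast_nonneg m
  have h2 := sqrt_le_two_mul_sqrt (pTilde_nonneg T p) (add_nonneg (add_nonneg hm hlog) hlil)
    (log_add_log_netCard_le hT (Nat.one_le_iff_ne_zero.2 hempty.2))
  simp only [← add_assoc] at h2
  rw [mul_assoc, mul_assoc, mul_assoc 128, mul_assoc 128, mul_assoc, mul_left_comm,
    mul_left_comm (128 : ℝ)]
  refine mul_le_mul_of_nonneg_left ?_ (Real.sqrt_nonneg _)
  rw [mul_left_comm, mul_left_comm (128 : ℝ)]
  refine mul_le_mul_of_nonneg_left ?_ (by positivity)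
  linarith [Real.sqrt_nonneg (pTilde T p + (m : ℝ) + Real.log (1 / δ)
    + lilOne (‖rowMatrix N₁ N e ω‖ / κ))]

/-- Gaussian inputs are subgaussian, so (c) controls the failure on the well-conditioned event; the
complement of that event costs at most `deltaU`. -/
theorem measure_fixedFilter_le_of_gaussian {ℱ : Filtration ℕ mΩ} (hT : 1 ≤ T) (hTN : T ≤ N₁)
    (hN : N₁ ≤ N) {G : Matrix (Fin m) (Fin T × Fin p) ℝ}
    {u : ℕ → Ω → EuclideanSpace ℝ (Fin p)} {y e : ℕ → Ω → EuclideanSpace ℝ (Fin m)}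
    (hmodel : SemiParametricModel ℱ T N₁ N G u y e)
    (hg : ∀ t ∈ Finset.Icc 1 N, CondStdGaussian μ (u t) (ℱ (t - 1)))
    (hN10 : (N₁ : ℝ) ≤ N / 10)
    (hc : 128000000 * (T : ℝ) * p * Real.log (2 * T * p) ^ 2 * Real.log (2 * N * p) ^ 2 ≤ N)
    {δ : ℝ} (hδ : 0 < δ) (hδ1 : δ < 1) {k : ℕ → Ω → EuclideanSpace ℝ (Fin L)}
    (hk : ∀ t ∈ Finset.Icc N₁ N, StronglyMeasurable[ℱ (t - T)] (k t))
    (φ : Matrix (Fin m) (Fin L) ℝ) {κ : ℝ} (hκ : 0 < κ) :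
    μ {ω | ¬ ∀ H : Matrix (Fin m) (Fin T × Fin p) ℝ, IsFixedFilterEstimate N₁ N u y k φ ω H →
          ‖H - G‖ ≤ 128 * filterRate T N p m κ δ ‖rowMatrix N₁ N (filtered φ k e) ω‖}
      ≤ ENNReal.ofReal (δ + deltaU T N p) := by
  rcases Nat.eq_zero_or_pos p with rfl | hp
  · refine measure_not_le_of_forall (fun ω H _ => ?_) _
    rw [opNorm_eq_zero_of_isEmpty (Or.inr inferInstance)]
    exact mul_nonneg (by norm_num) (filterRate_nonneg hκ (norm_nonneg _))
  have hsub : SubgaussianInputs μ ℱ N u := fun t ht v hv =>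
    (hg t ht).subgaussianGiven (ℱ.le _)
      ((hmodel.input_adapted t ht).mono (ℱ.le _)).measurable hv
  have hdelta : 0 ≤ deltaU T N p := Real.rpow_nonneg (by positivity) _
  rw [ENNReal.ofReal_add hδ.le hdelta]
  refine le_trans (measure_mono fun ω hω => ?_) ((measure_union_le _ _).trans (add_le_add
    (measure_fixedFilter_le hT hTN hN hmodel hsub hδ hδ1 hk φ hκ)
    (measure_not_wellConditioned_le hT hTN hN hp hmodel.input_adapted hg hN10 hc)))
  by_cases hE : ω ∈ wellConditioned T N₁ N u
  · exact Or.inl ⟨hE, hω⟩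
  · exact Or.inr hE

end Main

end SemiPar

theorem mainTheorem2 :
    ∃ C c : ℝ, 0 < C ∧ 0 < c ∧
      ∀ (Ω : Type*) [mΩ : MeasurableSpace Ω] (μ : Measure Ω)
        [IsProbabilityMeasure μ] (ℱ : Filtration ℕ mΩ)
        (T N₁ N p m : ℕ) (_ : 1 ≤ T) (_ : T ≤ N₁) (_ : N₁ ≤ N)
        (G : Matrix (Fin m) (Fin T × Fin p) ℝ)
        (u : ℕ → Ω → EuclideanSpace ℝ (Fin p)) (y e : ℕ → Ω → EuclideanSpace ℝ (Fin m))
        (_ : SemiPar.SemiParametricModel ℱ T N₁ N G u y e)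
        (δ : ℝ) (_ : 0 < δ) (_ : δ < 1),
        ((∀ t ∈ Finset.Icc 1 N, SemiPar.CondMeanZero μ (u t) (ℱ (t - 1)) ∧
            SemiPar.CondSubgaussian μ (u t) (ℱ (t - 1))) →
          -- self-normalized bound
          (∀ V₀ : Matrix (Fin m) (Fin m) ℝ, V₀.PosDef →
            μ {ω | ¬ ‖(CFC.sqrt ((SemiPar.rowMatrix N₁ N e ω)ᵀ * SemiPar.rowMatrix N₁ N e ω + V₀))⁻¹
                    * (SemiPar.rowMatrix N₁ N e ω)ᵀ * SemiPar.Ubar T N₁ N u ω‖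
                ≤ C * Real.sqrt T * Real.sqrt (SemiPar.pTilde T p + Real.log (1 / δ)
                    + Real.log (Real.sqrt (1 + SemiPar.rowMatrix N₁ N e ω * V₀⁻¹
                        * (SemiPar.rowMatrix N₁ N e ω)ᵀ).det))}
              ≤ ENNReal.ofReal δ) ∧
          -- operator-norm bound
          (∀ κ : ℝ, 0 < κ →
            μ {ω | ¬ (SemiPar.sigmaMin (SemiPar.Ubar T N₁ N u ω) ^ 2
                      * ‖SemiPar.pinv (SemiPar.Ubar T N₁ N u ω) * SemiPar.rowMatrix N₁ N e ω‖
                    ≤ ‖(SemiPar.rowMatrix N₁ N e ω)ᵀ * SemiPar.Ubar T N₁ N u ω‖ ∧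
                  ‖(SemiPar.rowMatrix N₁ N e ω)ᵀ * SemiPar.Ubar T N₁ N u ω‖
                    ≤ C * Real.sqrt T * (‖SemiPar.rowMatrix N₁ N e ω‖ + κ)
                      * Real.sqrt (SemiPar.pTilde T p + (m : ℝ) + Real.log (1 / δ)
                          + SemiPar.lilOne (‖SemiPar.rowMatrix N₁ N e ω‖ / κ)))}
              ≤ ENNReal.ofReal δ) ∧
          -- fixed filter, on the event that the design is well conditioned
          (∀ (L : ℕ) (k : ℕ → Ω → EuclideanSpace ℝ (Fin L)),
            (∀ t ∈ Finset.Icc N₁ N, StronglyMeasurable[ℱ (t - T)] (k t)) →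
            ∀ (φ : Matrix (Fin m) (Fin L) ℝ) (κ : ℝ), 0 < κ →
              μ {ω | ω ∈ SemiPar.wellConditioned T N₁ N u ∧
                  ¬ ∀ H : Matrix (Fin m) (Fin T × Fin p) ℝ,
                    SemiPar.IsFixedFilterEstimate N₁ N u y k φ ω H →
                    ‖H - G‖ ≤ C * SemiPar.filterRate T N p m κ δ
                      ‖SemiPar.rowMatrix N₁ N (SemiPar.filtered φ k e) ω‖}
                ≤ ENNReal.ofReal δ)) ∧
        -- fixed filter, Gaussian inputs, unconditionally once the sample size is large
        ((∀ t ∈ Finset.Icc 1 N, SemiPar.CondStdGaussian μ (u t) (ℱ (t - 1))) →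
          (N₁ : ℝ) ≤ (N : ℝ) / 10 →
          c * (T : ℝ) * (p : ℝ) * Real.log (2 * (T : ℝ) * (p : ℝ)) ^ 2
            * Real.log (2 * (N : ℝ) * (p : ℝ)) ^ 2 ≤ (N : ℝ) →
          ∀ (L : ℕ) (k : ℕ → Ω → EuclideanSpace ℝ (Fin L)),
            (∀ t ∈ Finset.Icc N₁ N, StronglyMeasurable[ℱ (t - T)] (k t)) →
            ∀ (φ : Matrix (Fin m) (Fin L) ℝ) (κ : ℝ), 0 < κ →
              μ {ω | ¬ ∀ H : Matrix (Fin m) (Fin T × Fin p) ℝ,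
                    SemiPar.IsFixedFilterEstimate N₁ N u y k φ ω H →
                    ‖H - G‖ ≤ C * SemiPar.filterRate T N p m κ δ
                      ‖SemiPar.rowMatrix N₁ N (SemiPar.filtered φ k e) ω‖}
                ≤ ENNReal.ofReal (δ + SemiPar.deltaU T N p)) := by
  -- The value `128` is dictated by the fixed-filter bound, and (a) and (b) are stated with the same
  -- constant although `8` and `64` come out of their estimates.
  refine ⟨128, 128000000, by norm_num, by norm_num, ?_⟩
  intro Ω mΩ μ _ ℱ T N₁ N p m hT hTN hN G u y e hmodel δ hδ hδ1
  refine ⟨fun hu => ?_, fun hg hN10 hc L k hk φ κ hκ =>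
    SemiPar.measure_fixedFilter_le_of_gaussian hT hTN hN hmodel hg hN10 hc hδ hδ1 hk φ hκ⟩
  have hsub : SemiPar.SubgaussianInputs μ ℱ N u := fun t ht v hv =>
    (hu t ht).2.subgaussianGiven (ℱ.le _) hv
  refine ⟨fun V₀ hV => SemiPar.measure_selfNormalized_opNorm_le_pTilde hT hTN hN
      hmodel.input_adapted hmodel.error_adapted hsub hV hδ hδ1,
    fun κ hκ => (SemiPar.measure_not_mono fun _ h =>
      ⟨SemiPar.sigmaMin_sq_mul_opNorm_pinv_mul_le _ _, h⟩).trans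
      (SemiPar.measure_opNorm_cross_le_pTilde hT hTN hN hmodel.input_adapted
        hmodel.error_adapted hsub hκ hδ hδ1),
    fun L k hk φ κ hκ =>
      SemiPar.measure_fixedFilter_le hT hTN hN hmodel hsub hδ hδ1 hk φ hκ⟩
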